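/- **Theorem 3 (Posterior ratio under $\mathcal S_{dc}$).** Let $\mu_2,\beta\in\mathbb R$, $\sigma_2>0$, and let $\boldsymbol X$ consist of $N$ independent samples of $(X_1,X_2)$, where $X_1\sim\mathrm{Bernoulli}(\tfrac12)$ and $X_2\mid X_1=x_1\sim\mathcal N(\mu_2+\beta x_1,\sigma_2^2)$. Let $\mathcal G_1$ be the graph $X_1\to X_2$ and $\mathcal G_0$ the graph on $X_1,X_2$ without edge, with positive prior probabilities, so that $P(\mathcal G\mid\boldsymbol X)\propto P(\boldsymbol X\mid\mathcal G)P(\mathcal G)$. (RAG.) Let $P(\boldsymbol X\mid\mathcal G)$ be the BGe marginal likelihood: both variables are modelled as bivariate Gaussian with mean $\boldsymbol\mu$ and precision matrix $\boldsymbol W$, with prior $\boldsymbol W\sim\mathcal W_2((tI_2)^{-1},\alpha_w)$, $\boldsymbol\mu\mid\boldsymbol W\sim\mathcal N(0,(\alpha_\mu\boldsymbol W)^{-1})$, where $t>0$, $\alpha_\mu>0$, $\alpha_w>3$; $P(\boldsymbol X\mid\mathcal G_1)=\int P(\boldsymbol X\mid\boldsymbol\mu,\boldsymbol W)\,dP(\boldsymbol\mu,\boldsymbol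 W)$ is the marginal likelihood of the whole data, and $P(\boldsymbol X\mid\mathcal G_0)$ is the product of the marginal likelihoods, in this same model, of the two columns of the data. Then $\log\frac{P(\mathcal G_1\mid\boldsymbol X)}{P(\mathcal G_0\mid\boldsymbol X)}$ is integrable for every $N$, and $r_{10}=\frac1N\,\mathbb E\Big[\log\frac{P(\mathcal G_1\mid\boldsymbol X)}{P(\mathcal G_0\mid\boldsymbol X)}\Big]$ satisfies $$\lim_{N\to\infty} r_{10}=\frac12\log\Big(1+\frac{\beta^2}{4\sigma_2^2}\Big).$$ (DISC.) Let $m$ be the median of the distribution of $X_2$, and let $\boldsymbol X'$ be obtained from $\boldsymbol X$ by keeping the binary variable, $X_1'=X_1$, and putting $X_2'=1$ if $X_2\ge m$ and $X_2'=0$ otherwise. Let $P(\boldsymbol X'\mid\mathcal G)$ be the BDe marginal likelihood: the probabilities of the cells $(1,1),(1,0),(0,1),(0,0)$ have a Dirichlet prior with parameters $\alpha_1,\dots,\alpha_4>0$; $P(\boldsymbol X'\mid\mathcal G_1)$ is the marginal likelihood of the whole data, and $P(\boldsymbol X'\mid\mathcal G_0)$ is the product of the marginal likelihoods of the two columns,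 whose success probabilities have the priors induced by the Dirichlet prior. Then $\tilde r_{10}=\frac1N\sum_{\boldsymbol x}\log\frac{P(\mathcal G_1\mid\boldsymbol X'=\boldsymbol x)}{P(\mathcal G_0\mid\boldsymbol X'=\boldsymbol x)}\,P(\boldsymbol X'=\boldsymbol x)$ satisfies $$\lim_{N\to\infty}\tilde r_{10}=\log 4+2\tilde p_{11}\log\tilde p_{11}+(1-2\tilde p_{11})\log\big(\tfrac12-\tilde p_{11}\big),\qquad \tilde p_{11}=\frac12\int_{-\beta/(2\sigma_2)}^{\infty}\frac1{\sqrt{2\pi}}e^{-x^2/2}\,dx.$$ -/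

import Mathlib

open MeasureTheory ProbabilityTheory Filter Topology

noncomputable section

namespace HybridBN

/-! ### Graphs on two nodes, marginal likelihoods and posterior probabilities -/

/-- The two equivalence classes of directed acyclic graphs on the nodes `X₁`, `X₂`:
`empty` is the graph without edge, `edge` is the graph `X₁ → X₂`. -/
inductive Graph
  | empty
  | edge

/-- Marginal likelihood `∫ ∏ₖ f(xₖ ∣ θ) dΠ(θ)` of a sample `x` of size `N`, for a family
`f(· ∣ θ)` of probability (density or mass) functions and a prior `Π` on the parameter. -/
def marginalLikelihood {Θ S : Type*} [MeasurableSpace Θ] (prior : Measure Θ) (f : Θ → S → ℝ)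
    {N : ℕ} (x : Fin N → S) : ℝ :=
  ∫ θ, ∏ k, f θ (x k) ∂prior

/-- Marginal likelihood `P(X ∣ G)` of the data given a graph.  The joint family is `f`, with
marginal families `f₁` for `X₁` and `f₂` for `X₂`; `prior` is the prior on the parameter of the
joint family.  Under `X₁ → X₂` the joint family is unrestricted.  Under the graph without
edge the two coordinates have independent parameters, each carrying the distribution induced by
`prior` (global parameter independence and parameter modularity). -/
def graphLikelihood {Θ S₁ S₂ : Type*} [MeasurableSpace Θ] (prior : Measure Θ)
    (f : Θ → S₁ × S₂ → ℝ) (f₁ : Θ → S₁ → ℝ) (f₂ : Θ → S₂ → ℝ) {N : ℕ} (x : Fin N → S₁ × S₂) :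
    Graph → ℝ
  | Graph.edge => marginalLikelihood prior f x
  | Graph.empty =>
      marginalLikelihood prior f₁ (fun k => (x k).1) *
        marginalLikelihood prior f₂ (fun k => (x k).2)

/-- Posterior probability `P(G ∣ X)` from the likelihoods `L G = P(X ∣ G)` and the prior weights
`q G`, which are proportional to `P(G)`, by Bayes' formula. -/
def posterior (q L : Graph → ℝ) (G : Graph) : ℝ :=
  L G * q G / (L Graph.empty * q Graph.empty + L Graph.edge * q Graph.edge)

/-- Log posterior ratio `log (P(G₁ ∣ X) / P(G₀ ∣ X))`. -/
def logPosteriorRatio (q L : Graph → ℝ) : ℝ :=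
  Real.log (posterior q L Graph.edge / posterior q L Graph.empty)

/-! ### The Gaussian model with Normal-Wishart prior (BGe score) -/

/-- Multivariate gamma function `Γₙ(a) = π^{n(n-1)/4} ∏_{j=1}^n Γ(a + (1-j)/2)`. -/
def multivariateGamma (n : ℕ) (a : ℝ) : ℝ :=
  Real.pi ^ ((n : ℝ) * ((n : ℝ) - 1) / 4) *
    ∏ j ∈ Finset.Icc 1 n, Real.Gamma (a + (1 - (j : ℝ)) / 2)

/-- Density at `W` (on positive definite matrices) of the Wishart distribution `𝒲ₙ(T⁻¹, αw)`. -/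
def wishartPDF {n : ℕ} (T : Matrix (Fin n) (Fin n) ℝ) (αw : ℝ)
    (W : Matrix (Fin n) (Fin n) ℝ) : ℝ :=
  W.det ^ ((αw - n - 1) / 2) /
      (2 ^ (αw * n / 2) * multivariateGamma n (αw / 2) / T.det ^ (αw / 2)) *
    Real.exp (-(1 / 2) * (T * W).trace)

/-- Density at `x` of the multivariate normal distribution with mean `m` and
precision matrix `W`. -/
def normalPDF {n : ℕ} (m : Fin n → ℝ) (W : Matrix (Fin n) (Fin n) ℝ) (x : Fin n → ℝ) : ℝ :=
  W.det ^ (1 / 2 : ℝ) / (2 * Real.pi) ^ ((n : ℝ) / 2) *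
    Real.exp (-(1 / 2) * ((x - m) ⬝ᵥ (W.mulVec (x - m))))

/-- The vector with coordinates `m.1`, `m.2`. -/
def vec (m : ℝ × ℝ) : Fin 2 → ℝ := ![m.1, m.2]

/-- The symmetric matrix with entries `W₁₁ = w.1`, `W₁₂ = w.2.1`, `W₂₂ = w.2.2`. -/
def symMat (w : ℝ × ℝ × ℝ) : Matrix (Fin 2) (Fin 2) ℝ := !![w.1, w.2.1; w.2.1, w.2.2]

/-- Normal-Wishart prior on (mean, precision matrix) for two variables:
`W ∼ 𝒲₂((t I)⁻¹, αw)` and, given `W`, the mean is normal with mean `0` and precision `αμ W`. -/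
def normalWishart (αμ αw t : ℝ) : Measure ((ℝ × ℝ) × (ℝ × ℝ × ℝ)) :=
  (volume.restrict {θ | (symMat θ.2).PosDef}).withDensity fun θ =>
    ENNReal.ofReal
      (wishartPDF (t • (1 : Matrix (Fin 2) (Fin 2) ℝ)) αw (symMat θ.2) *
        normalPDF 0 (αμ • symMat θ.2) (vec θ.1))

/-- Joint density of `(X₁, X₂)` in the Gaussian model. -/
def gaussJoint (θ : (ℝ × ℝ) × (ℝ × ℝ × ℝ)) (x : ℝ × ℝ) : ℝ :=
  normalPDF (vec θ.1) (symMat θ.2) (vec x)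

/-- Density of the coordinate `i` in the Gaussian model: it is normal with mean `mᵢ` and variance
`(W⁻¹)ᵢᵢ`. -/
def gaussMarginal (i : Fin 2) (θ : (ℝ × ℝ) × (ℝ × ℝ × ℝ)) (y : ℝ) : ℝ :=
  gaussianPDFReal (vec θ.1 i) ((symMat θ.2)⁻¹ i i).toNNReal y

/-- `P(X ∣ G)` under the BGe score. -/
def bgeLikelihood (αμ αw t : ℝ) {N : ℕ} (x : Fin N → ℝ × ℝ) : Graph → ℝ :=
  graphLikelihood (normalWishart αμ αw t) gaussJoint (gaussMarginal 0) (gaussMarginal 1) x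

/-! ### The binary model with Dirichlet prior (BDe score) -/

/-- Cell probabilities of a pair of binary variables (`true` is the value `1`):
`θ.1 = P(1,1)`, `θ.2.1 = P(1,0)`, `θ.2.2 = P(0,1)`. -/
def cellProb (θ : ℝ × ℝ × ℝ) : Bool × Bool → ℝ
  | (true, true) => θ.1
  | (true, false) => θ.2.1
  | (false, true) => θ.2.2
  | (false, false) => 1 - θ.1 - θ.2.1 - θ.2.2

/-- Mass function of the first binary variable. -/
def cellMarginal₁ (θ : ℝ × ℝ × ℝ) (i : Bool) : ℝ := ∑ j, cellProb θ (i, j)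

/-- Mass function of the second binary variable. -/
def cellMarginal₂ (θ : ℝ × ℝ × ℝ) (j : Bool) : ℝ := ∑ i, cellProb θ (i, j)

/-- Dirichlet prior with parameters `α` on the cell probabilities
of `(1,1)`, `(1,0)`, `(0,1)`, `(0,0)`. -/
def dirichletPrior (α : Fin 4 → ℝ) : Measure (ℝ × ℝ × ℝ) :=
  (volume.restrict {θ | ∀ c, 0 < cellProb θ c}).withDensity fun θ =>
    ENNReal.ofReal
      (((∏ i, Real.Gamma (α i)) / Real.Gamma (∑ i, α i))⁻¹ *
        (cellProb θ (true, true) ^ (α 0 - 1) * cellProb θ (true, false) ^ (α 1 - 1) *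
          cellProb θ (false, true) ^ (α 2 - 1) * cellProb θ (false, false) ^ (α 3 - 1)))

/-- `P(X' ∣ G)` under the BDe score. -/
def bdeLikelihood (α : Fin 4 → ℝ) {N : ℕ} (x : Fin N → Bool × Bool) : Graph → ℝ :=
  graphLikelihood (dirichletPrior α) cellProb cellMarginal₁ cellMarginal₂ x

/-! ### The data -/

/-- The conditional law of `X₂` given `X₁ = x₁`: normal, mean `μ₂ + β x₁`, variance `σ₂²`. -/
def sdcKernel (μ₂ β σ₂ : ℝ) : Kernel ℝ ℝ where
  toFun x₁ := gaussianReal (μ₂ + β * x₁) (σ₂ ^ 2).toNNReal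
  measurable' :=
    measurable_gaussianReal.comp
      (((measurable_id.const_mul β).const_add μ₂).prodMk measurable_const)

/-- The law of `(X₁, X₂)` when `X₁` is Bernoulli with parameter `p` (values `1` and `0`) and
`X₂ ∣ X₁ = x₁` is normal with mean `μ₂ + β x₁` and variance `σ₂²`. -/
def sdcLaw (p : unitInterval) (μ₂ β σ₂ : ℝ) : Measure (ℝ × ℝ) :=
  (bernoulliMeasure (1 : ℝ) 0 p) ⊗ₘ (sdcKernel μ₂ β σ₂)

/-- The law of `N` independent samples from `P`. -/
def sampleLaw {S : Type*} [MeasurableSpace S] (P : Measure S) (N : ℕ) : Measure (Fin N → S) :=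
  Measure.pi fun _ => P

/-- `m` is a median of the probability measure `ν` on the real line. -/
def IsMedian (ν : Measure ℝ) (m : ℝ) : Prop :=
  1 / 2 ≤ ν (Set.Iic m) ∧ 1 / 2 ≤ ν (Set.Ici m)

/-- Discretization of a pair whose first coordinate is binary already: the second coordinate
becomes `1` if it is at least the cutting point `m` and `0` otherwise. -/
def discretize (m : ℝ) (x : ℝ × ℝ) : Bool × Bool :=
  open Classical in (decide (x.1 = 1), decide (m ≤ x.2))

/-! ### Normalized expected log posterior ratios -/

/-- The expected log posterior ratio per sample, BGe score on `N` samples from `P`. -/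
def ragRatio (q : Graph → ℝ) (αμ αw t : ℝ) (P : Measure (ℝ × ℝ)) (N : ℕ) : ℝ :=
  1 / (N : ℝ) * ∫ x, logPosteriorRatio q (bgeLikelihood αμ αw t x) ∂(sampleLaw P N)

/-- The expected log posterior ratio per sample, BDe score on the discretization with cutting
point `m` of `N` samples from `P`. -/
def discRatio (q : Graph → ℝ) (α : Fin 4 → ℝ) (m : ℝ) (P : Measure (ℝ × ℝ)) (N : ℕ) : ℝ :=
  1 / (N : ℝ) * ∑ y : Fin N → Bool × Bool,
    logPosteriorRatio q (bdeLikelihood α y) *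
      (sampleLaw P N).real {x | ∀ k, discretize m (x k) = y k}

end HybridBN

end

open HybridBN

open HybridBN

/-! Both priors are conjugate, so every marginal likelihood is explicit: powers of the entries and
determinant of a posterior scale matrix for BGe, gamma functions of cell counts for BDe. After
division by `N`, the log ratio is, up to a deterministic error tending to zero, a function of `N⁻¹`
and of finitely many sample means. For BGe this function tends to `½ log (S₁₁ S₂₂ / det S)` with `S`
the covariance matrix, the mutual information of a Gaussian pair with that covariance. For BDe it is
the mutual information of the empirical 2×2 table. The limits are the values at the true means.

The normal-Wishart integral becomes elementary in the Schur coordinates `a = W₁₁`, `b = W₁₂`, `e =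
W₂₂ - b² / a`, where `det W = a e`: the means and `b` integrate as Gaussians, `e` and `a` as gamma
variables (`lintegral_schur`, `lintegral_normalWishart_kernel`). The Dirichlet integral reduces
likewise to three beta integrals (`lintegral_openSimplex`).

The law of large numbers alone does not give convergence of expectations, because the logarithms are
unbounded. The prior scale `t I` keeps the posterior scale matrix away from degeneracy, so the
normalized ratio is at most a constant times `(1 + log N) (1 + ∑ |sample means|)`. Near the true
means continuity suffices. Away from them this bound is at most a constant times `(1 + log N)` times
the squared deviation, whose expectation is of order `1 / N`. This is
`tendsto_integral_of_sampleMean`, which serves both scores; for BDe its growth condition is trivial,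
as mutual information is bounded.

It remains to evaluate. The covariance matrix of the pair has variances `1/4` and `σ₂² + β²/4` and
determinant `σ₂²/4`. The median is the midpoint of the two conditional means, so the table of the
discretized pair is `(p, ½ - p, ½ - p, p)` with a normal tail `2p`. -/

/-! ### Gaussian and gamma integrals, and the normal-Wishart integral in Schur coordinates. -/

lemma lintegral_ofReal_exp_neg_sq {c : ℝ} (hc : 0 < c) (x₀ : ℝ) :
    ∫⁻ x : ℝ, ENNReal.ofReal (Real.exp (-(c * (x - x₀) ^ 2 / 2))) =
      ENNReal.ofReal √(2 * Real.pi / c) := by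
  have h := lintegral_sub_right_eq_self (μ := (volume : Measure ℝ))
    (fun x : ℝ => ENNReal.ofReal (Real.exp (-(c * x ^ 2 / 2)))) x₀
  rw [h]
  have h2 : (fun x : ℝ => Real.exp (-(c * x ^ 2 / 2))) = fun x => Real.exp (-(c / 2) * x ^ 2) := by
    ext x; congr 1; ring
  rw [← ofReal_integral_eq_lintegral_ofReal]
  · rw [h2, integral_gaussian]
    congr 2; field_simp
  · rw [h2]; exact integrable_exp_neg_mul_sq (by positivity)
  · exact ae_of_all _ fun x => (Real.exp_pos _).le

lemma lintegral_Ioi_ofReal_rpow_mul_exp {s r : ℝ} (hs : 0 < s) (hr : 0 < r) :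
    ∫⁻ x in Set.Ioi (0 : ℝ), ENNReal.ofReal (x ^ (s - 1) * Real.exp (-(r * x))) =
      ENNReal.ofReal ((1 / r) ^ s * Real.Gamma s) := by
  rw [← Real.integral_rpow_mul_exp_neg_mul_Ioi hs hr, ofReal_integral_eq_lintegral_ofReal]
  · have := integrableOn_rpow_mul_exp_neg_mul_rpow (p := 1) (s := s - 1) (b := r)
      (by linarith) one_pos hr
    refine this.congr_fun (fun x _ => ?_) measurableSet_Ioi
    simp
  · refine (ae_restrict_iff' measurableSet_Ioi).2 (ae_of_all _ fun x hx => ?_)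
    have : (0 : ℝ) < x := hx
    positivity

lemma measurableSet_posDef :
    MeasurableSet {θ : (ℝ × ℝ) × (ℝ × ℝ × ℝ) | 0 < θ.2.1 ∧ 0 < θ.2.1 * θ.2.2.2 - θ.2.2.1 ^ 2} :=
  (measurableSet_lt (f := fun _ : (ℝ × ℝ) × (ℝ × ℝ × ℝ) => (0 : ℝ)) (g := fun θ => θ.2.1)
      (by fun_prop) (by fun_prop)).inter
      (measurableSet_lt (f := fun _ : (ℝ × ℝ) × (ℝ × ℝ × ℝ) => (0 : ℝ))
        (g := fun θ => θ.2.1 * θ.2.2.2 - θ.2.2.1 ^ 2) (by fun_prop) (by fun_prop))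

/-- Integration over a mean `m ∈ ℝ²` and a positive definite matrix with entries `a`, `b`, `d`,
in the coordinates `m`, `a`, `b` and the Schur complement `e = d - b² / a`. -/
lemma lintegral_schur {Φ : (ℝ × ℝ) × (ℝ × ℝ × ℝ) → ENNReal} (hΦ : Measurable Φ) :
    ∫⁻ θ in {θ : (ℝ × ℝ) × (ℝ × ℝ × ℝ) | 0 < θ.2.1 ∧ 0 < θ.2.1 * θ.2.2.2 - θ.2.2.1 ^ 2}, Φ θ =
      ∫⁻ a in Set.Ioi (0 : ℝ), ∫⁻ b, ∫⁻ e in Set.Ioi (0 : ℝ), ∫⁻ m₂, ∫⁻ m₁,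
        Φ ((m₁, m₂), (a, b, e + b ^ 2 / a)) := by
  have hS := measurableSet_posDef
  rw [← lintegral_indicator hS]
  set S := {θ : (ℝ × ℝ) × (ℝ × ℝ × ℝ) | 0 < θ.2.1 ∧ 0 < θ.2.1 * θ.2.2.2 - θ.2.2.1 ^ 2} with hSdef
  have hG : Measurable (S.indicator Φ) := hΦ.indicator hS
  refine (lintegral_prod_symm _ hG.aemeasurable).trans ?_
  have hG2 : Measurable fun w : ℝ × ℝ × ℝ => ∫⁻ m : ℝ × ℝ, S.indicator Φ (m, w) :=
    hG.lintegral_prod_left'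
  refine (lintegral_prod _ hG2.aemeasurable).trans ?_
  rw [← lintegral_indicator measurableSet_Ioi]
  refine lintegral_congr fun a => ?_
  have hG3 : Measurable fun w : ℝ × ℝ => ∫⁻ m : ℝ × ℝ, S.indicator Φ (m, (a, w)) :=
    hG2.comp (by fun_prop)
  refine (lintegral_prod _ hG3.aemeasurable).trans ?_
  by_cases ha : 0 < a
  · rw [Set.indicator_of_mem (Set.mem_Ioi.2 ha)]
    refine lintegral_congr fun b => ?_
    -- For fixed `a` and `b` the passage from `d` to `e` is a translation, so there is no Jacobian;
    -- positivity of the determinant becomes `0 < e`.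
    rw [← lintegral_add_right_eq_self _ (b ^ 2 / a), ← lintegral_indicator measurableSet_Ioi]
    refine lintegral_congr fun e => ?_
    have key : 0 < a * (e + b ^ 2 / a) - b ^ 2 ↔ 0 < e := by
      have : a * (e + b ^ 2 / a) - b ^ 2 = a * e := by field_simp; ring
      rw [this, mul_pos_iff_of_pos_left ha]
    by_cases he : 0 < e
    · rw [Set.indicator_of_mem (Set.mem_Ioi.2 he)]
      have : ∀ m : ℝ × ℝ, S.indicator Φ (m, (a, b, e + b ^ 2 / a)) =
          Φ (m, (a, b, e + b ^ 2 / a)) := fun m =>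
        Set.indicator_of_mem (s := S) ⟨ha, key.2 he⟩ _
      simp_rw [this]
      exact lintegral_prod_symm _ (hΦ.comp (by fun_prop)).aemeasurable
    · rw [Set.indicator_of_notMem (by simpa using he)]
      have : ∀ m : ℝ × ℝ, S.indicator Φ (m, (a, b, e + b ^ 2 / a)) = 0 := fun m =>
        Set.indicator_of_notMem (fun h => he (key.1 h.2)) _
      simp [this]
  · rw [Set.indicator_of_notMem (by simpa using ha)]
    have : ∀ (m : ℝ × ℝ) (w : ℝ × ℝ), S.indicator Φ (m, (a, w)) = 0 := fun m w =>
        Set.indicator_of_notMem (fun h => ha h.1) _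
    simp [this]

/-- Integral of a normal-Wishart kernel in two variables in the coordinates of
`lintegral_schur`. -/
lemma lintegral_normalWishart_kernel {p q t c₁ c₂ A B C Q : ℝ} (z : ℝ → ℝ) (z₂ : ℝ)
    (hp : -1 < p) (hq : -(1 / 2) < q) (ht : 0 < t) (hc₁ : 0 < c₁) (hc₂ : 0 < c₂)
    (hC : 0 ≤ C) (hQ : 0 ≤ Q) (hdet : 0 < (t + A) * (t + C) - B ^ 2) :
    ∫⁻ a in Set.Ioi (0 : ℝ), ∫⁻ b, ∫⁻ e in Set.Ioi (0 : ℝ), ∫⁻ m₂ : ℝ, ∫⁻ m₁ : ℝ,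
      ENNReal.ofReal (a ^ p * e ^ q * Real.exp (-(t * (a + e + b ^ 2 / a) +
        a * (c₁ * (m₁ + b / a * m₂ - z (b / a)) ^ 2 +
          (A + 2 * B * (b / a) + C * (b / a) ^ 2)) +
        e * (c₂ * (m₂ - z₂) ^ 2 + Q)) / 2)) =
    ENNReal.ofReal (√(2 * Real.pi / c₁) * √(2 * Real.pi / c₂) * √(2 * Real.pi / (t + C)) *
      ((2 * (t + C) / ((t + A) * (t + C) - B ^ 2)) ^ (p + 1) * Real.Gamma (p + 1)) *
      ((2 / (t + Q)) ^ (q + 1 / 2) * Real.Gamma (q + 1 / 2))) := by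
  have htC : 0 < t + C := by linarith
  have htQ : 0 < t + Q := by linarith
  set K := √(2 * Real.pi / c₁) * √(2 * Real.pi / c₂) with hK
  have hK0 : 0 ≤ K := by positivity
  -- Integrate out the means: `m₁` is Gaussian of precision `a c₁` around a point depending on `m₂`
  -- and `b / a`, which does not affect the integral; then `m₂` has precision `e c₂`. Each costs a
  -- factor `a ^ (-1/2)` or `e ^ (-1/2)`, after which `e` separates from `(a, b)`.
  have h1 : ∀ a ∈ Set.Ioi (0 : ℝ), ∀ b, ∀ e ∈ Set.Ioi (0 : ℝ), ∫⁻ m₂ : ℝ, ∫⁻ m₁ : ℝ,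
      ENNReal.ofReal (a ^ p * e ^ q * Real.exp (-(t * (a + e + b ^ 2 / a) +
        a * (c₁ * (m₁ + b / a * m₂ - z (b / a)) ^ 2 +
          (A + 2 * B * (b / a) + C * (b / a) ^ 2)) +
        e * (c₂ * (m₂ - z₂) ^ 2 + Q)) / 2)) =
      ENNReal.ofReal (K * (a ^ (p - 1 / 2) *
        Real.exp (-((t + A) * a + 2 * B * b + (t + C) * b ^ 2 / a) / 2))) *
        ENNReal.ofReal (e ^ (q + 1 / 2 - 1) * Real.exp (-((t + Q) / 2 * e))) := by
    intro a ha b e he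
    have ha : 0 < a := ha
    have he : 0 < e := he
    have e1 : ∀ m₂ m₁ : ℝ, ENNReal.ofReal (a ^ p * e ^ q *
        Real.exp (-(t * (a + e + b ^ 2 / a) +
        a * (c₁ * (m₁ + b / a * m₂ - z (b / a)) ^ 2 +
          (A + 2 * B * (b / a) + C * (b / a) ^ 2)) +
        e * (c₂ * (m₂ - z₂) ^ 2 + Q)) / 2)) =
      ENNReal.ofReal (a ^ p * e ^ q * Real.exp (-(t * (a + e + b ^ 2 / a) +
        a * (A + 2 * B * (b / a) + C * (b / a) ^ 2) + e * Q) / 2)) *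
        ENNReal.ofReal (Real.exp (-(e * c₂ * (m₂ - z₂) ^ 2 / 2))) *
        ENNReal.ofReal (Real.exp (-(a * c₁ * (m₁ - (z (b / a) - b / a * m₂)) ^ 2 / 2))) := by
      intro m₂ m₁
      rw [← ENNReal.ofReal_mul (by positivity), ← ENNReal.ofReal_mul (by positivity),
        mul_assoc (a ^ p * e ^ q), ← Real.exp_add, mul_assoc (a ^ p * e ^ q), ← Real.exp_add]
      congr 3; ring
    simp_rw [e1]
    have hm : ∀ x : ℝ, Measurable fun m₁ : ℝ =>
        ENNReal.ofReal (Real.exp (-(a * c₁ * (m₁ - x) ^ 2 / 2))) := fun x => by fun_prop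
    simp_rw [lintegral_const_mul _ (hm _), lintegral_ofReal_exp_neg_sq (mul_pos ha hc₁)]
    rw [lintegral_mul_const _ (by fun_prop), lintegral_const_mul _ (by fun_prop),
      lintegral_ofReal_exp_neg_sq (mul_pos he hc₂), ← ENNReal.ofReal_mul (by positivity),
      ← ENNReal.ofReal_mul (by positivity), ← ENNReal.ofReal_mul (by positivity)]
    congr 1
    have r1 : √(2 * Real.pi / (a * c₁)) = √(2 * Real.pi / c₁) * a ^ (-(1 / 2) : ℝ) := by
      rw [mul_comm a c₁, ← div_div, Real.sqrt_div (by positivity), Real.rpow_neg ha.le,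
        ← Real.sqrt_eq_rpow]; rfl
    have r2 : √(2 * Real.pi / (e * c₂)) = √(2 * Real.pi / c₂) * e ^ (-(1 / 2) : ℝ) := by
      rw [mul_comm e c₂, ← div_div, Real.sqrt_div (by positivity), Real.rpow_neg he.le,
        ← Real.sqrt_eq_rpow]; rfl
    have r3 : a ^ (p - 1 / 2) = a ^ p * a ^ (-(1 / 2) : ℝ) := by
      rw [← Real.rpow_add ha]; congr 1
    have r4 : e ^ (q + 1 / 2 - 1) = e ^ q * e ^ (-(1 / 2) : ℝ) := by
      rw [← Real.rpow_add he]; congr 1; ring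
    have r5 : Real.exp (-(t * (a + e + b ^ 2 / a) +
        a * (A + 2 * B * (b / a) + C * (b / a) ^ 2) + e * Q) / 2) =
        Real.exp (-((t + A) * a + 2 * B * b + (t + C) * b ^ 2 / a) / 2) *
          Real.exp (-((t + Q) / 2 * e)) := by
      rw [← Real.exp_add]; congr 1; field_simp; ring
    rw [r1, r2, r3, r4, r5, hK]; ring
  -- The variable `e` gives a gamma integral of rate `(t + Q) / 2`. Completing the square in `b`
  -- leaves a Gaussian of precision `(t + C) / a`, whose mass returns a factor `a ^ (1/2)`, and a
  -- gamma kernel in `a` whose rate is half the Schur complement of `t + C`.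
  have h2 : ∀ a ∈ Set.Ioi (0 : ℝ), ∫⁻ b, ∫⁻ e in Set.Ioi (0 : ℝ), ∫⁻ m₂ : ℝ, ∫⁻ m₁ : ℝ,
      ENNReal.ofReal (a ^ p * e ^ q * Real.exp (-(t * (a + e + b ^ 2 / a) +
        a * (c₁ * (m₁ + b / a * m₂ - z (b / a)) ^ 2 +
          (A + 2 * B * (b / a) + C * (b / a) ^ 2)) +
        e * (c₂ * (m₂ - z₂) ^ 2 + Q)) / 2)) =
      ENNReal.ofReal (K * √(2 * Real.pi / (t + C)) *
        ((1 / ((t + Q) / 2)) ^ (q + 1 / 2) * Real.Gamma (q + 1 / 2))) *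
      ENNReal.ofReal (a ^ (p + 1 - 1) *
        Real.exp (-(((t + A) * (t + C) - B ^ 2) / (2 * (t + C)) * a))) := by
    intro a ha
    have e1 : ∀ b, ∫⁻ e in Set.Ioi (0 : ℝ), ∫⁻ m₂ : ℝ, ∫⁻ m₁ : ℝ,
      ENNReal.ofReal (a ^ p * e ^ q * Real.exp (-(t * (a + e + b ^ 2 / a) +
        a * (c₁ * (m₁ + b / a * m₂ - z (b / a)) ^ 2 +
          (A + 2 * B * (b / a) + C * (b / a) ^ 2)) +
        e * (c₂ * (m₂ - z₂) ^ 2 + Q)) / 2)) = 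
        ENNReal.ofReal (K * a ^ (p - 1 / 2) *
          Real.exp (-(((t + A) * (t + C) - B ^ 2) / (2 * (t + C)) * a)) *
          ((1 / ((t + Q) / 2)) ^ (q + 1 / 2) * Real.Gamma (q + 1 / 2))) *
        ENNReal.ofReal (Real.exp (-((t + C) / a * (b - (- (B * a / (t + C)))) ^ 2 / 2))) := by
      intro b
      rw [setLIntegral_congr_fun measurableSet_Ioi (h1 a ha b),
        lintegral_const_mul _ (by fun_prop),
        lintegral_Ioi_ofReal_rpow_mul_exp (by linarith) (by positivity)]
      have ha : 0 < a := ha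
      have hG : 0 < Real.Gamma (q + 1 / 2) := Real.Gamma_pos_of_pos (by linarith)
      rw [← ENNReal.ofReal_mul (by positivity), ← ENNReal.ofReal_mul (by positivity)]
      congr 1
      have : Real.exp (-((t + A) * a + 2 * B * b + (t + C) * b ^ 2 / a) / 2) =
          Real.exp (-(((t + A) * (t + C) - B ^ 2) / (2 * (t + C)) * a)) *
          Real.exp (-((t + C) / a * (b - (- (B * a / (t + C)))) ^ 2 / 2)) := by
        rw [← Real.exp_add]; congr 1; field_simp; ring
      rw [this]; ring
    have ha : 0 < a := ha
    have hG : 0 < Real.Gamma (q + 1 / 2) := Real.Gamma_pos_of_pos (by linarith)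
    simp_rw [e1]
    rw [lintegral_const_mul _ (by fun_prop), lintegral_ofReal_exp_neg_sq (by positivity),
      ← ENNReal.ofReal_mul (by positivity), ← ENNReal.ofReal_mul (by positivity)]
    congr 1
    have r1 : √(2 * Real.pi / ((t + C) / a)) = √(2 * Real.pi / (t + C)) * a ^ (1 / 2 : ℝ) := by
      rw [← Real.sqrt_eq_rpow, ← Real.sqrt_mul (by positivity)]; congr 1; field_simp
    have r2 : a ^ (p + 1 - 1) = a ^ (p - 1 / 2) * a ^ (1 / 2 : ℝ) := by
      rw [← Real.rpow_add ha]; congr 1; ring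
    rw [r1, r2]; ring
  rw [setLIntegral_congr_fun measurableSet_Ioi h2, lintegral_const_mul _ (by fun_prop),
    lintegral_Ioi_ofReal_rpow_mul_exp (by linarith) (by positivity)]
  have hG : 0 < Real.Gamma (q + 1 / 2) := Real.Gamma_pos_of_pos (by linarith)
  rw [← ENNReal.ofReal_mul (by positivity)]
  congr 1
  rw [show 1 / ((t + Q) / 2) = 2 / (t + Q) by field_simp,
    show 1 / (((t + A) * (t + C) - B ^ 2) / (2 * (t + C))) =
      2 * (t + C) / ((t + A) * (t + C) - B ^ 2) by field_simp]
  ring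

/-! ### The BGe marginal likelihoods in closed form. -/

namespace HybridBN

lemma symMat_det (w : ℝ × ℝ × ℝ) : (symMat w).det = w.1 * w.2.2 - w.2.1 ^ 2 := by
  rw [symMat, Matrix.det_fin_two_of]; ring

lemma symMat_posDef_iff (w : ℝ × ℝ × ℝ) :
    (symMat w).PosDef ↔ 0 < w.1 ∧ 0 < w.1 * w.2.2 - w.2.1 ^ 2 := by
  constructor
  · intro h
    refine ⟨by simpa [symMat] using h.diag_pos (i := 0), ?_⟩
    rw [← symMat_det]; exact h.det_pos
  · rintro ⟨h1, h2⟩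
    refine Matrix.PosDef.of_dotProduct_mulVec_pos ?_ fun x hx => ?_
    · ext i j; fin_cases i <;> fin_cases j <;> simp [symMat]
    · have hx' : x 0 ≠ 0 ∨ x 1 ≠ 0 := by
        by_contra! h
        exact hx (by ext i; fin_cases i <;> simp [h])
      have e : star x ⬝ᵥ (symMat w).mulVec x =
          w.1 * x 0 ^ 2 + 2 * w.2.1 * x 0 * x 1 + w.2.2 * x 1 ^ 2 := by
        simp [symMat, dotProduct, Matrix.mulVec, Fin.sum_univ_two]; ring
      rw [e]
      -- Multiplication by `w.1 > 0` allows completing the square without division.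
      have key : w.1 * (w.1 * x 0 ^ 2 + 2 * w.2.1 * x 0 * x 1 + w.2.2 * x 1 ^ 2) =
          (w.1 * x 0 + w.2.1 * x 1) ^ 2 + (w.1 * w.2.2 - w.2.1 ^ 2) * x 1 ^ 2 := by ring
      refine pos_of_mul_pos_right (a := w.1) ?_ h1.le
      rw [key]
      by_cases h : x 1 = 0
      · have : x 0 ≠ 0 := by simpa [h] using hx'
        rw [h]; simp; positivity
      · positivity

lemma gaussJoint_eq (θ : (ℝ × ℝ) × (ℝ × ℝ × ℝ)) (x : ℝ × ℝ) :
    gaussJoint θ x = (θ.2.1 * θ.2.2.2 - θ.2.2.1 ^ 2) ^ (1 / 2 : ℝ) / (2 * Real.pi) *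
      Real.exp (-(θ.2.1 * (x.1 - θ.1.1) ^ 2 + 2 * θ.2.2.1 * (x.1 - θ.1.1) * (x.2 - θ.1.2) +
        θ.2.2.2 * (x.2 - θ.1.2) ^ 2) / 2) := by
  rw [gaussJoint, normalPDF, symMat_det]
  congr 2
  · simp
  · simp [symMat, vec, dotProduct, Matrix.mulVec, Fin.sum_univ_two]; ring

lemma symMat_inv_apply_zero (w : ℝ × ℝ × ℝ) :
    (symMat w)⁻¹ 0 0 = w.2.2 / (w.1 * w.2.2 - w.2.1 ^ 2) := by
  rw [Matrix.inv_def, symMat_det, symMat, Matrix.adjugate_fin_two_of]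
  simp [div_eq_inv_mul]

lemma symMat_inv_apply_one (w : ℝ × ℝ × ℝ) :
    (symMat w)⁻¹ 1 1 = w.1 / (w.1 * w.2.2 - w.2.1 ^ 2) := by
  rw [Matrix.inv_def, symMat_det, symMat, Matrix.adjugate_fin_two_of]
  simp [div_eq_inv_mul]

lemma gaussMarginal_one_eq (θ : (ℝ × ℝ) × (ℝ × ℝ × ℝ)) (y : ℝ) :
    gaussMarginal 1 θ y =
      gaussianPDFReal θ.1.2 (θ.2.1 / (θ.2.1 * θ.2.2.2 - θ.2.2.1 ^ 2)).toNNReal y := by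
  rw [gaussMarginal, symMat_inv_apply_one]; rfl

lemma gaussMarginal_zero_eq (θ : (ℝ × ℝ) × (ℝ × ℝ × ℝ)) (y : ℝ) :
    gaussMarginal 0 θ y =
      gaussianPDFReal θ.1.1 (θ.2.2.2 / (θ.2.1 * θ.2.2.2 - θ.2.2.1 ^ 2)).toNNReal y := by
  rw [gaussMarginal, symMat_inv_apply_zero]; rfl

lemma measurable_gaussJoint (x : ℝ × ℝ) : Measurable fun θ => gaussJoint θ x := by
  simp_rw [gaussJoint_eq]; fun_prop

lemma measurable_gaussMarginal_one (y : ℝ) : Measurable fun θ => gaussMarginal 1 θ y := by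
  simp_rw [gaussMarginal_one_eq]
  have h : Measurable fun θ : (ℝ × ℝ) × (ℝ × ℝ × ℝ) =>
      (θ.1.2, (θ.2.1 / (θ.2.1 * θ.2.2.2 - θ.2.2.1 ^ 2)).toNNReal, y) := by fun_prop
  exact measurable_uncurry_gaussianPDFReal.comp h

/-- The Normal-Wishart density up to a constant factor. -/
noncomputable def normalWishartKernel (αμ αw t : ℝ) (θ : (ℝ × ℝ) × (ℝ × ℝ × ℝ)) : ℝ :=
  (θ.2.1 * θ.2.2.2 - θ.2.2.1 ^ 2) ^ ((αw - 2) / 2) *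
    Real.exp (-(t * (θ.2.1 + θ.2.2.2) + αμ * (θ.2.1 * θ.1.1 ^ 2 + 2 * θ.2.2.1 * θ.1.1 * θ.1.2 +
      θ.2.2.2 * θ.1.2 ^ 2)) / 2)

/-- The normalizing constant of `normalWishartKernel`. -/
noncomputable def normalWishartConst (αμ αw t : ℝ) : ℝ :=
  αμ / (2 * Real.pi * (2 ^ (αw * 2 / 2) * multivariateGamma 2 (αw / 2) / (t ^ 2) ^ (αw / 2)))

lemma normalWishartConst_pos {αμ αw t : ℝ} (hαμ : 0 < αμ) (hαw : 3 < αw) (ht : 0 < t) :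
    0 < normalWishartConst αμ αw t := by
  have : 0 < multivariateGamma 2 (αw / 2) := by
    refine mul_pos (Real.rpow_pos_of_pos Real.pi_pos _) (Finset.prod_pos fun j hj => ?_)
    have : (j : ℝ) ≤ 2 := by exact_mod_cast (Finset.mem_Icc.1 hj).2
    exact Real.Gamma_pos_of_pos (by linarith)
  unfold normalWishartConst
  positivity

lemma normalWishartKernel_nonneg (αμ αw t : ℝ) {θ : (ℝ × ℝ) × (ℝ × ℝ × ℝ)}
    (hθ : 0 < θ.2.1 * θ.2.2.2 - θ.2.2.1 ^ 2) : 0 ≤ normalWishartKernel αμ αw t θ := by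
  unfold normalWishartKernel; positivity

lemma measurable_normalWishartKernel (αμ αw t : ℝ) :
    Measurable (normalWishartKernel αμ αw t) := by
  unfold normalWishartKernel; fun_prop

lemma wishart_mul_normal_eq {αμ αw t : ℝ} (hαμ : 0 < αμ)
    {θ : (ℝ × ℝ) × (ℝ × ℝ × ℝ)} (hθ : 0 < θ.2.1 * θ.2.2.2 - θ.2.2.1 ^ 2) :
    wishartPDF (t • (1 : Matrix (Fin 2) (Fin 2) ℝ)) αw (symMat θ.2) *
        normalPDF 0 (αμ • symMat θ.2) (vec θ.1) =
      normalWishartConst αμ αw t * normalWishartKernel αμ αw t θ := by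
  rw [wishartPDF, normalPDF, Matrix.det_smul, Matrix.det_smul, symMat_det, normalWishartConst,
    normalWishartKernel]
  set D := θ.2.1 * θ.2.2.2 - θ.2.2.1 ^ 2 with hD
  have e1 : (αμ ^ Fintype.card (Fin 2) * D) ^ (1 / 2 : ℝ) = αμ * D ^ (1 / 2 : ℝ) := by
    rw [Real.mul_rpow (by positivity) hθ.le, Fintype.card_fin, ← Real.sqrt_eq_rpow,
      Real.sqrt_sq hαμ.le]
  have e2 : D ^ ((αw - 2) / 2) = D ^ ((αw - (2 : ℕ) - 1) / 2) * D ^ (1 / 2 : ℝ) := by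
    rw [← Real.rpow_add hθ]; congr 1; push_cast; ring
  have e3 : Real.exp (-(t * (θ.2.1 + θ.2.2.2) + αμ * (θ.2.1 * θ.1.1 ^ 2 +
      2 * θ.2.2.1 * θ.1.1 * θ.1.2 + θ.2.2.2 * θ.1.2 ^ 2)) / 2) =
      Real.exp (-(1 / 2) * (t • (1 : Matrix (Fin 2) (Fin 2) ℝ) * symMat θ.2).trace) *
      Real.exp (-(1 / 2) * ((vec θ.1 - 0) ⬝ᵥ ((αμ • symMat θ.2).mulVec (vec θ.1 - 0)))) := by
    rw [← Real.exp_add]; congr 1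
    simp [symMat, vec, dotProduct, Matrix.mulVec, Fin.sum_univ_two, Matrix.trace_fin_two]
    ring
  rw [e1, e2, e3]
  simp only [Matrix.det_one, Fintype.card_fin, mul_one, Nat.cast_ofNat]
  rw [div_self two_ne_zero, Real.rpow_one]
  ring

/-- Transfers a computation with nonnegative integrals of the unnormalized kernel to the Bochner
integral defining the marginal likelihood. The value `ENNReal.ofReal V` is finite, so no separate
integrability argument is needed, and the family need only be nonnegative where the determinant is
positive, since the prior lives there. -/
lemma marginalLikelihood_normalWishart {αμ αw t : ℝ} (hαμ : 0 < αμ) (hαw : 3 < αw) (ht : 0 < t)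
    {S : Type*} {f : (ℝ × ℝ) × (ℝ × ℝ × ℝ) → S → ℝ} (hf : ∀ s, Measurable fun θ => f θ s)
    (hf0 : ∀ θ s, 0 < θ.2.1 * θ.2.2.2 - θ.2.2.1 ^ 2 → 0 ≤ f θ s) {N : ℕ} (x : Fin N → S) {V : ℝ}
    (hV : 0 ≤ V)
    (h : ∫⁻ θ in {θ : (ℝ × ℝ) × (ℝ × ℝ × ℝ) | 0 < θ.2.1 ∧ 0 < θ.2.1 * θ.2.2.2 - θ.2.2.1 ^ 2},
      ENNReal.ofReal (normalWishartKernel αμ αw t θ * ∏ k, f θ (x k)) = ENNReal.ofReal V) :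
    marginalLikelihood (normalWishart αμ αw t) f x = normalWishartConst αμ αw t * V := by
  have hc := normalWishartConst_pos hαμ hαw ht
  set T := {θ : (ℝ × ℝ) × (ℝ × ℝ × ℝ) | 0 < θ.2.1 ∧ 0 < θ.2.1 * θ.2.2.2 - θ.2.2.1 ^ 2} with hT
  have hTm : MeasurableSet T := measurableSet_posDef
  have hprod : Measurable fun θ => ∏ k, f θ (x k) := Finset.measurable_prod _ fun k _ => hf _
  have hset : {θ : (ℝ × ℝ) × (ℝ × ℝ × ℝ) | (symMat θ.2).PosDef} = T := by
    ext θ; exact symMat_posDef_iff _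
  have hprior : normalWishart αμ αw t = (volume.restrict T).withDensity fun θ =>
      ENNReal.ofReal (normalWishartConst αμ αw t * normalWishartKernel αμ αw t θ) := by
    rw [normalWishart, hset]
    refine withDensity_congr_ae ((ae_restrict_iff' hTm).2 (ae_of_all _ fun θ hθ => ?_))
    simp only [wishart_mul_normal_eq hαμ hθ.2]
  rw [marginalLikelihood, integral_eq_lintegral_of_nonneg_ae, hprior,
    lintegral_withDensity_eq_lintegral_mul]
  · have : ∫⁻ θ in T, ((fun θ => ENNReal.ofReal (normalWishartConst αμ αw t *
          normalWishartKernel αμ αw t θ)) * fun θ => ENNReal.ofReal (∏ k, f θ (x k))) θ =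
        ENNReal.ofReal (normalWishartConst αμ αw t) * ENNReal.ofReal V := by
      rw [← h, ← lintegral_const_mul]
      · refine setLIntegral_congr_fun hTm fun θ hθ => ?_
        have := normalWishartKernel_nonneg αμ αw t hθ.2
        simp only [Pi.mul_apply]
        rw [← ENNReal.ofReal_mul (by positivity), ← ENNReal.ofReal_mul (by positivity), mul_assoc]
      · exact ((measurable_normalWishartKernel αμ αw t).mul hprod).ennreal_ofReal
    rw [this, ← ENNReal.ofReal_mul hc.le, ENNReal.toReal_ofReal (by positivity)]
  · exact ((measurable_normalWishartKernel αμ αw t).const_mul _).ennreal_ofReal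
  · exact hprod.ennreal_ofReal
  · rw [hprior]
    refine (withDensity_absolutelyContinuous _ _).ae_le
      ((ae_restrict_iff' hTm).2 (ae_of_all _ fun θ hθ => ?_))
    exact Finset.prod_nonneg fun k _ => hf0 _ _ hθ.2
  · exact hprod.aestronglyMeasurable

/-- The posterior centered sum of products `∑ yₖ zₖ - (∑ yₖ) (∑ zₖ) / (κ + N)`. -/
noncomputable def centeredSum (κ : ℝ) {N : ℕ} (y z : Fin N → ℝ) : ℝ :=
  ∑ k, y k * z k - (∑ k, y k) * (∑ k, z k) / (κ + N)

/-- Completing the square in `u`: the prior acts like `κ` additional observations at `0`, so the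
center is the posterior mean and `centeredSum` is what remains. -/
lemma sum_sq_sub_eq {κ : ℝ} (hκ : 0 < κ) {N : ℕ} (y : Fin N → ℝ) (u : ℝ) :
    κ * u ^ 2 + ∑ k, (y k - u) ^ 2 =
      (κ + N) * (u - (∑ k, y k) / (κ + N)) ^ 2 + centeredSum κ y y := by
  have hc : κ + N ≠ 0 := by positivity
  have : ∑ k, (y k - u) ^ 2 = ∑ k, y k * y k - 2 * u * ∑ k, y k + N * u ^ 2 := by
    rw [Finset.mul_sum, ← Finset.sum_sub_distrib]
    have : (N : ℝ) * u ^ 2 = ∑ k : Fin N, u ^ 2 := by simp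
    rw [this, ← Finset.sum_add_distrib]
    exact Finset.sum_congr rfl fun k _ => by ring
  rw [this, centeredSum]; field_simp; ring

lemma centeredSum_self_nonneg {κ : ℝ} (hκ : 0 < κ) {N : ℕ} (y : Fin N → ℝ) :
    0 ≤ centeredSum κ y y := by
  have h := sum_sq_sub_eq hκ y ((∑ k, y k) / (κ + N))
  rw [sub_self] at h
  have h2 : 0 ≤ κ * ((∑ k, y k) / (κ + N)) ^ 2 +
      ∑ k, (y k - (∑ k, y k) / (κ + N)) ^ 2 := by positivity
  linarith

/-- Bilinearity. With `h = b / a` it expands the residual of the combination that appears in Schur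
coordinates; with `h` free it yields Cauchy–Schwarz. -/
lemma centeredSum_add_mul (κ : ℝ) {N : ℕ} (y z : Fin N → ℝ) (h : ℝ) :
    centeredSum κ (fun k => y k + h * z k) (fun k => y k + h * z k) =
      centeredSum κ y y + 2 * centeredSum κ y z * h + centeredSum κ z z * h ^ 2 := by
  have e1 : ∑ k, (y k + h * z k) = ∑ k, y k + h * ∑ k, z k := by
    rw [Finset.mul_sum, Finset.sum_add_distrib]
  have e2 : ∑ k, (y k + h * z k) * (y k + h * z k) =
      ∑ k, y k * y k + 2 * h * ∑ k, y k * z k + h ^ 2 * ∑ k, z k * z k := by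
    rw [Finset.mul_sum, Finset.mul_sum, ← Finset.sum_add_distrib, ← Finset.sum_add_distrib]
    exact Finset.sum_congr rfl fun k _ => by ring
  simp only [centeredSum, e1, e2]; ring

lemma centeredSum_sq_le {κ : ℝ} (hκ : 0 < κ) {N : ℕ} (y z : Fin N → ℝ) :
    centeredSum κ y z ^ 2 ≤ centeredSum κ y y * centeredSum κ z z := by
  have h : ∀ h : ℝ, 0 ≤ centeredSum κ z z * (h * h) + 2 * centeredSum κ y z * h +
      centeredSum κ y y := fun h => by
    have := centeredSum_self_nonneg hκ (fun k => y k + h * z k)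
    rw [centeredSum_add_mul] at this
    linarith
  have := discrim_le_zero h
  rw [discrim] at this
  linarith

/-- The diagonal entries of the posterior scale matrix. -/
noncomputable def scaleDiag (κ t : ℝ) {N : ℕ} (y : Fin N → ℝ) : ℝ := t + centeredSum κ y y

/-- The determinant of the posterior scale matrix. -/
noncomputable def scaleDet (κ t : ℝ) {N : ℕ} (y z : Fin N → ℝ) : ℝ :=
  scaleDiag κ t y * scaleDiag κ t z - centeredSum κ y z ^ 2

lemma le_scaleDiag {κ t : ℝ} (hκ : 0 < κ) {N : ℕ} (y : Fin N → ℝ) : t ≤ scaleDiag κ t y :=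
  le_add_of_nonneg_right (centeredSum_self_nonneg hκ y)

/-- The scale matrix is `t I` plus a positive semidefinite matrix. The bound is uniform in the data,
so the logarithm of the determinant is bounded below on all samples. -/
lemma sq_le_scaleDet {κ t : ℝ} (hκ : 0 < κ) (ht : 0 < t) {N : ℕ} (y z : Fin N → ℝ) :
    t ^ 2 ≤ scaleDet κ t y z := by
  have h1 := centeredSum_sq_le hκ y z
  have h2 := centeredSum_self_nonneg hκ y
  have h3 := centeredSum_self_nonneg hκ z
  unfold scaleDet scaleDiag
  nlinarith [mul_nonneg ht.le h2, mul_nonneg ht.le h3]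

lemma marginalLikelihood_gaussJoint {αμ αw t : ℝ} (hαμ : 0 < αμ) (hαw : 3 < αw) (ht : 0 < t)
    {N : ℕ} (x : Fin N → ℝ × ℝ) :
    marginalLikelihood (normalWishart αμ αw t) gaussJoint x =
      normalWishartConst αμ αw t * ((1 / (2 * Real.pi)) ^ N *
      (√(2 * Real.pi / (αμ + N)) * √(2 * Real.pi / (αμ + N)) *
        √(2 * Real.pi / scaleDiag αμ t (fun k => (x k).2)) *
        ((2 * scaleDiag αμ t (fun k => (x k).2) /
          scaleDet αμ t (fun k => (x k).1) (fun k => (x k).2)) ^ ((αw + N) / 2) *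
            Real.Gamma ((αw + N) / 2)) *
        ((2 / scaleDiag αμ t (fun k => (x k).2)) ^ ((αw + N - 1) / 2) *
          Real.Gamma ((αw + N - 1) / 2)))) := by
  set y := fun k => (x k).1 with hy
  set z := fun k => (x k).2 with hz
  have hN : (0 : ℝ) ≤ N := Nat.cast_nonneg N
  have hdet : 0 < scaleDet αμ t y z := lt_of_lt_of_le (by positivity) (sq_le_scaleDet hαμ ht y z)
  have hdz : 0 < scaleDiag αμ t z := lt_of_lt_of_le ht (le_scaleDiag hαμ z)
  have hG1 : 0 < Real.Gamma ((αw + N) / 2) := Real.Gamma_pos_of_pos (by linarith)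
  have hG2 : 0 < Real.Gamma ((αw + N - 1) / 2) := Real.Gamma_pos_of_pos (by linarith)
  have hm : Measurable fun θ : (ℝ × ℝ) × (ℝ × ℝ × ℝ) => ENNReal.ofReal
      (normalWishartKernel αμ αw t θ * ∏ k, gaussJoint θ (x k)) :=
    ((measurable_normalWishartKernel αμ αw t).mul
      (Finset.measurable_prod _ fun k _ => measurable_gaussJoint _)).ennreal_ofReal
  refine marginalLikelihood_normalWishart hαμ hαw ht measurable_gaussJoint
    (fun θ s hθ => by rw [gaussJoint_eq]; positivity) x (by positivity) ?_
  rw [lintegral_schur hm]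
  have hc : 0 < αμ + N := by positivity
  -- The prior density has the determinant to the power `(αw - 2) / 2` and each observation adds `1
  -- / 2`; as the determinant is `a e`, both exponents are `(αw + N) / 2 - 1`. Both means have
  -- posterior precision factor `αμ + N`.
  have key := lintegral_normalWishart_kernel (p := (αw + N) / 2 - 1) (q := (αw + N) / 2 - 1)
    (t := t) (c₁ := αμ + N) (c₂ := αμ + N) (A := centeredSum αμ y y) (B := centeredSum αμ y z)
    (C := centeredSum αμ z z) (Q := centeredSum αμ z z)
    (fun h => (∑ k, (y k + h * z k)) / (αμ + N)) ((∑ k, z k) / (αμ + N))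
    (by linarith) (by linarith) ht hc hc (centeredSum_self_nonneg hαμ z)
    (centeredSum_self_nonneg hαμ z) hdet
  rw [show (αw + N) / 2 - 1 + 1 = (αw + N) / 2 by ring,
    show (αw + N) / 2 - 1 + 1 / 2 = (αw + N - 1) / 2 by ring] at key
  rw [ENNReal.ofReal_mul (by positivity)]
  refine Eq.trans ?_ (congrArg _ key)
  rw [← lintegral_const_mul' _ _ ENNReal.ofReal_ne_top]
  refine setLIntegral_congr_fun measurableSet_Ioi fun a ha => ?_
  have ha : 0 < a := ha
  rw [← lintegral_const_mul' _ _ ENNReal.ofReal_ne_top]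
  refine lintegral_congr fun b => ?_
  rw [← lintegral_const_mul' _ _ ENNReal.ofReal_ne_top]
  refine setLIntegral_congr_fun measurableSet_Ioi fun e he => ?_
  have he : 0 < e := he
  rw [← lintegral_const_mul' _ _ ENNReal.ofReal_ne_top]
  refine lintegral_congr fun m₂ => ?_
  rw [← lintegral_const_mul' _ _ ENNReal.ofReal_ne_top]
  refine lintegral_congr fun m₁ => ?_
  rw [← ENNReal.ofReal_mul (by positivity)]
  congr 1
  have hD : a * (e + b ^ 2 / a) - b ^ 2 = a * e := by field_simp; ring
  simp_rw [gaussJoint_eq, normalWishartKernel, hD, Finset.prod_mul_distrib, ← Real.exp_sum,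
    Finset.prod_const, Finset.card_univ, Fintype.card_fin]
  have s1 := sum_sq_sub_eq hαμ (fun k => y k + b / a * z k) (m₁ + b / a * m₂)
  have s2 := sum_sq_sub_eq hαμ z m₂
  rw [centeredSum_add_mul] at s1
  have e1 : a ^ ((αw + N) / 2 - 1) * e ^ ((αw + N) / 2 - 1) =
      (a * e) ^ ((αw - 2) / 2) * ((a * e) ^ (1 / 2 : ℝ)) ^ N := by
    rw [← Real.mul_rpow ha.le he.le, ← Real.rpow_mul_natCast (by positivity),
      ← Real.rpow_add (by positivity)]
    congr 1; ring
  rw [e1, div_pow, div_pow, one_pow, mul_mul_mul_comm, ← Real.exp_add]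
  -- The quadratic form of the precision matrix is diagonalized as `a (u₁ + (b / a) u₂)² + e u₂²`,
  -- for the prior term and for each observation alike.
  have e2 : -(t * (a + (e + b ^ 2 / a)) + αμ * (a * m₁ ^ 2 + 2 * b * m₁ * m₂ +
        (e + b ^ 2 / a) * m₂ ^ 2)) / 2 +
      ∑ k, -(a * ((x k).1 - m₁) ^ 2 + 2 * b * ((x k).1 - m₁) * ((x k).2 - m₂) +
        (e + b ^ 2 / a) * ((x k).2 - m₂) ^ 2) / 2 =
      -(t * (a + e + b ^ 2 / a) + a * (αμ * (m₁ + b / a * m₂) ^ 2 +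
        ∑ k, (y k + b / a * z k - (m₁ + b / a * m₂)) ^ 2) +
        e * (αμ * m₂ ^ 2 + ∑ k, (z k - m₂) ^ 2)) / 2 := by
    have : ∑ k, -(a * ((x k).1 - m₁) ^ 2 + 2 * b * ((x k).1 - m₁) * ((x k).2 - m₂) +
        (e + b ^ 2 / a) * ((x k).2 - m₂) ^ 2) / 2 =
        -(a * ∑ k, (y k + b / a * z k - (m₁ + b / a * m₂)) ^ 2 +
          e * ∑ k, (z k - m₂) ^ 2) / 2 := by
      rw [Finset.mul_sum, Finset.mul_sum, ← Finset.sum_add_distrib, ← Finset.sum_neg_distrib,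
        Finset.sum_div]
      refine Finset.sum_congr rfl fun k _ => ?_
      simp only [hy, hz]; field_simp; ring
    rw [this]; field_simp; ring
  rw [e2, s1, s2]
  ring

/-- In Schur coordinates the variance of `X₂` is `a / (a e) = 1 / e`, so the data touch only `e` and
`m₂`; the variables `a`, `b`, `m₁` keep their prior integrals. -/
lemma lintegral_kernel_mul_gaussMarginal_one {αμ αw t : ℝ} (hαμ : 0 < αμ) (hαw : 3 < αw)
    (ht : 0 < t) {N : ℕ} (z : Fin N → ℝ) :
    ∫⁻ θ in {θ : (ℝ × ℝ) × (ℝ × ℝ × ℝ) | 0 < θ.2.1 ∧ 0 < θ.2.1 * θ.2.2.2 - θ.2.2.1 ^ 2},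
      ENNReal.ofReal (normalWishartKernel αμ αw t θ * ∏ k, gaussMarginal 1 θ (z k)) =
      ENNReal.ofReal ((1 / √(2 * Real.pi)) ^ N *
      (√(2 * Real.pi / αμ) * √(2 * Real.pi / (αμ + N)) * √(2 * Real.pi / t) *
        ((2 / t) ^ (αw / 2) * Real.Gamma (αw / 2)) *
        ((2 / scaleDiag αμ t z) ^ ((αw + N - 1) / 2) *
          Real.Gamma ((αw + N - 1) / 2)))) := by
  have hN : (0 : ℝ) ≤ N := Nat.cast_nonneg N
  have hm : Measurable fun θ : (ℝ × ℝ) × (ℝ × ℝ × ℝ) => ENNReal.ofReal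
      (normalWishartKernel αμ αw t θ * ∏ k, gaussMarginal 1 θ (z k)) :=
    ((measurable_normalWishartKernel αμ αw t).mul
      (Finset.measurable_prod _ fun k _ => measurable_gaussMarginal_one _)).ennreal_ofReal
  rw [lintegral_schur hm]
  have hc : 0 < αμ + N := by positivity
  -- Only the exponent of `e`, the precision factor of `m₂` and `Q` are updated; the zero values of
  -- `A`, `B`, `C` and the factor `c₁ = αμ` are those of the prior.
  have key := lintegral_normalWishart_kernel (p := αw / 2 - 1) (q := (αw + N) / 2 - 1)
    (t := t) (c₁ := αμ) (c₂ := αμ + N) (A := 0) (B := 0) (C := 0) (Q := centeredSum αμ z z)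
    (fun _ => 0) ((∑ k, z k) / (αμ + N))
    (by linarith) (by linarith) ht hαμ hc le_rfl (centeredSum_self_nonneg hαμ z)
    (by simp; positivity)
  rw [show αw / 2 - 1 + 1 = αw / 2 by ring,
    show (αw + N) / 2 - 1 + 1 / 2 = (αw + N - 1) / 2 by ring,
    show 2 * (t + 0) / ((t + 0) * (t + 0) - 0 ^ 2) = 2 / t by field_simp; ring, add_zero] at key
  rw [ENNReal.ofReal_mul (by positivity)]
  refine Eq.trans ?_ (congrArg _ key)
  rw [← lintegral_const_mul' _ _ ENNReal.ofReal_ne_top]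
  refine setLIntegral_congr_fun measurableSet_Ioi fun a ha => ?_
  have ha : 0 < a := ha
  rw [← lintegral_const_mul' _ _ ENNReal.ofReal_ne_top]
  refine lintegral_congr fun b => ?_
  rw [← lintegral_const_mul' _ _ ENNReal.ofReal_ne_top]
  refine setLIntegral_congr_fun measurableSet_Ioi fun e he => ?_
  have he : 0 < e := he
  rw [← lintegral_const_mul' _ _ ENNReal.ofReal_ne_top]
  refine lintegral_congr fun m₂ => ?_
  rw [← lintegral_const_mul' _ _ ENNReal.ofReal_ne_top]
  refine lintegral_congr fun m₁ => ?_
  rw [← ENNReal.ofReal_mul (by positivity)]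
  congr 1
  have hD : a * (e + b ^ 2 / a) - b ^ 2 = a * e := by field_simp; ring
  have hpdf : ∀ y, gaussMarginal 1 ((m₁, m₂), (a, b, e + b ^ 2 / a)) y =
      e ^ (1 / 2 : ℝ) / √(2 * Real.pi) * Real.exp (-(e * (y - m₂) ^ 2) / 2) := by
    intro y
    rw [gaussMarginal_one_eq, gaussianPDFReal]
    simp only [hD]
    rw [show a / (a * e) = e⁻¹ by field_simp, Real.coe_toNNReal _ (by positivity),
      ← Real.sqrt_eq_rpow, Real.sqrt_mul (by positivity), Real.sqrt_inv]
    congr 1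
    · field_simp
    · congr 1; field_simp
  simp_rw [hpdf, normalWishartKernel, hD, Finset.prod_mul_distrib, ← Real.exp_sum,
    Finset.prod_const, Finset.card_univ, Fintype.card_fin]
  have s2 := sum_sq_sub_eq hαμ z m₂
  have e1 : a ^ (αw / 2 - 1) * e ^ ((αw + N) / 2 - 1) =
      (a * e) ^ ((αw - 2) / 2) * (e ^ (1 / 2 : ℝ)) ^ N := by
    rw [Real.mul_rpow ha.le he.le, ← Real.rpow_mul_natCast (by positivity), mul_assoc,
      ← Real.rpow_add (by positivity)]
    congr 2 <;> ring
  rw [e1, div_pow, div_pow, one_pow, mul_mul_mul_comm, ← Real.exp_add, ← s2]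
  have e2 : -(t * (a + (e + b ^ 2 / a)) + αμ * (a * m₁ ^ 2 + 2 * b * m₁ * m₂ +
        (e + b ^ 2 / a) * m₂ ^ 2)) / 2 + ∑ k, -(e * (z k - m₂) ^ 2) / 2 =
      -(t * (a + e + b ^ 2 / a) + a * (αμ * (m₁ + b / a * m₂ - 0) ^ 2 +
        (0 + 2 * 0 * (b / a) + 0 * (b / a) ^ 2)) +
        e * (αμ * m₂ ^ 2 + ∑ k, (z k - m₂) ^ 2)) / 2 := by
    rw [← Finset.sum_div, Finset.sum_neg_distrib, ← Finset.mul_sum]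
    field_simp; ring
  rw [e2]
  ring

/-- Exchange of the two coordinates on the parameters of the Gaussian model. -/
def swapGauss (θ : (ℝ × ℝ) × (ℝ × ℝ × ℝ)) : (ℝ × ℝ) × (ℝ × ℝ × ℝ) :=
  ((θ.1.2, θ.1.1), (θ.2.2.2, θ.2.2.1, θ.2.1))

lemma measurePreserving_swapGauss : MeasurePreserving swapGauss := by
  have h1 : MeasurePreserving (fun w : ℝ × ℝ × ℝ => (w.2.2, w.2.1, w.1)) := by
    have a1 : MeasurePreserving (Prod.swap : ℝ × (ℝ × ℝ) → (ℝ × ℝ) × ℝ) :=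
      Measure.measurePreserving_swap
    have a2 : MeasurePreserving (Prod.map Prod.swap id : (ℝ × ℝ) × ℝ → (ℝ × ℝ) × ℝ) :=
      Measure.measurePreserving_swap.prod (MeasurePreserving.id _)
    have a3 : MeasurePreserving (MeasurableEquiv.prodAssoc : (ℝ × ℝ) × ℝ ≃ᵐ ℝ × ℝ × ℝ) :=
      measurePreserving_prodAssoc _ _ _
    exact a3.comp (a2.comp a1)
  have h2 : MeasurePreserving (Prod.swap : ℝ × ℝ → ℝ × ℝ) := Measure.measurePreserving_swap
  exact h2.prod h1

/-- The prior has mean `0` and scale matrix `t I`, hence is invariant under exchange of the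
coordinates, and the exchange preserves volume. -/
lemma lintegral_kernel_mul_gaussMarginal_zero (αμ αw t : ℝ) {N : ℕ} (z : Fin N → ℝ) :
    ∫⁻ θ in {θ : (ℝ × ℝ) × (ℝ × ℝ × ℝ) | 0 < θ.2.1 ∧ 0 < θ.2.1 * θ.2.2.2 - θ.2.2.1 ^ 2},
      ENNReal.ofReal (normalWishartKernel αμ αw t θ * ∏ k, gaussMarginal 0 θ (z k)) =
    ∫⁻ θ in {θ : (ℝ × ℝ) × (ℝ × ℝ × ℝ) | 0 < θ.2.1 ∧ 0 < θ.2.1 * θ.2.2.2 - θ.2.2.1 ^ 2},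
      ENNReal.ofReal (normalWishartKernel αμ αw t θ * ∏ k, gaussMarginal 1 θ (z k)) := by
  set T := {θ : (ℝ × ℝ) × (ℝ × ℝ × ℝ) | 0 < θ.2.1 ∧ 0 < θ.2.1 * θ.2.2.2 - θ.2.2.1 ^ 2} with hT
  have hTm : MeasurableSet T := measurableSet_posDef
  have hm : Measurable fun θ : (ℝ × ℝ) × (ℝ × ℝ × ℝ) => ENNReal.ofReal
      (normalWishartKernel αμ αw t θ * ∏ k, gaussMarginal 1 θ (z k)) :=
    ((measurable_normalWishartKernel αμ αw t).mul
      (Finset.measurable_prod _ fun k _ => measurable_gaussMarginal_one _)).ennreal_ofReal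
  rw [← measurePreserving_swapGauss.setLIntegral_comp_preimage hTm hm]
  have hpre : swapGauss ⁻¹' T = T := by
    ext θ
    simp only [hT, swapGauss, Set.mem_preimage, Set.mem_ofPred_eq, mul_comm θ.2.2.2]
    -- A positive determinant and one positive diagonal entry force the other diagonal entry to be
    -- positive.
    constructor <;> rintro ⟨h1, h2⟩ <;> refine ⟨?_, h2⟩ <;> nlinarith [sq_nonneg θ.2.2.1]
  rw [hpre]
  refine lintegral_congr fun θ => ?_
  simp_rw [gaussMarginal_one_eq, gaussMarginal_zero_eq, normalWishartKernel, swapGauss]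
  rw [mul_comm θ.2.2.2 θ.2.1]
  congr 5; ring

lemma measurable_gaussMarginal_zero (y : ℝ) : Measurable fun θ => gaussMarginal 0 θ y := by
  have : (fun θ => gaussMarginal 0 θ y) = (fun θ => gaussMarginal 1 θ y) ∘ swapGauss := by
    ext θ
    simp [gaussMarginal_zero_eq, gaussMarginal_one_eq, swapGauss, mul_comm]
  rw [this]
  exact (measurable_gaussMarginal_one y).comp measurePreserving_swapGauss.measurable

/-- The marginal likelihood of a column in the Gaussian model. -/
noncomputable def columnLikelihood (αμ αw t : ℝ) {N : ℕ} (z : Fin N → ℝ) : ℝ :=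
  normalWishartConst αμ αw t * ((1 / √(2 * Real.pi)) ^ N *
      (√(2 * Real.pi / αμ) * √(2 * Real.pi / (αμ + N)) * √(2 * Real.pi / t) *
        ((2 / t) ^ (αw / 2) * Real.Gamma (αw / 2)) *
        ((2 / scaleDiag αμ t z) ^ ((αw + N - 1) / 2) *
          Real.Gamma ((αw + N - 1) / 2))))

lemma marginalLikelihood_gaussMarginal {αμ αw t : ℝ} (hαμ : 0 < αμ) (hαw : 3 < αw)
    (ht : 0 < t) (i : Fin 2) {N : ℕ} (z : Fin N → ℝ) :
    marginalLikelihood (normalWishart αμ αw t) (gaussMarginal i) z =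
      columnLikelihood αμ αw t z := by
  have hN : (0 : ℝ) ≤ N := Nat.cast_nonneg N
  have hdz : 0 < scaleDiag αμ t z := lt_of_lt_of_le ht (le_scaleDiag hαμ z)
  have hG1 : 0 < Real.Gamma (αw / 2) := Real.Gamma_pos_of_pos (by linarith)
  have hG2 : 0 < Real.Gamma ((αw + N - 1) / 2) := Real.Gamma_pos_of_pos (by linarith)
  have hc : 0 < αμ + N := by positivity
  have h1 := lintegral_kernel_mul_gaussMarginal_one hαμ hαw ht z
  fin_cases i
  · exact marginalLikelihood_normalWishart hαμ hαw ht measurable_gaussMarginal_zero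
      (fun θ s _ => gaussianPDFReal_nonneg _ _ _) z (by positivity)
      ((lintegral_kernel_mul_gaussMarginal_zero αμ αw t z).trans h1)
  · exact marginalLikelihood_normalWishart hαμ hαw ht measurable_gaussMarginal_one
      (fun θ s _ => gaussianPDFReal_nonneg _ _ _) z (by positivity) h1

/-- The denominator of Bayes' formula cancels; the prior weights contribute only a constant, which
disappears after division by `N`. -/
lemma logPosteriorRatio_eq {q L : Graph → ℝ} (hq : ∀ G, 0 < q G) (hL : ∀ G, 0 < L G) :
    logPosteriorRatio q L = Real.log (q Graph.edge) - Real.log (q Graph.empty) +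
      (Real.log (L Graph.edge) - Real.log (L Graph.empty)) := by
  have h1 := hq Graph.edge
  have h2 := hq Graph.empty
  have h3 := hL Graph.edge
  have h4 := hL Graph.empty
  have : posterior q L Graph.edge / posterior q L Graph.empty =
      (L Graph.edge * q Graph.edge) / (L Graph.empty * q Graph.empty) := by
    unfold posterior
    have : 0 < L Graph.empty * q Graph.empty + L Graph.edge * q Graph.edge := by positivity
    field_simp
  rw [logPosteriorRatio, this, Real.log_div (by positivity) (by positivity),
    Real.log_mul h3.ne' h1.ne', Real.log_mul h4.ne' h2.ne']
  ring

/-- Closed form of the log posterior ratio under the BGe score. -/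
lemma exists_logPosteriorRatio_bgeLikelihood_eq {q : Graph → ℝ} (hq : ∀ G, 0 < q G) {αμ αw t : ℝ}
    (hαμ : 0 < αμ) (hαw : 3 < αw) (ht : 0 < t) :
    ∃ K : ℝ, ∀ (N : ℕ) (x : Fin N → ℝ × ℝ),
      logPosteriorRatio q (bgeLikelihood αμ αw t x) =
        K + (Real.log (Real.Gamma ((αw + N) / 2)) - Real.log (Real.Gamma ((αw + N - 1) / 2))) +
        (αw + N) / 2 * (Real.log (scaleDiag αμ t fun k => (x k).1) +
          Real.log (scaleDiag αμ t fun k => (x k).2) -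
          Real.log (scaleDet αμ t (fun k => (x k).1) fun k => (x k).2)) -
        1 / 2 * (Real.log (scaleDiag αμ t fun k => (x k).1) +
          Real.log (scaleDiag αμ t fun k => (x k).2)) := by
  -- The powers of `2π` and of `αμ + N` that depend on `N` cancel between the two graphs, and the
  -- powers of `2` leave exponent `1/2 - αw`. In the joint likelihood the second diagonal entry has
  -- total exponent zero, so only the determinant survives there.
  refine ⟨Real.log (q Graph.edge) - Real.log (q Graph.empty) -
    Real.log (normalWishartConst αμ αw t) - 3 / 2 * Real.log (2 * Real.pi) + Real.log αμ +
    Real.log t - αw * (Real.log 2 - Real.log t) - 2 * Real.log (Real.Gamma (αw / 2)) +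
    1 / 2 * Real.log 2, fun N x => ?_⟩
  set y := fun k => (x k).1 with hy
  set z := fun k => (x k).2 with hz
  have hN : (0 : ℝ) ≤ N := Nat.cast_nonneg N
  have hdet : 0 < scaleDet αμ t y z := lt_of_lt_of_le (by positivity) (sq_le_scaleDet hαμ ht y z)
  have hdy : 0 < scaleDiag αμ t y := lt_of_lt_of_le ht (le_scaleDiag hαμ y)
  have hdz : 0 < scaleDiag αμ t z := lt_of_lt_of_le ht (le_scaleDiag hαμ z)
  have hG0 : 0 < Real.Gamma (αw / 2) := Real.Gamma_pos_of_pos (by linarith)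
  have hG1 : 0 < Real.Gamma ((αw + N) / 2) := Real.Gamma_pos_of_pos (by linarith)
  have hG2 : 0 < Real.Gamma ((αw + N - 1) / 2) := Real.Gamma_pos_of_pos (by linarith)
  have hκ := normalWishartConst_pos hαμ hαw ht
  have hc : 0 < αμ + N := by positivity
  have hpi : 0 < 2 * Real.pi := by positivity
  have E : bgeLikelihood αμ αw t x Graph.edge = _ := marginalLikelihood_gaussJoint hαμ hαw ht x
  have E0 : bgeLikelihood αμ αw t x Graph.empty =
      columnLikelihood αμ αw t y * columnLikelihood αμ αw t z := by
    rw [← marginalLikelihood_gaussMarginal hαμ hαw ht 0 y,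
      ← marginalLikelihood_gaussMarginal hαμ hαw ht 1 z]; rfl
  have hcol : ∀ w : Fin N → ℝ, 0 < scaleDiag αμ t w → 0 < columnLikelihood αμ αw t w :=
    fun w hw => by unfold columnLikelihood; positivity
  have hlogcol : ∀ w : Fin N → ℝ, 0 < scaleDiag αμ t w →
      Real.log (columnLikelihood αμ αw t w) = Real.log (normalWishartConst αμ αw t) -
        N * (1 / 2 * Real.log (2 * Real.pi)) +
        (1 / 2 * (Real.log (2 * Real.pi) - Real.log αμ) +
        1 / 2 * (Real.log (2 * Real.pi) - Real.log (αμ + N)) +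
        1 / 2 * (Real.log (2 * Real.pi) - Real.log t) +
        (αw / 2 * (Real.log 2 - Real.log t) + Real.log (Real.Gamma (αw / 2))) +
        ((αw + N - 1) / 2 * (Real.log 2 - Real.log (scaleDiag αμ t w)) +
          Real.log (Real.Gamma ((αw + N - 1) / 2)))) := by
    intro w hw
    unfold columnLikelihood
    rw [Real.log_mul (by positivity) (by positivity), Real.log_mul (by positivity) (by positivity),
      Real.log_mul (by positivity) (by positivity), Real.log_mul (by positivity) (by positivity),
      Real.log_mul (by positivity) (by positivity), Real.log_mul (by positivity) (by positivity),
      Real.log_mul (by positivity) (by positivity), Real.log_mul (by positivity) (by positivity),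
      Real.log_pow, Real.log_sqrt (by positivity), Real.log_sqrt (by positivity),
      Real.log_sqrt (by positivity), Real.log_rpow (by positivity), Real.log_rpow (by positivity),
      one_div, Real.log_inv, Real.log_sqrt hpi.le, Real.log_div hpi.ne' hαμ.ne',
      Real.log_div hpi.ne' hc.ne', Real.log_div hpi.ne' ht.ne', Real.log_div two_ne_zero ht.ne',
      Real.log_div two_ne_zero hw.ne']
    ring
  have hE : 0 < bgeLikelihood αμ αw t x Graph.edge := by rw [E]; positivity
  have hE0 : 0 < bgeLikelihood αμ αw t x Graph.empty := by
    rw [E0]; exact mul_pos (hcol y hdy) (hcol z hdz)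
  rw [logPosteriorRatio_eq hq (fun G => by cases G <;> assumption), E0,
    Real.log_mul (hcol y hdy).ne' (hcol z hdz).ne', hlogcol y hdy, hlogcol z hdz, E,
    Real.log_mul (by positivity) (by positivity), Real.log_mul (by positivity) (by positivity),
    Real.log_mul (by positivity) (by positivity), Real.log_mul (by positivity) (by positivity),
    Real.log_mul (by positivity) (by positivity), Real.log_mul (by positivity) (by positivity),
    Real.log_mul (by positivity) (by positivity), Real.log_mul (by positivity) (by positivity),
    Real.log_pow, Real.log_sqrt (by positivity), Real.log_sqrt (by positivity),
    Real.log_rpow (by positivity), Real.log_rpow (by positivity),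
    one_div (2 * Real.pi), Real.log_inv, Real.log_div hpi.ne' hc.ne', Real.log_div hpi.ne' hdz.ne',
    Real.log_div (by positivity) hdet.ne', Real.log_div two_ne_zero hdz.ne',
    Real.log_mul two_ne_zero hdz.ne']
  ring

/-! ### Convergence of expectations of functions of sample means. -/

section Averages

variable {S : Type*} [MeasurableSpace S]

/-- The average of `f` over a sample. -/
noncomputable def sampleMean (f : S → ℝ) {N : ℕ} (x : Fin N → S) : ℝ := (∑ k, f (x k)) / N

instance isProbabilityMeasure_sampleLaw (P : Measure S) [IsProbabilityMeasure P] (N : ℕ) :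
    IsProbabilityMeasure (sampleLaw P N) := by
  unfold sampleLaw; infer_instance

variable {P : Measure S} [IsProbabilityMeasure P] {f : S → ℝ}

lemma memLp_eval_sampleLaw {p : ENNReal} (hf : MemLp f p P) {N : ℕ} (k : Fin N) :
    MemLp (fun x : Fin N → S => f (x k)) p (sampleLaw P N) :=
  hf.comp_measurePreserving (measurePreserving_eval (fun _ => P) k)

lemma memLp_sampleMean {p : ENNReal} (hf : MemLp f p P) (N : ℕ) :
    MemLp (fun x : Fin N → S => sampleMean f x) p (sampleLaw P N) := by
  simp only [sampleMean, div_eq_mul_inv]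
  exact (memLp_finsetSum _ fun k _ => memLp_eval_sampleLaw hf k).mul_const _

lemma integral_sampleMean (hf : Integrable f P) {N : ℕ} (hN : N ≠ 0) :
    ∫ x, sampleMean f x ∂(sampleLaw P N) = ∫ s, f s ∂P := by
  simp only [sampleMean]
  rw [integral_div, integral_finsetSum]
  · have : ∀ k : Fin N, ∫ x : Fin N → S, f (x k) ∂(sampleLaw P N) = ∫ s, f s ∂P := fun k =>
      integral_comp_eval (μ := fun _ => P) hf.aestronglyMeasurable
    simp [this, hN]
  · intro k _
    exact memLp_one_iff_integrable.1 (memLp_eval_sampleLaw (memLp_one_iff_integrable.2 hf) k)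

/-- Independence makes the variances add; the resulting rate `1 / N` is what absorbs the factor `1 +
log N` later. -/
lemma integral_sampleMean_sub_sq (hf : MemLp f 2 P) {N : ℕ} (hN : N ≠ 0) :
    ∫ x, (sampleMean f x - ∫ s, f s ∂P) ^ 2 ∂(sampleLaw P N) = Var[f; P] / N := by
  have h1 := variance_eq_integral (μ := sampleLaw P N) (memLp_sampleMean hf N).aemeasurable
  rw [integral_sampleMean (hf.integrable one_le_two) hN] at h1
  rw [← h1]
  have h2 : (fun x : Fin N → S => sampleMean f x) =
      fun x => (N : ℝ)⁻¹ * (∑ k, fun x : Fin N → S => f (x k)) x := by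
    ext x; simp [sampleMean, div_eq_inv_mul]
  rw [h2, variance_const_mul, sampleLaw, variance_sum_pi (fun _ => hf)]
  simp; field_simp

lemma tendsto_one_add_log_div_atTop :
    Tendsto (fun N : ℕ => (1 + Real.log N) / (N : ℝ)) atTop (𝓝 0) := by
  have h1 : Tendsto (fun x : ℝ => 1 / x + Real.log x / x) atTop (𝓝 (0 + 0)) := by
    refine Tendsto.add ?_ ?_
    · exact (tendsto_inv_atTop_zero (𝕜 := ℝ)).congr fun x => (one_div x).symm
    · exact Real.isLittleO_log_id_atTop.tendsto_div_nhds_zero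
  rw [add_zero] at h1
  refine (h1.comp tendsto_natCast_atTop_atTop).congr fun N => ?_
  simp [add_div]

/-- Expectations of functions of sample means that grow at most linearly, up to a logarithmic
factor in the size of the sample, converge to the value at the means. -/
theorem tendsto_integral_of_sampleMean {d : ℕ} {φ : Fin d → S → ℝ} (hφ : ∀ i, MemLp (φ i) 2 P)
    {F : (N : ℕ) → (Fin N → S) → ℝ}
    (hF : ∀ N, AEStronglyMeasurable (F N) (sampleLaw P N)) {H : ℝ × (Fin d → ℝ) → ℝ}
    (hH : ContinuousAt H (0, fun i => ∫ s, φ i s ∂P))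
    {c : ℕ → ℝ} (hc : Tendsto c atTop (𝓝 0))
    (hFH : ∀ N : ℕ, N ≠ 0 → ∀ x : Fin N → S,
      |F N x - H ((N : ℝ)⁻¹, fun i => sampleMean (φ i) x)| ≤ c N) {C : ℝ}
    (hC : ∀ N : ℕ, N ≠ 0 → ∀ x : Fin N → S,
      |H ((N : ℝ)⁻¹, fun i => sampleMean (φ i) x)| ≤
        C * (1 + Real.log N) * (1 + ∑ i, |sampleMean (φ i) x|)) :
    (∀ N, N ≠ 0 → Integrable (F N) (sampleLaw P N)) ∧
    Tendsto (fun N => ∫ x, F N x ∂(sampleLaw P N)) atTop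
      (𝓝 (H (0, fun i => ∫ s, φ i s ∂P))) := by
  set v₀ : Fin d → ℝ := fun i => ∫ s, φ i s ∂P with hv₀
  have hint : ∀ N, N ≠ 0 → Integrable (F N) (sampleLaw P N) := by
    intro N hN
    have hb : Integrable (fun x : Fin N → S => c N +
        C * (1 + Real.log N) * (1 + ∑ i, |sampleMean (φ i) x|)) (sampleLaw P N) := by
      refine (integrable_const _).add (Integrable.const_mul ((integrable_const _).add ?_) _)
      exact integrable_finsetSum _ fun i _ =>
        ((memLp_sampleMean (hφ i) N).integrable one_le_two).abs
    refine hb.mono' (hF N) (ae_of_all _ fun x => ?_)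
    have h1 := hFH N hN x
    have h2 := hC N hN x
    rw [Real.norm_eq_abs]
    have h3 := abs_add_le (F N x - H ((N : ℝ)⁻¹, fun i => sampleMean (φ i) x))
      (H ((N : ℝ)⁻¹, fun i => sampleMean (φ i) x))
    rw [sub_add_cancel] at h3
    linarith
  refine ⟨hint, ?_⟩
  have hC0 : 0 ≤ |C| := abs_nonneg C
  set V := ∑ i, Var[φ i; P] with hV
  rw [Metric.tendsto_atTop']
  intro ε hε
  obtain ⟨δ, hδ, hball⟩ := Metric.continuousAt_iff.1 hH (ε / 4) (by positivity)
  set M := 1 + ∑ i, |v₀ i| with hM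
  have hM1 : 1 ≤ M := le_add_of_nonneg_right (Finset.sum_nonneg fun i _ => abs_nonneg _)
  -- Chosen so that, outside the `δ`-ball, both values of `H` are controlled together by `K (1 + log
  -- N) D`; each `1 / δ ^ 2` comes from `1 ≤ D / δ ^ 2` there.
  set K := |C| * ((M + d) / δ ^ 2 + 1) + |H (0, v₀)| / δ ^ 2 with hK
  have hK0 : 0 ≤ K := by positivity
  have t1 := (tendsto_one_add_log_div_atTop.const_mul (K * V))
  rw [mul_zero] at t1
  have t2 := (Metric.tendsto_nhds.1 t1) (ε / 4) (by positivity)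
  have t3 := (Metric.tendsto_nhds.1 hc) (ε / 4) (by positivity)
  have t4 : ∀ᶠ N : ℕ in atTop, (N : ℝ)⁻¹ < δ :=
    (tendsto_inv_atTop_nhds_zero_nat (𝕜 := ℝ)).eventually (gt_mem_nhds hδ)
  obtain ⟨N₀, hN₀⟩ := eventually_atTop.1 (t2.and (t3.and t4))
  refine ⟨max N₀ 1, fun N hN => ?_⟩
  have hN1 : 1 ≤ N := (le_max_right _ _).trans hN.le
  have hN0 : N ≠ 0 := by omega
  obtain ⟨b2, b3, b4⟩ := hN₀ N ((le_max_left _ _).trans hN.le)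
  have hlog : 0 ≤ Real.log N := Real.log_natCast_nonneg N
  have hNpos : (0 : ℝ) < N := by positivity
  have hD : ∀ i, Integrable (fun x : Fin N → S => (sampleMean (φ i) x - v₀ i) ^ 2)
      (sampleLaw P N) := fun i =>
    ((memLp_sampleMean (hφ i) N).sub (memLp_const (v₀ i))).integrable_sq
  have hDint : ∫ x, ∑ i, (sampleMean (φ i) x - v₀ i) ^ 2 ∂(sampleLaw P N) = V / N := by
    rw [integral_finsetSum _ fun i _ => hD i, hV, Finset.sum_div]
    exact Finset.sum_congr rfl fun i _ => integral_sampleMean_sub_sq (hφ i) hN0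
  -- A pointwise bound valid on all samples. After integration its last term is `K V (1 + log N) /
  -- N`, also below `ε / 4` for large `N`.
  have hpt : ∀ x : Fin N → S, |F N x - H (0, v₀)| ≤ ε / 4 + ε / 4 +
      K * (1 + Real.log N) * ∑ i, (sampleMean (φ i) x - v₀ i) ^ 2 := by
    intro x
    set v : Fin d → ℝ := fun i => sampleMean (φ i) x with hv
    set D := ∑ i, (v i - v₀ i) ^ 2 with hDdef
    have hD0 : 0 ≤ D := Finset.sum_nonneg fun i _ => sq_nonneg _
    have h1 : |F N x - H ((N : ℝ)⁻¹, v)| ≤ ε / 4 := by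
      refine (hFH N hN0 x).trans ?_
      rw [Real.dist_eq, sub_zero] at b3
      exact (le_abs_self _).trans b3.le
    -- If all sample means are within `δ`, use continuity of `H`. Otherwise some coordinate gives `δ
    -- ^ 2 ≤ D`, and the growth bound together with the constant `|H (0, v₀)|` is absorbed by the
    -- squared deviation.
    have h2 : |H ((N : ℝ)⁻¹, v) - H (0, v₀)| ≤ ε / 4 + K * (1 + Real.log N) * D := by
      by_cases hd : ∀ i, |v i - v₀ i| < δ
      · have : dist ((N : ℝ)⁻¹, v) ((0 : ℝ), v₀) < δ := by
          rw [Prod.dist_eq, max_lt_iff]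
          refine ⟨?_, (dist_pi_lt_iff hδ).2 hd⟩
          rw [Real.dist_eq, sub_zero, abs_of_nonneg (by positivity)]
          exact b4
        have := (hball this).le
        rw [Real.dist_eq] at this
        exact this.trans (le_add_of_nonneg_right (by positivity))
      · push Not at hd
        obtain ⟨i, hi⟩ := hd
        have hDδ : 1 ≤ D / δ ^ 2 := by
          rw [le_div_iff₀ (by positivity), one_mul]
          calc δ ^ 2 ≤ |v i - v₀ i| ^ 2 := by gcongr
            _ = (v i - v₀ i) ^ 2 := sq_abs _
            _ ≤ D := Finset.single_le_sum (f := fun i => (v i - v₀ i) ^ 2)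
              (fun i _ => sq_nonneg _) (Finset.mem_univ i)
        have hsum : 1 + ∑ i, |v i| ≤ M + d + D := by
          have : ∀ i, |v i| ≤ |v₀ i| + (1 + (v i - v₀ i) ^ 2) := fun i => by
            have h1 := abs_add_le (v₀ i) (v i - v₀ i)
            rw [add_sub_cancel] at h1
            have h2 : |v i - v₀ i| ≤ 1 + |v i - v₀ i| ^ 2 := by
              nlinarith [sq_nonneg (|v i - v₀ i| - 1), abs_nonneg (v i - v₀ i)]
            rw [sq_abs] at h2
            linarith
          have := Finset.sum_le_sum fun i (_ : i ∈ Finset.univ) => this i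
          rw [Finset.sum_add_distrib, Finset.sum_add_distrib] at this
          simp only [Finset.sum_const, Finset.card_univ, Fintype.card_fin, nsmul_eq_mul,
            mul_one] at this
          linarith
        have h3 := hC N hN0 x
        have h4 : C * (1 + Real.log N) * (1 + ∑ i, |v i|) ≤
            (|C| * ((M + d) / δ ^ 2 + 1)) * (1 + Real.log N) * D := by
          have : 1 + ∑ i, |v i| ≤ ((M + d) / δ ^ 2 + 1) * D := by
            have : M + d ≤ (M + d) * (D / δ ^ 2) := le_mul_of_one_le_right (by positivity) hDδ
            calc _ ≤ M + d + D := hsum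
              _ ≤ (M + d) * (D / δ ^ 2) + D := by linarith
              _ = _ := by ring
          calc C * (1 + Real.log N) * (1 + ∑ i, |v i|)
              ≤ |C| * (1 + Real.log N) * (((M + d) / δ ^ 2 + 1) * D) := by
                gcongr
                exact le_abs_self C
            _ = _ := by ring
        have h5 : |H (0, v₀)| ≤ |H (0, v₀)| / δ ^ 2 * (1 + Real.log N) * D := by
          calc |H (0, v₀)| ≤ |H (0, v₀)| * (D / δ ^ 2) :=
                le_mul_of_one_le_right (abs_nonneg _) hDδ
            _ = |H (0, v₀)| / δ ^ 2 * 1 * D := by ring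
            _ ≤ _ := by gcongr; linarith
        calc |H ((N : ℝ)⁻¹, v) - H (0, v₀)| ≤ |H ((N : ℝ)⁻¹, v)| + |H (0, v₀)| := abs_sub _ _
          _ ≤ (|C| * ((M + d) / δ ^ 2 + 1)) * (1 + Real.log N) * D +
              |H (0, v₀)| / δ ^ 2 * (1 + Real.log N) * D := by
            have := h3.trans h4
            linarith
          _ = K * (1 + Real.log N) * D := by rw [hK]; ring
          _ ≤ _ := by linarith
    have := abs_sub_le (F N x) (H ((N : ℝ)⁻¹, v)) (H (0, v₀))
    linarith
  have hbd : Integrable (fun x : Fin N → S => ε / 4 + ε / 4 +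
      K * (1 + Real.log N) * ∑ i, (sampleMean (φ i) x - v₀ i) ^ 2) (sampleLaw P N) :=
    (integrable_const _).add ((integrable_finsetSum _ fun i _ => hD i).const_mul _)
  rw [Real.dist_eq]
  calc |∫ x, F N x ∂(sampleLaw P N) - H (0, v₀)|
      = |∫ x, (F N x - H (0, v₀)) ∂(sampleLaw P N)| := by
        rw [integral_sub (hint N hN0) (integrable_const _)]; simp
    _ ≤ ∫ x, |F N x - H (0, v₀)| ∂(sampleLaw P N) := abs_integral_le_integral_abs
    _ ≤ ∫ x, (ε / 4 + ε / 4 +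
      K * (1 + Real.log N) * ∑ i, (sampleMean (φ i) x - v₀ i) ^ 2) ∂(sampleLaw P N) :=
        integral_mono ((hint N hN0).sub (integrable_const _)).abs hbd hpt
    _ = ε / 4 + ε / 4 + K * V * ((1 + Real.log N) / N) := by
        rw [integral_add (integrable_const _)
          ((integrable_finsetSum _ fun i _ => hD i).const_mul _), integral_const_mul, hDint]
        simp; ring
    _ < ε := by
        rw [Real.dist_eq, sub_zero] at b2
        have := (le_abs_self _).trans_lt b2
        linarith

end Averages

/-! ### The BGe score for a general law with nondegenerate covariance. -/

/-- Exhibits the posterior scatter as `N` times a function of sample moments and `N⁻¹`, which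
extends continuously to `N⁻¹ = 0`, where it is the empirical covariance formula. -/
lemma centeredSum_eq_mul {κ : ℝ} (hκ : 0 < κ) {N : ℕ} (hN : N ≠ 0) {S : Type*} (x : Fin N → S)
    (f g : S → ℝ) :
    centeredSum κ (fun k => f (x k)) (fun k => g (x k)) =
      N * (sampleMean (fun s => f s * g s) x -
        sampleMean f x * sampleMean g x / (1 + κ * (N : ℝ)⁻¹)) := by
  have hN' : (0 : ℝ) < N := by positivity
  have h1 : 1 + κ * (N : ℝ)⁻¹ = (κ + N) / N := by field_simp; ring
  have h2 : κ + N ≠ 0 := by positivity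
  rw [centeredSum, sampleMean, sampleMean, sampleMean, h1]
  field_simp

/-- The first and second moments of a pair. -/
def pairMoments : Fin 5 → ℝ × ℝ → ℝ :=
  ![fun s => s.1, fun s => s.2, fun s => s.1 * s.1, fun s => s.1 * s.2, fun s => s.2 * s.2]

/-- The normalized log posterior ratio as a function of `N⁻¹` and the sample moments, up to
terms that do not depend on the data. -/
noncomputable def bgeProfile (κ αw t : ℝ) (w : ℝ × (Fin 5 → ℝ)) : ℝ :=
  (1 + αw * w.1) / 2 *
    (Real.log (t * w.1 + (w.2 2 - w.2 0 * w.2 0 / (1 + κ * w.1))) +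
      Real.log (t * w.1 + (w.2 4 - w.2 1 * w.2 1 / (1 + κ * w.1))) -
      Real.log ((t * w.1 + (w.2 2 - w.2 0 * w.2 0 / (1 + κ * w.1))) *
        (t * w.1 + (w.2 4 - w.2 1 * w.2 1 / (1 + κ * w.1))) -
        (w.2 3 - w.2 0 * w.2 1 / (1 + κ * w.1)) ^ 2)) -
    w.1 / 2 * (Real.log (t * w.1 + (w.2 2 - w.2 0 * w.2 0 / (1 + κ * w.1))) +
      Real.log (t * w.1 + (w.2 4 - w.2 1 * w.2 1 / (1 + κ * w.1))))

/-- At `N⁻¹ = 0` the corrections from the prior vanish, and the three logarithms have the variances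
and the determinant of the covariance matrix as arguments. -/
lemma continuousAt_bgeProfile (κ αw t : ℝ) {v : Fin 5 → ℝ} (h₁ : v 2 - v 0 * v 0 ≠ 0)
    (h₂ : v 4 - v 1 * v 1 ≠ 0)
    (h₃ : (v 2 - v 0 * v 0) * (v 4 - v 1 * v 1) - (v 3 - v 0 * v 1) ^ 2 ≠ 0) :
    ContinuousAt (bgeProfile κ αw t) (0, v) := by
  unfold bgeProfile
  have c : ∀ i : Fin 5, ContinuousAt (fun w : ℝ × (Fin 5 → ℝ) => w.2 i) (0, v) :=
    fun i => by fun_prop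
  have cu : ContinuousAt (fun w : ℝ × (Fin 5 → ℝ) => w.1) (0, v) := by fun_prop
  have cd : ∀ i j k : Fin 5, ContinuousAt
      (fun w : ℝ × (Fin 5 → ℝ) => w.2 i - w.2 j * w.2 k / (1 + κ * w.1)) (0, v) := fun i j k =>
    (c i).sub (((c j).mul (c k)).div (continuousAt_const.add (cu.const_mul κ)) (by simp))
  have ct : ContinuousAt (fun w : ℝ × (Fin 5 → ℝ) => t * w.1) (0, v) := by fun_prop
  have l1 := (ct.add (cd 2 0 0)).log (by simpa using h₁)
  have l2 := (ct.add (cd 4 1 1)).log (by simpa using h₂)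
  have l3 := (((ct.add (cd 2 0 0)).mul (ct.add (cd 4 1 1))).sub ((cd 3 0 1).pow 2)).log
    (by simpa using h₃)
  exact (((continuousAt_const.add (cu.const_mul αw)).div_const 2).mul
    ((l1.add l2).sub l3)).sub ((cu.div_const 2).mul (l1.add l2))

/-- For `N ≥ 2` both arguments lie in `[2, ∞)`, where `Γ` increases. The ratio is therefore at least
`1`, and by the functional equation at most `(a + N - 1) / 2`, so its logarithm grows only like `log
N`. -/
lemma tendsto_log_Gamma_sub_div {a : ℝ} (ha : 3 < a) :
    Tendsto (fun N : ℕ => (Real.log (Real.Gamma ((a + N) / 2)) -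
      Real.log (Real.Gamma ((a + N - 1) / 2))) / (N : ℝ)) atTop (𝓝 0) := by
  have hup : Tendsto (fun N : ℕ => Real.log a / (N : ℝ) + (1 + Real.log N) / (N : ℝ)) atTop
      (𝓝 (0 + 0)) :=
    (tendsto_const_div_atTop_nhds_zero_nat _).add tendsto_one_add_log_div_atTop
  rw [add_zero] at hup
  refine tendsto_of_tendsto_of_tendsto_of_le_of_le' tendsto_const_nhds hup ?_ ?_
  all_goals
    filter_upwards [eventually_ge_atTop 2] with N hN
    have hN' : (2 : ℝ) ≤ N := by exact_mod_cast hN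
    have hG2 : 0 < Real.Gamma ((a + N - 1) / 2) := Real.Gamma_pos_of_pos (by linarith)
    have hG1 : 0 < Real.Gamma ((a + N) / 2) := Real.Gamma_pos_of_pos (by linarith)
    have mono := Real.Gamma_strictMonoOn_Ici.monotoneOn
  · have : Real.Gamma ((a + N - 1) / 2) ≤ Real.Gamma ((a + N) / 2) :=
      mono (Set.mem_Ici.2 (by linarith)) (Set.mem_Ici.2 (by linarith)) (by linarith)
    have := Real.log_le_log hG2 this
    exact div_nonneg (by linarith) (by linarith)
  · rw [← add_div]
    refine div_le_div_of_nonneg_right ?_ (by linarith)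
    have h1 : Real.Gamma ((a + N) / 2) ≤ Real.Gamma ((a + N - 1) / 2 + 1) :=
      mono (Set.mem_Ici.2 (by linarith)) (Set.mem_Ici.2 (by linarith)) (by linarith)
    rw [Real.Gamma_add_one (by linarith)] at h1
    have h2 := Real.log_le_log hG1 h1
    rw [Real.log_mul (by linarith) hG2.ne'] at h2
    have h3 : Real.log ((a + N - 1) / 2) ≤ Real.log (a * N) :=
      Real.log_le_log (by linarith) (by nlinarith)
    rw [Real.log_mul (by linarith) (by linarith)] at h3
    linarith

/-- The lower bounds on the scale matrix bound the logarithms below by `log t - log N`, twice that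
for the determinant; `log x ≤ x - 1` bounds those of the diagonal entries above by second moments.
Since the determinant is at most the product of the diagonal entries, the main bracket is
nonnegative and needs only an upper bound. -/
lemma abs_bgeProfile_le {κ αw t : ℝ} (hαw : 0 ≤ αw) (ht : 0 < t) {N : ℕ} (hN : N ≠ 0)
    {v : Fin 5 → ℝ}
    (hy : t ≤ N * (t * (N : ℝ)⁻¹ + (v 2 - v 0 * v 0 / (1 + κ * (N : ℝ)⁻¹))))
    (hz : t ≤ N * (t * (N : ℝ)⁻¹ + (v 4 - v 1 * v 1 / (1 + κ * (N : ℝ)⁻¹))))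
    (hd : t ^ 2 ≤ N ^ 2 * ((t * (N : ℝ)⁻¹ + (v 2 - v 0 * v 0 / (1 + κ * (N : ℝ)⁻¹))) *
        (t * (N : ℝ)⁻¹ + (v 4 - v 1 * v 1 / (1 + κ * (N : ℝ)⁻¹))) -
        (v 3 - v 0 * v 1 / (1 + κ * (N : ℝ)⁻¹)) ^ 2)) (hκ : 0 < κ) :
    |bgeProfile κ αw t ((N : ℝ)⁻¹, v)| ≤
      ((2 + αw) / 2 * (2 * t + 2 * |Real.log t| + 2)) * (1 + Real.log N) *
        (1 + ∑ i, |v i|) := by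
  have hN1 : (1 : ℝ) ≤ N := by exact_mod_cast Nat.one_le_iff_ne_zero.2 hN
  have hNpos : (0 : ℝ) < N := by linarith
  set u := (N : ℝ)⁻¹ with hu
  have hu0 : 0 < u := by positivity
  have hu1 : u ≤ 1 := inv_le_one_of_one_le₀ hN1
  set ℓ := Real.log N with hℓ
  have hℓ0 : 0 ≤ ℓ := Real.log_natCast_nonneg N
  have hden : 0 < 1 + κ * u := by positivity
  have hry : t * u + (v 2 - v 0 * v 0 / (1 + κ * u)) ≤ t + |v 2| := by
    have h1 : 0 ≤ v 0 * v 0 / (1 + κ * u) := div_nonneg (mul_self_nonneg _) hden.le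
    have h2 := le_abs_self (v 2)
    have h3 := mul_le_of_le_one_right ht.le hu1
    linarith
  have hrz : t * u + (v 4 - v 1 * v 1 / (1 + κ * u)) ≤ t + |v 4| := by
    have h1 : 0 ≤ v 1 * v 1 / (1 + κ * u) := div_nonneg (mul_self_nonneg _) hden.le
    have h2 := le_abs_self (v 4)
    have h3 := mul_le_of_le_one_right ht.le hu1
    linarith
  unfold bgeProfile
  simp only
  set ry := t * u + (v 2 - v 0 * v 0 / (1 + κ * u))
  set rz := t * u + (v 4 - v 1 * v 1 / (1 + κ * u))
  set b := v 3 - v 0 * v 1 / (1 + κ * u)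
  have ry0 : 0 < ry := pos_of_mul_pos_right (ht.trans_le hy) hNpos.le
  have rz0 : 0 < rz := pos_of_mul_pos_right (ht.trans_le hz) hNpos.le
  have d0 : 0 < ry * rz - b ^ 2 :=
    pos_of_mul_pos_right ((by positivity : 0 < t ^ 2).trans_le hd) (by positivity)
  have ly : Real.log t ≤ ℓ + Real.log ry := by
    rw [hℓ, ← Real.log_mul hNpos.ne' ry0.ne']; exact Real.log_le_log ht hy
  have lz : Real.log t ≤ ℓ + Real.log rz := by
    rw [hℓ, ← Real.log_mul hNpos.ne' rz0.ne']; exact Real.log_le_log ht hz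
  have ld : 2 * Real.log t ≤ 2 * ℓ + Real.log (ry * rz - b ^ 2) := by
    have := Real.log_le_log (by positivity) hd
    rw [Real.log_mul (by positivity) d0.ne', Real.log_pow, Real.log_pow] at this
    exact_mod_cast this
  have ld' : Real.log (ry * rz - b ^ 2) ≤ Real.log ry + Real.log rz := by
    rw [← Real.log_mul ry0.ne' rz0.ne']
    exact Real.log_le_log d0 (sub_le_self _ (sq_nonneg b))
  have uy : Real.log ry ≤ t + |v 2| := by
    have := Real.log_le_sub_one_of_pos ry0
    linarith
  have uz : Real.log rz ≤ t + |v 4| := by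
    have := Real.log_le_sub_one_of_pos rz0
    linarith
  have lt1 := neg_abs_le (Real.log t)
  have p2 := abs_nonneg (v 2)
  have p4 := abs_nonneg (v 4)
  have pt := abs_nonneg (Real.log t)
  set B := 2 * t + 2 * |Real.log t| + 2 * ℓ + |v 2| + |v 4| with hB
  have hB0 : 0 ≤ B := by positivity
  have hG0 : 0 ≤ Real.log ry + Real.log rz - Real.log (ry * rz - b ^ 2) := by linarith
  have hG1 : Real.log ry + Real.log rz - Real.log (ry * rz - b ^ 2) ≤ B := by
    rw [hB]; linarith
  have hL : |Real.log ry + Real.log rz| ≤ B := by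
    rw [abs_le, hB]; constructor <;> linarith
  have hs : |v 2| + |v 4| ≤ ∑ i, |v i| := by
    rw [Fin.sum_univ_five]
    have := abs_nonneg (v 0)
    have := abs_nonneg (v 1)
    have := abs_nonneg (v 3)
    linarith
  set s := ∑ i, |v i| with hsdef
  have hs0 : 0 ≤ s := by linarith
  have hBs : B ≤ (2 * t + 2 * |Real.log t| + 2) * ((1 + ℓ) * (1 + s)) := by
    have h0 : 0 ≤ ℓ * s := mul_nonneg hℓ0 hs0
    have h1 : 1 ≤ (1 + ℓ) * (1 + s) := by rw [one_add_mul, mul_one_add]; linarith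
    have h2 : ℓ + s ≤ (1 + ℓ) * (1 + s) := by rw [one_add_mul, mul_one_add]; linarith
    have h3 : (2 * t + 2 * |Real.log t|) * 1 ≤ (2 * t + 2 * |Real.log t|) * ((1 + ℓ) * (1 + s)) :=
      mul_le_mul_of_nonneg_left h1 (by positivity)
    rw [hB]; linarith
  calc _ ≤ |(1 + αw * u) / 2 * (Real.log ry + Real.log rz - Real.log (ry * rz - b ^ 2))| +
        |u / 2 * (Real.log ry + Real.log rz)| := abs_sub _ _
    _ = (1 + αw * u) / 2 * (Real.log ry + Real.log rz - Real.log (ry * rz - b ^ 2)) +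
        u / 2 * |Real.log ry + Real.log rz| := by
      rw [abs_mul, abs_mul, abs_of_nonneg hG0, abs_of_nonneg (by positivity : 0 ≤ u / 2),
        abs_of_nonneg (by positivity : 0 ≤ (1 + αw * u) / 2)]
    _ ≤ (1 + αw * 1) / 2 * B + 1 / 2 * B := by gcongr
    _ = (2 + αw) / 2 * B := by ring
    _ ≤ (2 + αw) / 2 * ((2 * t + 2 * |Real.log t| + 2) * ((1 + ℓ) * (1 + s))) := by gcongr
    _ = _ := by ring

lemma measurable_logPosteriorRatio_bge {q : Graph → ℝ} (hq : ∀ G, 0 < q G) {αμ αw t : ℝ}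
    (hαμ : 0 < αμ) (hαw : 3 < αw) (ht : 0 < t) (N : ℕ) :
    Measurable fun x : Fin N → ℝ × ℝ => logPosteriorRatio q (bgeLikelihood αμ αw t x) := by
  obtain ⟨K, hK⟩ := exists_logPosteriorRatio_bgeLikelihood_eq hq hαμ hαw ht
  simp_rw [hK N]
  unfold scaleDet scaleDiag centeredSum
  fun_prop

/-- Integrability and limit of the normalized log posterior ratio under the BGe score, for samples
from a law with fourth moments and nondegenerate covariance. -/
theorem bge_integrable_and_tendsto {q : Graph → ℝ} (hq : ∀ G, 0 < q G) {αμ αw t : ℝ}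
    (hαμ : 0 < αμ) (hαw : 3 < αw) (ht : 0 < t) {P : Measure (ℝ × ℝ)} [IsProbabilityMeasure P]
    (hP : ∀ i, MemLp (pairMoments i) 2 P) {v : Fin 5 → ℝ} (hv : ∀ i, ∫ s, pairMoments i s ∂P = v i)
    (h₁ : 0 < v 2 - v 0 * v 0) (h₂ : 0 < v 4 - v 1 * v 1)
    (h₃ : 0 < (v 2 - v 0 * v 0) * (v 4 - v 1 * v 1) - (v 3 - v 0 * v 1) ^ 2) :
    (∀ N : ℕ, Integrable
        (fun x : Fin N → ℝ × ℝ => logPosteriorRatio q (bgeLikelihood αμ αw t x))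
        (sampleLaw P N)) ∧
      Tendsto (fun N : ℕ => ragRatio q αμ αw t P N) atTop
        (𝓝 (1 / 2 * (Real.log (v 2 - v 0 * v 0) + Real.log (v 4 - v 1 * v 1) -
          Real.log ((v 2 - v 0 * v 0) * (v 4 - v 1 * v 1) - (v 3 - v 0 * v 1) ^ 2)))) := by
  obtain ⟨K, hK⟩ := exists_logPosteriorRatio_bgeLikelihood_eq hq hαμ hαw ht
  have hv' : (fun i => ∫ s, pairMoments i s ∂P) = v := funext hv
  have hdiag : ∀ (N : ℕ), N ≠ 0 → ∀ x : Fin N → ℝ × ℝ,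
      scaleDiag αμ t (fun k => (x k).1) = N * (t * (N : ℝ)⁻¹ + (sampleMean (pairMoments 2) x -
        sampleMean (pairMoments 0) x * sampleMean (pairMoments 0) x / (1 + αμ * (N : ℝ)⁻¹))) ∧
      scaleDiag αμ t (fun k => (x k).2) = N * (t * (N : ℝ)⁻¹ + (sampleMean (pairMoments 4) x -
        sampleMean (pairMoments 1) x * sampleMean (pairMoments 1) x / (1 + αμ * (N : ℝ)⁻¹))) ∧
      centeredSum αμ (fun k => (x k).1) (fun k => (x k).2) = N * (sampleMean (pairMoments 3) x -
        sampleMean (pairMoments 0) x * sampleMean (pairMoments 1) x / (1 + αμ * (N : ℝ)⁻¹)) := by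
    intro N hN x
    have hNpos : (0 : ℝ) < N := by positivity
    have hNt : N * (t * (N : ℝ)⁻¹) = t := by field_simp
    refine ⟨?_, ?_, centeredSum_eq_mul hαμ hN x Prod.fst Prod.snd⟩
    · rw [scaleDiag, mul_add, hNt]
      exact congrArg _ (centeredSum_eq_mul hαμ hN x Prod.fst Prod.fst)
    · rw [scaleDiag, mul_add, hNt]
      exact congrArg _ (centeredSum_eq_mul hαμ hN x Prod.snd Prod.snd)
  have hdet : ∀ (N : ℕ), N ≠ 0 → ∀ x : Fin N → ℝ × ℝ,
      scaleDet αμ t (fun k => (x k).1) (fun k => (x k).2) =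
        N ^ 2 * ((t * (N : ℝ)⁻¹ + (sampleMean (pairMoments 2) x -
        sampleMean (pairMoments 0) x * sampleMean (pairMoments 0) x / (1 + αμ * (N : ℝ)⁻¹))) *
        (t * (N : ℝ)⁻¹ + (sampleMean (pairMoments 4) x -
        sampleMean (pairMoments 1) x * sampleMean (pairMoments 1) x / (1 + αμ * (N : ℝ)⁻¹))) -
        (sampleMean (pairMoments 3) x -
        sampleMean (pairMoments 0) x * sampleMean (pairMoments 1) x /
          (1 + αμ * (N : ℝ)⁻¹)) ^ 2) := by
    intro N hN x
    obtain ⟨e1, e2, e3⟩ := hdiag N hN x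
    rw [scaleDet, e1, e2, e3]; ring
  -- All terms that do not depend on the data. The factors `N` taken out of the scale matrix cancel
  -- in the main bracket, since the determinant carries `N ^ 2`, and leave `-log N` from the term
  -- with coefficient `1 / 2`.
  set c : ℕ → ℝ := fun N => K / N + (Real.log (Real.Gamma ((αw + N) / 2)) -
    Real.log (Real.Gamma ((αw + N - 1) / 2))) / (N : ℝ) - Real.log N / N with hc
  have hc0 : Tendsto (fun N => |c N|) atTop (𝓝 0) := by
    have h1 : Tendsto (fun N : ℕ => Real.log N / (N : ℝ)) atTop (𝓝 0) :=
      (Real.isLittleO_log_id_atTop.tendsto_div_nhds_zero).comp tendsto_natCast_atTop_atTop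
    have := ((tendsto_const_div_atTop_nhds_zero_nat K).add
      (tendsto_log_Gamma_sub_div hαw)).sub h1
    simpa using this.abs
  have main := tendsto_integral_of_sampleMean (P := P) (φ := pairMoments) hP
    (F := fun N x => 1 / (N : ℝ) * logPosteriorRatio q (bgeLikelihood αμ αw t x))
    (fun N => ((measurable_logPosteriorRatio_bge hq hαμ hαw ht N).const_mul _).aestronglyMeasurable)
    (H := bgeProfile αμ αw t)
    (by rw [hv']; exact continuousAt_bgeProfile αμ αw t h₁.ne' h₂.ne' h₃.ne') hc0
    (fun N hN x => by
      obtain ⟨e1, e2, e3⟩ := hdiag N hN x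
      have e4 := hdet N hN x
      have p1 := ht.trans_le (le_scaleDiag (t := t) hαμ (fun k => (x k).1))
      have p2 := ht.trans_le (le_scaleDiag (t := t) hαμ (fun k => (x k).2))
      have p3 := (by positivity : 0 < t ^ 2).trans_le
        (sq_le_scaleDet hαμ ht (fun k => (x k).1) (fun k => (x k).2))
      have hNpos : (0 : ℝ) < N := by positivity
      rw [e1] at p1
      rw [e2] at p2
      rw [e4] at p3
      refine le_of_eq (congrArg _ ?_)
      rw [hK N x, e1, e2, e4, bgeProfile,
        Real.log_mul hNpos.ne' (pos_of_mul_pos_right p1 hNpos.le).ne',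
        Real.log_mul hNpos.ne' (pos_of_mul_pos_right p2 hNpos.le).ne',
        Real.log_mul (by positivity) (pos_of_mul_pos_right p3 (by positivity)).ne', Real.log_pow]
      simp only [hc]
      field_simp
      push_cast
      ring)
    (C := (2 + αw) / 2 * (2 * t + 2 * |Real.log t| + 2))
    (fun N hN x => by
      obtain ⟨e1, e2, e3⟩ := hdiag N hN x
      refine abs_bgeProfile_le (by linarith) ht hN ?_ ?_ ?_ hαμ
      · rw [← e1]; exact le_scaleDiag hαμ _
      · rw [← e2]; exact le_scaleDiag hαμ _
      · rw [← hdet N hN x]; exact sq_le_scaleDet hαμ ht _ _)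
  refine ⟨fun N => ?_, ?_⟩
  -- The general result excludes `N = 0`; there the sample space is a single point and the integrand
  -- is constant.
  · rcases eq_or_ne N 0 with rfl | hN
    · have : (fun x : Fin 0 → ℝ × ℝ => logPosteriorRatio q (bgeLikelihood αμ αw t x)) =
          fun _ => logPosteriorRatio q (bgeLikelihood αμ αw t (default : Fin 0 → ℝ × ℝ)) :=
        funext fun x => by rw [Subsingleton.elim x default]
      rw [this]; exact integrable_const _
    · have := (main.1 N hN).const_mul (N : ℝ)
      refine this.congr (ae_of_all _ fun x => ?_)
      have : (N : ℝ) ≠ 0 := by positivity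
      simp only; field_simp
  · have h := main.2
    simp only [integral_const_mul, hv'] at h
    have e : bgeProfile αμ αw t (0, v) = 1 / 2 * (Real.log (v 2 - v 0 * v 0) +
        Real.log (v 4 - v 1 * v 1) -
        Real.log ((v 2 - v 0 * v 0) * (v 4 - v 1 * v 1) - (v 3 - v 0 * v 1) ^ 2)) := by
      simp [bgeProfile]
    rw [e] at h
    exact h

/-! ### Moments of the sampling law and the BGe limit. -/

instance isMarkovKernel_sdcKernel (μ₂ β σ₂ : ℝ) : IsMarkovKernel (sdcKernel μ₂ β σ₂) :=
  ⟨fun x => by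
    change IsProbabilityMeasure (gaussianReal _ _)
    infer_instance⟩

instance isProbabilityMeasure_sdcLaw (p : unitInterval) (μ₂ β σ₂ : ℝ) :
    IsProbabilityMeasure (sdcLaw p μ₂ β σ₂) := by
  unfold sdcLaw; infer_instance

/-- Composing a point mass with a kernel is a pushforward, so all expectations and probabilities
become averages over two Gaussian laws. -/
lemma sdcLaw_eq {p : unitInterval} (hp : (p : ℝ) = 1 / 2) (μ₂ β σ₂ : ℝ) :
    sdcLaw p μ₂ β σ₂ =
      (1 / 2 : ENNReal) • (gaussianReal (μ₂ + β) (σ₂ ^ 2).toNNReal).map (Prod.mk 1) +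
      (1 / 2 : ENNReal) • (gaussianReal μ₂ (σ₂ ^ 2).toNNReal).map (Prod.mk 0) := by
  have h1 : (unitInterval.toNNReal p : ENNReal) = 1 / 2 := by
    rw [← ENNReal.toReal_eq_toReal_iff' (by simp) (by simp)]
    simpa using hp
  have h2 : (unitInterval.toNNReal (unitInterval.symm p) : ENNReal) = 1 / 2 := by
    rw [← ENNReal.toReal_eq_toReal_iff' (by simp) (by simp)]
    simp [hp]; norm_num
  have e1 : sdcKernel μ₂ β σ₂ 1 = gaussianReal (μ₂ + β) (σ₂ ^ 2).toNNReal := by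
    change gaussianReal _ _ = _; rw [mul_one]
  have e0 : sdcKernel μ₂ β σ₂ 0 = gaussianReal μ₂ (σ₂ ^ 2).toNNReal := by
    change gaussianReal _ _ = _; rw [mul_zero, add_zero]
  rw [sdcLaw, bernoulliMeasure_def, Measure.compProd_add_left]
  change ((unitInterval.toNNReal p : ENNReal) • Measure.dirac (1 : ℝ)) ⊗ₘ _ +
    ((unitInterval.toNNReal (unitInterval.symm p) : ENNReal) • Measure.dirac (0 : ℝ)) ⊗ₘ _ = _
  have hd : ∀ a, Measure.dirac a ⊗ₘ sdcKernel μ₂ β σ₂ =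
      (sdcKernel μ₂ β σ₂ a).map (Prod.mk a) := fun a => by
    ext s hs; rw [Measure.dirac_compProd_apply hs, Measure.map_apply measurable_prodMk_left hs]
  rw [Measure.compProd_smul_left, Measure.compProd_smul_left, hd, hd, h1, h2, e1, e0]

section Moments

variable {p : unitInterval} {f : ℝ × ℝ → ℝ}

lemma memLp_sdcLaw (hp : (p : ℝ) = 1 / 2) (μ₂ β σ₂ : ℝ) (hf : Measurable f)
    (h : ∀ a m, MemLp (fun y => f (a, y)) 2 (gaussianReal m (σ₂ ^ 2).toNNReal)) :
    MemLp f 2 (sdcLaw p μ₂ β σ₂) := by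
  rw [memLp_two_iff_integrable_sq hf.aestronglyMeasurable, sdcLaw_eq hp]
  refine (Integrable.smul_measure ?_ (by simp)).add_measure (Integrable.smul_measure ?_ (by simp))
  all_goals
    rw [integrable_map_measure (hf.pow_const 2).aestronglyMeasurable (by fun_prop)]
    exact (h _ _).integrable_sq

lemma integral_sdcLaw (hp : (p : ℝ) = 1 / 2) (μ₂ β σ₂ : ℝ) (hf : Measurable f)
    (h : ∀ a m, Integrable (fun y => f (a, y)) (gaussianReal m (σ₂ ^ 2).toNNReal)) :
    ∫ s, f s ∂(sdcLaw p μ₂ β σ₂) =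
      1 / 2 * ∫ y, f (1, y) ∂(gaussianReal (μ₂ + β) (σ₂ ^ 2).toNNReal) +
      1 / 2 * ∫ y, f (0, y) ∂(gaussianReal μ₂ (σ₂ ^ 2).toNNReal) := by
  have hi : ∀ a m : ℝ, Integrable f ((gaussianReal m (σ₂ ^ 2).toNNReal).map (Prod.mk a)) :=
    fun a m => (integrable_map_measure hf.aestronglyMeasurable (by fun_prop)).2 (h a m)
  rw [sdcLaw_eq hp, integral_add_measure ((hi _ _).smul_measure (by simp))
    ((hi _ _).smul_measure (by simp)), integral_smul_measure, integral_smul_measure,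
    integral_map (by fun_prop) hf.aestronglyMeasurable,
    integral_map (by fun_prop) hf.aestronglyMeasurable]
  simp

lemma memLp_id_gaussian (r : NNReal) (m : ℝ) (v : NNReal) :
    MemLp (fun y : ℝ => y) r (gaussianReal m v) := memLp_id_gaussianReal r

lemma memLp_sq_gaussian (m : ℝ) (v : NNReal) :
    MemLp (fun y : ℝ => y * y) 2 (gaussianReal m v) := by
  rw [memLp_two_iff_integrable_sq (by fun_prop)]
  have := (memLp_id_gaussian 4 m v).integrable_norm_pow (by norm_num)
  refine this.congr (ae_of_all _ fun y => ?_)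
  simp only [Real.norm_eq_abs]
  rw [Even.pow_abs (by decide)]
  ring

lemma integral_sq_gaussian (m : ℝ) (v : NNReal) :
    ∫ y, y * y ∂(gaussianReal m v) = m ^ 2 + v := by
  have h := variance_eq_sub (memLp_id_gaussian 2 m v)
  rw [variance_fun_id_gaussianReal, integral_id_gaussianReal] at h
  have : ∫ y, y * y ∂(gaussianReal m v) = (gaussianReal m v)[(fun y => y) ^ 2] :=
    integral_congr_ae (ae_of_all _ fun y => by simp [sq])
  rw [this]; linarith

lemma memLp_pairMoments (hp : (p : ℝ) = 1 / 2) (μ₂ β σ₂ : ℝ) (i : Fin 5) :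
    MemLp (pairMoments i) 2 (sdcLaw p μ₂ β σ₂) := by
  have h2 := fun m => memLp_id_gaussian 2 m (σ₂ ^ 2).toNNReal
  fin_cases i
  · exact memLp_sdcLaw hp μ₂ β σ₂ (f := fun s => s.1) (by fun_prop) fun a m => memLp_const a
  · exact memLp_sdcLaw hp μ₂ β σ₂ (f := fun s => s.2) (by fun_prop) fun a m => h2 m
  · exact memLp_sdcLaw hp μ₂ β σ₂ (f := fun s => s.1 * s.1) (by fun_prop)
      fun a m => memLp_const (a * a)
  · exact memLp_sdcLaw hp μ₂ β σ₂ (f := fun s => s.1 * s.2) (by fun_prop)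
      fun a m => (h2 m).const_mul a
  · exact memLp_sdcLaw hp μ₂ β σ₂ (f := fun s => s.2 * s.2) (by fun_prop)
      fun a m => memLp_sq_gaussian m _

lemma integral_pairMoments (hp : (p : ℝ) = 1 / 2) (μ₂ β σ₂ : ℝ) (i : Fin 5) :
    ∫ s, pairMoments i s ∂(sdcLaw p μ₂ β σ₂) =
      (![1 / 2, μ₂ + β / 2, 1 / 2, (μ₂ + β) / 2,
        ((μ₂ + β) ^ 2 + μ₂ ^ 2) / 2 + σ₂ ^ 2] : Fin 5 → ℝ) i := by
  have h2 : ∀ m, Integrable (fun y : ℝ => y) (gaussianReal m (σ₂ ^ 2).toNNReal) :=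
    fun m => (memLp_id_gaussian 1 m _).integrable (by simp)
  have h4 : ∀ m, Integrable (fun y : ℝ => y * y) (gaussianReal m (σ₂ ^ 2).toNNReal) :=
    fun m => (memLp_sq_gaussian m _).integrable one_le_two
  have hv : (((σ₂ ^ 2).toNNReal : NNReal) : ℝ) = σ₂ ^ 2 := Real.coe_toNNReal _ (sq_nonneg _)
  fin_cases i
  · refine (integral_sdcLaw hp μ₂ β σ₂ (f := fun s => s.1) (by fun_prop)
      fun a m => integrable_const a).trans ?_
    simp
  · refine (integral_sdcLaw hp μ₂ β σ₂ (f := fun s => s.2) (by fun_prop) fun a m => h2 m).trans ?_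
    simp [integral_id_gaussianReal]; ring
  · refine (integral_sdcLaw hp μ₂ β σ₂ (f := fun s => s.1 * s.1) (by fun_prop)
      fun a m => integrable_const (a * a)).trans ?_
    simp
  · refine (integral_sdcLaw hp μ₂ β σ₂ (f := fun s => s.1 * s.2) (by fun_prop)
      fun a m => (h2 m).const_mul a).trans ?_
    simp [integral_id_gaussianReal]; ring
  · refine (integral_sdcLaw hp μ₂ β σ₂ (f := fun s => s.2 * s.2) (by fun_prop)
      fun a m => h4 m).trans ?_
    simp only [integral_sq_gaussian, hv]
    simp; ring

end Moments

/-- The BGe part: integrability of the log posterior ratio and limit of its expectation per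
sample. -/
theorem ragRatio_sdcLaw {p : unitInterval} (hp : (p : ℝ) = 1 / 2) (μ₂ β : ℝ) {σ₂ : ℝ}
    (hσ : 0 < σ₂) {q : Graph → ℝ} (hq : ∀ G, 0 < q G) {αμ αw t : ℝ}
    (hαμ : 0 < αμ) (hαw : 3 < αw) (ht : 0 < t) :
    (∀ N : ℕ, Integrable
        (fun x : Fin N → ℝ × ℝ => logPosteriorRatio q (bgeLikelihood αμ αw t x))
        (sampleLaw (sdcLaw p μ₂ β σ₂) N)) ∧
      Tendsto (fun N : ℕ => ragRatio q αμ αw t (sdcLaw p μ₂ β σ₂) N) atTop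
        (𝓝 (1 / 2 * Real.log (1 + β ^ 2 / (4 * σ₂ ^ 2)))) := by
  set v : Fin 5 → ℝ := ![1 / 2, μ₂ + β / 2, 1 / 2, (μ₂ + β) / 2,
        ((μ₂ + β) ^ 2 + μ₂ ^ 2) / 2 + σ₂ ^ 2] with hv
  -- These are the variances of `X₁` and `X₂` and the determinant of their covariance matrix; the
  -- product of the variances over the determinant is the argument of the logarithm in the limit.
  have e1 : v 2 - v 0 * v 0 = 1 / 4 := by simp [hv]; norm_num
  have e2 : v 4 - v 1 * v 1 = σ₂ ^ 2 + β ^ 2 / 4 := by simp [hv]; ring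
  have e3 : (v 2 - v 0 * v 0) * (v 4 - v 1 * v 1) - (v 3 - v 0 * v 1) ^ 2 = σ₂ ^ 2 / 4 := by
    rw [e1, e2]; simp [hv]; ring
  have main := bge_integrable_and_tendsto hq hαμ hαw ht (memLp_pairMoments hp μ₂ β σ₂)
    (integral_pairMoments hp μ₂ β σ₂) (by rw [e1]; norm_num) (by rw [e2]; positivity)
    (by rw [e3]; positivity)
  refine ⟨main.1, ?_⟩
  have h := main.2
  rw [e3, e1, e2] at h
  convert h using 3
  rw [← Real.log_mul (by norm_num) (by positivity), ← Real.log_div (by positivity) (by positivity)]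
  congr 1
  field_simp

/-! ### Normal tails, the median and the cell probabilities. -/

/-- The upper tail of the standard normal distribution. -/
noncomputable def normalTail (a : ℝ) : ℝ := (gaussianReal 0 1).real (Set.Ici a)

lemma gaussianReal_real_Ici (M m : ℝ) {σ : ℝ} (hσ : 0 < σ) :
    (gaussianReal M (σ ^ 2).toNNReal).real (Set.Ici m) = normalTail ((m - M) / σ) := by
  have h : gaussianReal M (σ ^ 2).toNNReal =
      ((gaussianReal 0 1).map (σ * ·)).map (· + M) := by
    rw [gaussianReal_map_const_mul, gaussianReal_map_add_const]
    congr 1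
    · ring
    · ext; simp [Real.coe_toNNReal _ (sq_nonneg σ)]
  rw [h, map_measureReal_apply (by fun_prop) measurableSet_Ici,
    map_measureReal_apply (by fun_prop) (measurableSet_Ici.preimage (by fun_prop)), normalTail]
  congr 1
  ext x
  simp only [Set.mem_preimage, Set.mem_Ici]
  rw [div_le_iff₀ hσ, sub_le_iff_le_add, mul_comm]

lemma gaussianReal_real_Iio (M m : ℝ) {σ : ℝ} (hσ : 0 < σ) :
    (gaussianReal M (σ ^ 2).toNNReal).real (Set.Iio m) = 1 - normalTail ((m - M) / σ) := by
  rw [← gaussianReal_real_Ici M m hσ, ← Set.compl_Ici, measureReal_compl measurableSet_Ici]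
  simp

/-- The standard normal law is invariant under reflection and has no atoms. -/
lemma normalTail_add_neg (a : ℝ) : normalTail a + normalTail (-a) = 1 := by
  have : NullSingletonClass (gaussianReal 0 1) := nullSingletonClass_gaussianReal one_ne_zero
  have h : gaussianReal 0 1 = (gaussianReal 0 1).map (fun x => -x) := by
    rw [gaussianReal_map_neg, neg_zero]
  have h2 : normalTail (-a) = (gaussianReal 0 1).real (Set.Iio a) := by
    rw [normalTail, h, map_measureReal_apply (by fun_prop) measurableSet_Ici, ← h,
      measureReal_congr Iio_ae_eq_Iic]
    congr 1
    ext x; simp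
  rw [h2, normalTail, ← Set.compl_Ici, measureReal_compl measurableSet_Ici]
  simp

lemma normalTail_strictAnti : StrictAnti normalTail := by
  intro a b hab
  have h1 : Set.Ici a = Set.Ico a b ∪ Set.Ici b := (Set.Ico_union_Ici_eq_Ici hab.le).symm
  have h2 : (gaussianReal 0 1).real (Set.Ici a) =
      (gaussianReal 0 1).real (Set.Ico a b) + (gaussianReal 0 1).real (Set.Ici b) := by
    rw [h1, measureReal_union _ measurableSet_Ici]
    exact Set.disjoint_left.2 fun x hx hx' => not_le.2 hx.2 hx'
  have h3 : 0 < (gaussianReal 0 1).real (Set.Ico a b) := by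
    rw [measureReal_def]
    refine ENNReal.toReal_pos (fun h => ?_) (measure_ne_top _ _)
    have := gaussianReal_absolutelyContinuous' 0 one_ne_zero h
    rw [Real.volume_Ico, ENNReal.ofReal_eq_zero] at this
    linarith
  unfold normalTail
  linarith

lemma normalTail_eq_integral (a : ℝ) :
    normalTail a = ∫ x in Set.Ioi a, 1 / √(2 * Real.pi) * Real.exp (-(x ^ 2 / 2)) := by
  rw [normalTail, measureReal_def, gaussianReal_apply_eq_integral 0 one_ne_zero,
    ENNReal.toReal_ofReal (integral_nonneg fun x => gaussianPDFReal_nonneg _ _ _),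
    integral_Ici_eq_integral_Ioi]
  refine integral_congr_ae (ae_of_all _ fun x => ?_)
  simp only [gaussianPDFReal, NNReal.coe_one, sub_zero, mul_one, one_div]
  rw [neg_div]

section Cells

variable {p : unitInterval} (μ₂ β : ℝ) {σ₂ : ℝ}

lemma sdcLaw_real_apply (hp : (p : ℝ) = 1 / 2) (σ₂ : ℝ) {s : Set (ℝ × ℝ)} (hs : MeasurableSet s) :
    (sdcLaw p μ₂ β σ₂).real s =
      1 / 2 * (gaussianReal (μ₂ + β) (σ₂ ^ 2).toNNReal).real (Prod.mk 1 ⁻¹' s) +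
      1 / 2 * (gaussianReal μ₂ (σ₂ ^ 2).toNNReal).real (Prod.mk 0 ⁻¹' s) := by
  have hfin : ∀ (μ : Measure (ℝ × ℝ)) [IsFiniteMeasure μ], ((1 / 2 : ENNReal) • μ) s ≠ ⊤ :=
    fun μ _ => ENNReal.mul_ne_top (by simp) (measure_ne_top _ _)
  rw [sdcLaw_eq hp, measureReal_add_apply (hfin _) (hfin _), measureReal_ennreal_smul_apply,
    measureReal_ennreal_smul_apply, map_measureReal_apply (by fun_prop) hs,
    map_measureReal_apply (by fun_prop) hs]
  simp

/-- The median of the mixture of the two conditional laws is the midpoint of their means. -/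
lemma eq_of_isMedian (hp : (p : ℝ) = 1 / 2) (hσ : 0 < σ₂) {m : ℝ}
    (hm : IsMedian (sdcLaw p μ₂ β σ₂).snd m) : m = μ₂ + β / 2 := by
  have hIci : (1 / 2 : ℝ) ≤ (sdcLaw p μ₂ β σ₂).snd.real (Set.Ici m) := by
    have := ENNReal.toReal_mono (measure_ne_top _ _) hm.2
    rw [measureReal_def]; simpa using this
  have hIic : (1 / 2 : ℝ) ≤ (sdcLaw p μ₂ β σ₂).snd.real (Set.Iic m) := by
    have := ENNReal.toReal_mono (measure_ne_top _ _) hm.1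
    rw [measureReal_def]; simpa using this
  have hv : (σ₂ ^ 2).toNNReal ≠ 0 := by simp; positivity
  have hna : ∀ M, NullSingletonClass (gaussianReal M (σ₂ ^ 2).toNNReal) :=
    fun M => nullSingletonClass_gaussianReal hv
  rw [Measure.snd, map_measureReal_apply measurable_snd measurableSet_Ici,
    sdcLaw_real_apply μ₂ β hp σ₂ (measurableSet_Ici.preimage measurable_snd)] at hIci
  rw [Measure.snd, map_measureReal_apply measurable_snd measurableSet_Iic,
    sdcLaw_real_apply μ₂ β hp σ₂ (measurableSet_Iic.preimage measurable_snd)] at hIic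
  have c1 : ∀ a : ℝ, Prod.mk a ⁻¹' (Prod.snd ⁻¹' Set.Ici m) = Set.Ici m := fun a => rfl
  have c2 : ∀ a : ℝ, Prod.mk a ⁻¹' (Prod.snd ⁻¹' Set.Iic m) = Set.Iic m := fun a => rfl
  rw [c1, c1, gaussianReal_real_Ici _ _ hσ, gaussianReal_real_Ici _ _ hσ] at hIci
  have i1 := measureReal_congr (Iio_ae_eq_Iic (μ := gaussianReal μ₂ (σ₂ ^ 2).toNNReal) (a := m))
  have i2 := measureReal_congr
    (Iio_ae_eq_Iic (μ := gaussianReal (μ₂ + β) (σ₂ ^ 2).toNNReal) (a := m))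
  rw [c2, c2, ← i1, ← i2, gaussianReal_real_Iio _ _ hσ, gaussianReal_real_Iio _ _ hσ] at hIic
  -- The two median inequalities give `≥ 1` and `≤ 1` respectively. Compared with the reflection
  -- identity, injectivity of the tail places the two standardized cutting points opposite each
  -- other, which determines `m`.
  have hsum : normalTail ((m - (μ₂ + β)) / σ₂) + normalTail ((m - μ₂) / σ₂) = 1 := by linarith
  have h2 := normalTail_add_neg ((m - μ₂) / σ₂)
  have h3 : (m - (μ₂ + β)) / σ₂ = -((m - μ₂) / σ₂) :=
    normalTail_strictAnti.injective (by linarith)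
  field_simp at h3
  linarith

/-- The probabilities of the cells `(1,1)`, `(1,0)`, `(0,1)`, `(0,0)`. -/
def cell : Fin 4 → Bool × Bool := ![(true, true), (true, false), (false, true), (false, false)]

/-- The indicator of a cell of the discretized data. -/
noncomputable def cellIndicator (m : ℝ) (i : Fin 4) (s : ℝ × ℝ) : ℝ :=
  if discretize m s = cell i then 1 else 0

lemma measurable_discretize (m : ℝ) : Measurable (discretize m) := by
  have h1 : Measurable fun s : ℝ × ℝ => (discretize m s).1 := by
    refine measurable_to_bool ?_
    have : (fun s : ℝ × ℝ => (discretize m s).1) ⁻¹' {true} = {s | s.1 = 1} := by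
      ext s; simp [discretize]
    rw [this]; exact measurableSet_eq_fun measurable_fst measurable_const
  have h2 : Measurable fun s : ℝ × ℝ => (discretize m s).2 := by
    refine measurable_to_bool ?_
    have : (fun s : ℝ × ℝ => (discretize m s).2) ⁻¹' {true} = {s | m ≤ s.2} := by
      ext s; simp [discretize]
    rw [this]; exact measurableSet_le measurable_const measurable_snd
  exact h1.prodMk h2

lemma cellIndicator_eq (m : ℝ) (i : Fin 4) :
    cellIndicator m i = (discretize m ⁻¹' {cell i}).indicator 1 := by
  ext s
  by_cases h : discretize m s = cell i
  · rw [Set.indicator_of_mem (by exact h), cellIndicator, if_pos h]; rfl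
  · rw [Set.indicator_of_notMem (by exact h), cellIndicator, if_neg h]

lemma memLp_cellIndicator (m : ℝ) (i : Fin 4) (P : Measure (ℝ × ℝ)) [IsProbabilityMeasure P] :
    MemLp (cellIndicator m i) 2 P := by
  rw [cellIndicator_eq]
  exact memLp_indicator_const 2 (measurable_discretize m (measurableSet_singleton _)) (1 : ℝ)
    (Or.inr (measure_ne_top _ _))

/-- At the midpoint the standardized cutting points are `-β / (2 σ₂)` and `β / (2 σ₂)`, whose tails
sum to `1`; hence the symmetric table. -/
lemma integral_cellIndicator (hp : (p : ℝ) = 1 / 2) (hσ : 0 < σ₂) (i : Fin 4) :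
    ∫ s, cellIndicator (μ₂ + β / 2) i s ∂(sdcLaw p μ₂ β σ₂) =
      (![1 / 2 * normalTail (-(β / (2 * σ₂))), 1 / 2 - 1 / 2 * normalTail (-(β / (2 * σ₂))),
        1 / 2 - 1 / 2 * normalTail (-(β / (2 * σ₂))),
        1 / 2 * normalTail (-(β / (2 * σ₂)))] : Fin 4 → ℝ) i := by
  have hs := measurable_discretize (μ₂ + β / 2) (measurableSet_singleton (cell i))
  rw [cellIndicator_eq, integral_indicator_one hs, sdcLaw_real_apply μ₂ β hp σ₂ hs]
  have a1 : (μ₂ + β / 2 - (μ₂ + β)) / σ₂ = -(β / (2 * σ₂)) := by field_simp; ring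
  have a0 : (μ₂ + β / 2 - μ₂) / σ₂ = β / (2 * σ₂) := by field_simp; ring
  have hadd := normalTail_add_neg (β / (2 * σ₂))
  have t1 := gaussianReal_real_Ici (μ₂ + β) (μ₂ + β / 2) hσ
  have t2 := gaussianReal_real_Iio (μ₂ + β) (μ₂ + β / 2) hσ
  have t3 := gaussianReal_real_Ici μ₂ (μ₂ + β / 2) hσ
  have t4 := gaussianReal_real_Iio μ₂ (μ₂ + β / 2) hσ
  rw [a1] at t1 t2
  rw [a0] at t3 t4
  have s1 : ∀ a b : Bool, Prod.mk (1 : ℝ) ⁻¹' (discretize (μ₂ + β / 2) ⁻¹' {(a, b)}) =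
      if a then (if b then Set.Ici (μ₂ + β / 2) else Set.Iio (μ₂ + β / 2)) else ∅ := by
    intro a b; ext y; cases a <;> cases b <;> simp [discretize]
  have s0 : ∀ a b : Bool, Prod.mk (0 : ℝ) ⁻¹' (discretize (μ₂ + β / 2) ⁻¹' {(a, b)}) =
      if a then ∅ else (if b then Set.Ici (μ₂ + β / 2) else Set.Iio (μ₂ + β / 2)) := by
    intro a b; ext y; cases a <;> cases b <;> simp [discretize]
  fin_cases i <;> simp [cell, s1, s0, t1, t2, t3, t4] <;> linarith

end Cells

/-! ### Dirichlet integrals and the BDe marginal likelihoods in closed form. -/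

lemma lintegral_Ioo_beta {c d w : ℝ} (hc : 0 < c) (hd : 0 < d) (hw : 0 < w) :
    ∫⁻ z in Set.Ioo 0 w, ENNReal.ofReal (z ^ (c - 1) * (w - z) ^ (d - 1)) =
      ENNReal.ofReal (w ^ (c + d - 1) * beta c d) := by
  have hB := beta_pos hc hd
  have h1 : ∫⁻ z in Set.Ioo (0 : ℝ) 1, ENNReal.ofReal (z ^ (c - 1) * (1 - z) ^ (d - 1)) =
      ENNReal.ofReal (beta c d) := by
    have h := lintegral_betaPDF_eq_one hc hd
    rw [lintegral_betaPDF] at h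
    have e : ∀ z : ℝ, ENNReal.ofReal (1 / beta c d * z ^ (c - 1) * (1 - z) ^ (d - 1)) =
        ENNReal.ofReal (1 / beta c d) * ENNReal.ofReal (z ^ (c - 1) * (1 - z) ^ (d - 1)) := by
      intro z; rw [mul_assoc, ENNReal.ofReal_mul (by positivity)]
    simp_rw [e] at h
    rw [lintegral_const_mul' _ _ ENNReal.ofReal_ne_top] at h
    calc _ = ENNReal.ofReal (beta c d) * (ENNReal.ofReal (1 / beta c d) *
        ∫⁻ z in Set.Ioo (0 : ℝ) 1, ENNReal.ofReal (z ^ (c - 1) * (1 - z) ^ (d - 1))) := by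
          rw [← mul_assoc, ← ENNReal.ofReal_mul hB.le, mul_one_div_cancel hB.ne']; simp
      _ = _ := by rw [h, mul_one]
  -- Rescaling to the unit interval: the integrand contributes `w ^ (c + d - 2)` and the Jacobian
  -- one more factor `w`.
  rw [← lintegral_indicator measurableSet_Ioo, ← Real.smul_map_volume_mul_left hw.ne',
    lintegral_smul_measure, lintegral_map ((by fun_prop : Measurable _).indicator
      measurableSet_Ioo) (by fun_prop), abs_of_pos hw]
  have e : ∀ z : ℝ, (Set.Ioo 0 w).indicator
      (fun z => ENNReal.ofReal (z ^ (c - 1) * (w - z) ^ (d - 1))) (w * z) =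
      (Set.Ioo 0 1).indicator (fun z => ENNReal.ofReal (w ^ (c + d - 2)) *
        ENNReal.ofReal (z ^ (c - 1) * (1 - z) ^ (d - 1))) z := by
    intro z
    by_cases hz : z ∈ Set.Ioo (0 : ℝ) 1
    · have hz0 : 0 < z := hz.1
      have hz1 : 0 < 1 - z := by linarith [hz.2]
      rw [Set.indicator_of_mem hz, Set.indicator_of_mem (show w * z ∈ Set.Ioo 0 w from
        ⟨by positivity, by nlinarith [hz.2]⟩), ← ENNReal.ofReal_mul (by positivity)]
      congr 1
      rw [show w - w * z = w * (1 - z) by ring, Real.mul_rpow hw.le hz0.le,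
        Real.mul_rpow hw.le hz1.le, show c + d - 2 = (c - 1) + (d - 1) by ring, Real.rpow_add hw]
      ring
    · rw [Set.indicator_of_notMem hz, Set.indicator_of_notMem]
      rintro ⟨h1, h2⟩
      exact hz ⟨pos_of_mul_pos_right h1 hw.le, by
        by_contra h; push Not at h; nlinarith⟩
  simp_rw [e]
  rw [lintegral_indicator measurableSet_Ioo, lintegral_const_mul' _ _ ENNReal.ofReal_ne_top, h1,
    smul_eq_mul, ← ENNReal.ofReal_mul (by positivity), ← ENNReal.ofReal_mul hw.le]
  congr 1
  rw [show c + d - 1 = 1 + (c + d - 2) by ring, Real.rpow_add hw, Real.rpow_one]; ring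

/-- The open simplex of cell probabilities. -/
def openSimplex : Set (ℝ × ℝ × ℝ) := {θ | ∀ c, 0 < cellProb θ c}

lemma mem_openSimplex (θ : ℝ × ℝ × ℝ) :
    θ ∈ openSimplex ↔ 0 < θ.1 ∧ 0 < θ.2.1 ∧ 0 < θ.2.2 ∧ 0 < 1 - θ.1 - θ.2.1 - θ.2.2 := by
  constructor
  · intro h
    exact ⟨h (true, true), h (true, false), h (false, true), h (false, false)⟩
  · rintro ⟨h1, h2, h3, h4⟩ ⟨_ | _, _ | _⟩ <;> assumption

lemma measurableSet_openSimplex : MeasurableSet openSimplex := by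
  have : openSimplex = {θ : ℝ × ℝ × ℝ | 0 < θ.1} ∩ ({θ | 0 < θ.2.1} ∩ ({θ | 0 < θ.2.2} ∩
      {θ | 0 < 1 - θ.1 - θ.2.1 - θ.2.2})) := by
    ext θ; exact mem_openSimplex θ
  rw [this]
  exact (measurableSet_lt (by fun_prop) (by fun_prop)).inter
    ((measurableSet_lt (by fun_prop) (by fun_prop)).inter
    ((measurableSet_lt (by fun_prop) (by fun_prop)).inter
    (measurableSet_lt (by fun_prop) (by fun_prop))))

/-- Integral of a Dirichlet kernel times powers of the marginal probabilities of the first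
variable. -/
lemma lintegral_openSimplex {a b c d n l : ℝ} (ha : 0 < a) (hb : 0 < b) (hc : 0 < c) (hd : 0 < d)
    (hn : 0 ≤ n) (hl : 0 ≤ l) :
    ∫⁻ θ in openSimplex, ENNReal.ofReal (θ.1 ^ (a - 1) * θ.2.1 ^ (b - 1) * θ.2.2 ^ (c - 1) *
      (1 - θ.1 - θ.2.1 - θ.2.2) ^ (d - 1) * ((θ.1 + θ.2.1) ^ n * (1 - θ.1 - θ.2.1) ^ l)) =
    ENNReal.ofReal (beta a b * beta c d * beta (a + b + n) (c + d + l)) := by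
  have hB1 := beta_pos ha hb
  have hB2 := beta_pos hc hd
  set Φ : ℝ × ℝ × ℝ → ENNReal := fun θ => ENNReal.ofReal (θ.1 ^ (a - 1) * θ.2.1 ^ (b - 1) *
    θ.2.2 ^ (c - 1) * (1 - θ.1 - θ.2.1 - θ.2.2) ^ (d - 1) *
      ((θ.1 + θ.2.1) ^ n * (1 - θ.1 - θ.2.1) ^ l)) with hΦ
  have hΦm : Measurable Φ := by fun_prop
  have hG : Measurable (openSimplex.indicator Φ) := hΦm.indicator measurableSet_openSimplex
  rw [← lintegral_indicator measurableSet_openSimplex]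
  refine (lintegral_prod _ hG.aemeasurable).trans ?_
  -- The coordinate `s = θ.1 + θ.2.1`, the probability of `X₁ = 1`, replaces `θ.2.1`; the third
  -- coordinate then ranges over `(0, 1 - s)` and gives a beta integral.
  have h1 : ∀ x : ℝ, ∫⁻ w : ℝ × ℝ, openSimplex.indicator Φ (x, w) =
      ∫⁻ s, {s : ℝ | 0 < x ∧ x < s ∧ s < 1}.indicator (fun s =>
        ENNReal.ofReal (x ^ (a - 1) * (s - x) ^ (b - 1)) *
        ENNReal.ofReal (s ^ n * (1 - s) ^ (c + d + l - 1) * beta c d)) s := by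
    intro x
    have hGx : Measurable fun w : ℝ × ℝ => openSimplex.indicator Φ (x, w) :=
      hG.comp (by fun_prop)
    refine (lintegral_prod _ hGx.aemeasurable).trans ?_
    rw [← lintegral_sub_right_eq_self _ x]
    refine lintegral_congr fun s => ?_
    by_cases hs : 0 < x ∧ x < s ∧ s < 1
    · obtain ⟨hx, hxs, hs1⟩ := hs
      have hs0 : 0 < s := hx.trans hxs
      have h1s : 0 < 1 - s := by linarith
      have hsx : 0 < s - x := by linarith
      rw [Set.indicator_of_mem (show s ∈ {s : ℝ | 0 < x ∧ x < s ∧ s < 1} from ⟨hx, hxs, hs1⟩)]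
      have e : ∀ z, openSimplex.indicator Φ (x, (s - x, z)) =
          (Set.Ioo 0 (1 - s)).indicator (fun z =>
            ENNReal.ofReal (x ^ (a - 1) * (s - x) ^ (b - 1) * (s ^ n * (1 - s) ^ l)) *
            ENNReal.ofReal (z ^ (c - 1) * ((1 - s) - z) ^ (d - 1))) z := by
        intro z
        by_cases hz : z ∈ Set.Ioo 0 (1 - s)
        · rw [Set.indicator_of_mem hz, Set.indicator_of_mem ((mem_openSimplex _).2
            ⟨hx, hsx, hz.1, by simp only; linarith [hz.2]⟩), hΦ,
            ← ENNReal.ofReal_mul (by positivity)]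
          simp only
          rw [show x + (s - x) = s by ring, show 1 - x - (s - x) = 1 - s by ring]
          congr 1; ring
        · rw [Set.indicator_of_notMem hz, Set.indicator_of_notMem]
          intro h
          obtain ⟨_, _, h3, h4⟩ := (mem_openSimplex _).1 h
          simp only at h3 h4
          exact hz ⟨h3, by linarith⟩
      simp_rw [e]
      rw [lintegral_indicator measurableSet_Ioo, lintegral_const_mul' _ _ ENNReal.ofReal_ne_top,
        lintegral_Ioo_beta hc hd h1s, ← ENNReal.ofReal_mul (by positivity),
        ← ENNReal.ofReal_mul (by positivity)]
      congr 1
      rw [show c + d + l - 1 = l + (c + d - 1) by ring, Real.rpow_add h1s]; ring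
    · rw [Set.indicator_of_notMem (by exact hs)]
      have e : ∀ z, openSimplex.indicator Φ (x, (s - x, z)) = 0 := by
        intro z
        refine Set.indicator_of_notMem (fun h => hs ?_) _
        obtain ⟨h1, h2, h3, h4⟩ := (mem_openSimplex _).1 h
        simp only at h1 h2 h3 h4
        exact ⟨h1, by linarith, by linarith⟩
      simp [e]
  simp_rw [h1]
  have hmeas : Measurable (Function.uncurry fun x s : ℝ =>
      {s : ℝ | 0 < x ∧ x < s ∧ s < 1}.indicator (fun s =>
        ENNReal.ofReal (x ^ (a - 1) * (s - x) ^ (b - 1)) *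
        ENNReal.ofReal (s ^ n * (1 - s) ^ (c + d + l - 1) * beta c d)) s) := by
    have hset : MeasurableSet ({w : ℝ × ℝ | 0 < w.1} ∩ ({w | w.1 < w.2} ∩ {w | w.2 < 1})) :=
      (measurableSet_lt (by fun_prop) (by fun_prop)).inter
      ((measurableSet_lt (by fun_prop) (by fun_prop)).inter
      (measurableSet_lt (by fun_prop) (by fun_prop)))
    have hf : Measurable fun w : ℝ × ℝ =>
        ENNReal.ofReal (w.1 ^ (a - 1) * (w.2 - w.1) ^ (b - 1)) *
        ENNReal.ofReal (w.2 ^ n * (1 - w.2) ^ (c + d + l - 1) * beta c d) := by fun_prop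
    exact hf.indicator hset
  rw [lintegral_lintegral_swap hmeas.aemeasurable]
  -- With the order exchanged, `x` ranges over `(0, s)` and gives the second beta integral; the
  -- third one, over `s`, carries the powers of the marginal probabilities.
  have h2 : ∀ s : ℝ, ∫⁻ x, {s : ℝ | 0 < x ∧ x < s ∧ s < 1}.indicator (fun s =>
        ENNReal.ofReal (x ^ (a - 1) * (s - x) ^ (b - 1)) *
        ENNReal.ofReal (s ^ n * (1 - s) ^ (c + d + l - 1) * beta c d)) s =
      (Set.Ioo 0 1).indicator (fun s => ENNReal.ofReal (beta a b * beta c d) *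
        ENNReal.ofReal (s ^ (a + b + n - 1) * (1 - s) ^ (c + d + l - 1))) s := by
    intro s
    by_cases hs : s ∈ Set.Ioo (0 : ℝ) 1
    · have hs0 : 0 < s := hs.1
      have h1s : 0 < 1 - s := by linarith [hs.2]
      rw [Set.indicator_of_mem hs]
      have e : ∀ x, {s : ℝ | 0 < x ∧ x < s ∧ s < 1}.indicator (fun s =>
          ENNReal.ofReal (x ^ (a - 1) * (s - x) ^ (b - 1)) *
          ENNReal.ofReal (s ^ n * (1 - s) ^ (c + d + l - 1) * beta c d)) s =
          (Set.Ioo 0 s).indicator (fun x => ENNReal.ofReal (x ^ (a - 1) * (s - x) ^ (b - 1)) *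
          ENNReal.ofReal (s ^ n * (1 - s) ^ (c + d + l - 1) * beta c d)) x := by
        intro x
        by_cases hx : x ∈ Set.Ioo 0 s
        · rw [Set.indicator_of_mem hx, Set.indicator_of_mem]
          exact ⟨hx.1, hx.2, hs.2⟩
        · rw [Set.indicator_of_notMem hx, Set.indicator_of_notMem]
          exact fun h => hx ⟨h.1, h.2.1⟩
      simp_rw [e]
      rw [lintegral_indicator measurableSet_Ioo, lintegral_mul_const' _ _ ENNReal.ofReal_ne_top,
        lintegral_Ioo_beta ha hb hs0, ← ENNReal.ofReal_mul (by positivity),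
        ← ENNReal.ofReal_mul (by positivity)]
      congr 1
      rw [show a + b + n - 1 = n + (a + b - 1) by ring, Real.rpow_add hs0]; ring
    · rw [Set.indicator_of_notMem hs]
      have e : ∀ x, {s : ℝ | 0 < x ∧ x < s ∧ s < 1}.indicator (fun s =>
          ENNReal.ofReal (x ^ (a - 1) * (s - x) ^ (b - 1)) *
          ENNReal.ofReal (s ^ n * (1 - s) ^ (c + d + l - 1) * beta c d)) s = 0 := fun x =>
        Set.indicator_of_notMem (fun h => hs ⟨h.1.trans h.2.1, h.2.2⟩) _
      simp [e]
  simp_rw [h2]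
  rw [lintegral_indicator measurableSet_Ioo, lintegral_const_mul' _ _ ENNReal.ofReal_ne_top,
    lintegral_Ioo_beta (by linarith) (by linarith) one_pos, Real.one_rpow, one_mul,
    ← ENNReal.ofReal_mul (by positivity)]

/-- The Dirichlet density up to a constant factor. -/
noncomputable def dirichletKernel (α : Fin 4 → ℝ) (θ : ℝ × ℝ × ℝ) : ℝ :=
  θ.1 ^ (α 0 - 1) * θ.2.1 ^ (α 1 - 1) * θ.2.2 ^ (α 2 - 1) *
    (1 - θ.1 - θ.2.1 - θ.2.2) ^ (α 3 - 1)

/-- The normalizing constant of `dirichletKernel`. -/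
noncomputable def dirichletConst (α : Fin 4 → ℝ) : ℝ :=
  ((∏ i, Real.Gamma (α i)) / Real.Gamma (∑ i, α i))⁻¹

lemma dirichletConst_pos {α : Fin 4 → ℝ} (hα : ∀ i, 0 < α i) : 0 < dirichletConst α := by
  have h1 : 0 < ∏ i, Real.Gamma (α i) := Finset.prod_pos fun i _ => Real.Gamma_pos_of_pos (hα i)
  have h2 : 0 < Real.Gamma (∑ i, α i) :=
    Real.Gamma_pos_of_pos (Finset.sum_pos (fun i _ => hα i) Finset.univ_nonempty)
  unfold dirichletConst; positivity

lemma measurable_dirichletKernel (α : Fin 4 → ℝ) : Measurable (dirichletKernel α) := by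
  unfold dirichletKernel; fun_prop

lemma dirichletKernel_nonneg (α : Fin 4 → ℝ) {θ : ℝ × ℝ × ℝ} (hθ : θ ∈ openSimplex) :
    0 ≤ dirichletKernel α θ := by
  obtain ⟨h1, h2, h3, h4⟩ := (mem_openSimplex θ).1 hθ
  unfold dirichletKernel; positivity

lemma marginalLikelihood_dirichletPrior {α : Fin 4 → ℝ} (hα : ∀ i, 0 < α i) {S : Type*}
    {f : ℝ × ℝ × ℝ → S → ℝ} (hf : ∀ s, Measurable fun θ => f θ s)
    (hf0 : ∀ θ s, θ ∈ openSimplex → 0 ≤ f θ s) {N : ℕ} (x : Fin N → S) {V : ℝ} (hV : 0 ≤ V)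
    (h : ∫⁻ θ in openSimplex, ENNReal.ofReal (dirichletKernel α θ * ∏ k, f θ (x k)) =
      ENNReal.ofReal V) :
    marginalLikelihood (dirichletPrior α) f x = dirichletConst α * V := by
  have hc := dirichletConst_pos hα
  have hT := measurableSet_openSimplex
  have hprod : Measurable fun θ => ∏ k, f θ (x k) := Finset.measurable_prod _ fun k _ => hf _
  have hprior : dirichletPrior α = (volume.restrict openSimplex).withDensity fun θ =>
      ENNReal.ofReal (dirichletConst α * dirichletKernel α θ) := by
    rfl
  rw [marginalLikelihood, integral_eq_lintegral_of_nonneg_ae, hprior,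
    lintegral_withDensity_eq_lintegral_mul]
  · have : ∫⁻ θ in openSimplex, ((fun θ => ENNReal.ofReal (dirichletConst α *
          dirichletKernel α θ)) * fun θ => ENNReal.ofReal (∏ k, f θ (x k))) θ =
        ENNReal.ofReal (dirichletConst α) * ENNReal.ofReal V := by
      rw [← h, ← lintegral_const_mul]
      · refine setLIntegral_congr_fun hT fun θ hθ => ?_
        have := dirichletKernel_nonneg α hθ
        simp only [Pi.mul_apply]
        rw [← ENNReal.ofReal_mul (by positivity), ← ENNReal.ofReal_mul (by positivity), mul_assoc]
      · exact ((measurable_dirichletKernel α).mul hprod).ennreal_ofReal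
    rw [this, ← ENNReal.ofReal_mul hc.le, ENNReal.toReal_ofReal (by positivity)]
  · exact ((measurable_dirichletKernel α).const_mul _).ennreal_ofReal
  · exact hprod.ennreal_ofReal
  · rw [hprior]
    refine (withDensity_absolutelyContinuous _ _).ae_le
      ((ae_restrict_iff' hT).2 (ae_of_all _ fun θ hθ => ?_))
    exact Finset.prod_nonneg fun k _ => hf0 _ _ hθ
  · exact hprod.aestronglyMeasurable

/-- The number of observations in each cell. -/
def cellCount {N : ℕ} (y : Fin N → Bool × Bool) (i : Fin 4) : ℕ :=
  Fintype.card {k // y k = cell i}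

lemma prod_eq_prod_pow_cellCount {N : ℕ} (y : Fin N → Bool × Bool) (g : Bool × Bool → ℝ) :
    ∏ k, g (y k) = g (true, true) ^ cellCount y 0 * g (true, false) ^ cellCount y 1 *
      (g (false, true) ^ cellCount y 2 * g (false, false) ^ cellCount y 3) := by
  rw [← Fintype.prod_fiberwise' y g]
  simp only [Finset.prod_const, Fintype.prod_prod_type, Fintype.prod_bool, Finset.card_univ]
  rfl

lemma sum_cellCount {N : ℕ} (y : Fin N → Bool × Bool) :
    cellCount y 0 + cellCount y 1 + cellCount y 2 + cellCount y 3 = N := by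
  have h := Fintype.sum_fiberwise' y (fun _ => (1 : ℕ))
  simp only [Finset.sum_const, Fintype.sum_prod_type, Fintype.sum_bool, Finset.card_univ,
    smul_eq_mul, mul_one, Fintype.card_fin] at h
  rw [← add_assoc] at h
  exact h

/-- Conjugacy: the counts are added to the Dirichlet parameters, and the marginal exponents of
`lintegral_openSimplex` are zero. -/
lemma marginalLikelihood_cellProb {α : Fin 4 → ℝ} (hα : ∀ i, 0 < α i) {N : ℕ}
    (y : Fin N → Bool × Bool) :
    marginalLikelihood (dirichletPrior α) cellProb y = dirichletConst α *
      (beta (α 0 + cellCount y 0) (α 1 + cellCount y 1) *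
        beta (α 2 + cellCount y 2) (α 3 + cellCount y 3) *
        beta (α 0 + cellCount y 0 + (α 1 + cellCount y 1) + 0)
          (α 2 + cellCount y 2 + (α 3 + cellCount y 3) + 0)) := by
  have hp : ∀ i, 0 < α i + cellCount y i := fun i => by have := hα i; positivity
  have b1 := beta_pos (hp 0) (hp 1)
  have b2 := beta_pos (hp 2) (hp 3)
  have b3 : 0 < beta (α 0 + cellCount y 0 + (α 1 + cellCount y 1) + 0)
          (α 2 + cellCount y 2 + (α 3 + cellCount y 3) + 0) :=
    beta_pos (by linarith [hp 0, hp 1]) (by linarith [hp 2, hp 3])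
  refine marginalLikelihood_dirichletPrior hα ?_ (fun θ s hθ => (hθ s).le) y (by positivity) ?_
  · rintro ⟨_ | _, _ | _⟩ <;> simp only [cellProb] <;> fun_prop
  · rw [← lintegral_openSimplex (hp 0) (hp 1) (hp 2) (hp 3) le_rfl le_rfl]
    refine setLIntegral_congr_fun measurableSet_openSimplex fun θ hθ => ?_
    obtain ⟨h1, h2, h3, h4⟩ := (mem_openSimplex θ).1 hθ
    have e : ∀ (r : ℝ) (i : Fin 4), 0 < r →
        r ^ (α i + cellCount y i - 1) = r ^ (α i - 1) * r ^ cellCount y i := fun r i hr => by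
      rw [← Real.rpow_natCast, ← Real.rpow_add hr]; congr 1; ring
    rw [prod_eq_prod_pow_cellCount y (cellProb θ)]
    simp only [dirichletKernel, cellProb, Real.rpow_zero, mul_one]
    rw [e _ 0 h1, e _ 1 h2, e _ 2 h3, e _ 3 h4]
    congr 1; ring

lemma measurable_cellMarginal₁ (s : Bool) : Measurable fun θ => cellMarginal₁ θ s := by
  cases s <;> simp only [cellMarginal₁, cellProb, Fintype.sum_bool] <;> fun_prop

lemma measurable_cellMarginal₂ (s : Bool) : Measurable fun θ => cellMarginal₂ θ s := by
  cases s <;> simp only [cellMarginal₂, cellProb, Fintype.sum_bool] <;> fun_prop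

/-- Here the Dirichlet parameters stay those of the prior and the counts enter only as exponents of
the marginal probabilities. -/
lemma marginalLikelihood_cellMarginal₁ {α : Fin 4 → ℝ} (hα : ∀ i, 0 < α i) {N : ℕ}
    (y : Fin N → Bool × Bool) :
    marginalLikelihood (dirichletPrior α) cellMarginal₁ (fun k => (y k).1) = dirichletConst α *
      (beta (α 0) (α 1) * beta (α 2) (α 3) *
        beta (α 0 + α 1 + (cellCount y 0 + cellCount y 1 : ℕ))
          (α 2 + α 3 + (cellCount y 2 + cellCount y 3 : ℕ))) := by
  have h0 := hα 0
  have h1 := hα 1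
  have h2 := hα 2
  have h3 := hα 3
  have b1 := beta_pos h0 h1
  have b2 := beta_pos h2 h3
  have b3 : 0 < beta (α 0 + α 1 + (cellCount y 0 + cellCount y 1 : ℕ))
          (α 2 + α 3 + (cellCount y 2 + cellCount y 3 : ℕ)) :=
    beta_pos (by positivity) (by positivity)
  refine marginalLikelihood_dirichletPrior (f := cellMarginal₁) hα
    measurable_cellMarginal₁
    (fun θ s hθ => Finset.sum_nonneg fun j _ => (hθ (s, j)).le) _ (by positivity) ?_
  · rw [← lintegral_openSimplex h0 h1 h2 h3 (Nat.cast_nonneg _) (Nat.cast_nonneg _)]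
    refine setLIntegral_congr_fun measurableSet_openSimplex fun θ hθ => ?_
    have hprod := prod_eq_prod_pow_cellCount y (fun c => cellMarginal₁ θ c.1)
    beta_reduce at hprod
    rw [hprod]
    simp only [dirichletKernel, cellMarginal₁, cellProb, Fintype.sum_bool, Real.rpow_natCast, pow_add]
    rw [show θ.2.2 + (1 - θ.1 - θ.2.1 - θ.2.2) = 1 - θ.1 - θ.2.1 by ring]

/-- Exchange of the two variables on the cell probabilities. -/
def swapCells (θ : ℝ × ℝ × ℝ) : ℝ × ℝ × ℝ := (θ.1, θ.2.2, θ.2.1)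

lemma measurePreserving_swapCells : MeasurePreserving swapCells := by
  have h : MeasurePreserving (Prod.swap : ℝ × ℝ → ℝ × ℝ) := Measure.measurePreserving_swap
  exact (MeasurePreserving.id _).prod h

/-- Exchanging the variables swaps the cells `(1,0)` and `(0,1)`, which reduces the second column to
the same integral with the two middle parameters interchanged. -/
lemma marginalLikelihood_cellMarginal₂ {α : Fin 4 → ℝ} (hα : ∀ i, 0 < α i) {N : ℕ}
    (y : Fin N → Bool × Bool) :
    marginalLikelihood (dirichletPrior α) cellMarginal₂ (fun k => (y k).2) = dirichletConst α *
      (beta (α 0) (α 2) * beta (α 1) (α 3) *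
        beta (α 0 + α 2 + (cellCount y 0 + cellCount y 2 : ℕ))
          (α 1 + α 3 + (cellCount y 1 + cellCount y 3 : ℕ))) := by
  have h0 := hα 0
  have h1 := hα 1
  have h2 := hα 2
  have h3 := hα 3
  have b1 := beta_pos h0 h2
  have b2 := beta_pos h1 h3
  have b3 : 0 < beta (α 0 + α 2 + (cellCount y 0 + cellCount y 2 : ℕ))
          (α 1 + α 3 + (cellCount y 1 + cellCount y 3 : ℕ)) :=
    beta_pos (by positivity) (by positivity)
  refine marginalLikelihood_dirichletPrior (f := cellMarginal₂) hα
    measurable_cellMarginal₂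
    (fun θ s hθ => Finset.sum_nonneg fun j _ => (hθ (j, s)).le) _ (by positivity) ?_
  · have hm : Measurable fun θ => ENNReal.ofReal
        (dirichletKernel α θ * ∏ k, cellMarginal₂ θ (y k).2) :=
      ((measurable_dirichletKernel α).mul (Finset.measurable_prod _ fun k _ =>
          measurable_cellMarginal₂ (y k).2)).ennreal_ofReal
    rw [← lintegral_openSimplex h0 h2 h1 h3 (Nat.cast_nonneg _) (Nat.cast_nonneg _),
      ← measurePreserving_swapCells.setLIntegral_comp_preimage measurableSet_openSimplex hm]
    have hpre : swapCells ⁻¹' openSimplex = openSimplex := by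
      ext θ
      simp only [Set.mem_preimage, mem_openSimplex, swapCells]
      constructor <;> rintro ⟨a, b, c, d⟩ <;> exact ⟨a, c, b, by linarith⟩
    rw [hpre]
    refine setLIntegral_congr_fun measurableSet_openSimplex fun θ hθ => ?_
    have hprod := prod_eq_prod_pow_cellCount y (fun c => cellMarginal₂ (swapCells θ) c.2)
    beta_reduce at hprod
    rw [hprod]
    simp only [dirichletKernel, cellMarginal₂, cellProb, Fintype.sum_bool, Real.rpow_natCast, pow_add, swapCells]
    rw [show θ.2.2 + (1 - θ.1 - θ.2.2 - θ.2.1) = 1 - θ.1 - θ.2.1 by ring,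
      show 1 - θ.1 - θ.2.2 - θ.2.1 = 1 - θ.1 - θ.2.1 - θ.2.2 by ring]
    congr 1; ring

lemma log_beta {a b : ℝ} (ha : 0 < a) (hb : 0 < b) :
    Real.log (beta a b) = Real.log (Real.Gamma a) + Real.log (Real.Gamma b) -
      Real.log (Real.Gamma (a + b)) := by
  have h1 := Real.Gamma_pos_of_pos ha
  have h2 := Real.Gamma_pos_of_pos hb
  have h3 := Real.Gamma_pos_of_pos (add_pos ha hb)
  rw [beta, Real.log_div (by positivity) h3.ne', Real.log_mul h1.ne' h2.ne']

/-- Closed form of the log posterior ratio under the BDe score. -/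
lemma exists_logPosteriorRatio_bdeLikelihood_eq {q : Graph → ℝ} (hq : ∀ G, 0 < q G)
    {α : Fin 4 → ℝ} (hα : ∀ i, 0 < α i) :
    ∃ K : ℝ, ∀ (N : ℕ) (y : Fin N → Bool × Bool),
      logPosteriorRatio q (bdeLikelihood α y) = K +
        ((Real.log (Real.Gamma (α 0 + cellCount y 0)) +
          Real.log (Real.Gamma (α 1 + cellCount y 1)) +
          Real.log (Real.Gamma (α 2 + cellCount y 2)) +
          Real.log (Real.Gamma (α 3 + cellCount y 3)) +
          Real.log (Real.Gamma (α 0 + α 1 + α 2 + α 3 + N))) -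
        (Real.log (Real.Gamma (α 0 + α 1 + (cellCount y 0 + cellCount y 1 : ℕ))) +
          Real.log (Real.Gamma (α 2 + α 3 + (cellCount y 2 + cellCount y 3 : ℕ))) +
          Real.log (Real.Gamma (α 0 + α 2 + (cellCount y 0 + cellCount y 2 : ℕ))) +
          Real.log (Real.Gamma (α 1 + α 3 + (cellCount y 1 + cellCount y 3 : ℕ))))) := by
  refine ⟨Real.log (q Graph.edge) - Real.log (q Graph.empty) - Real.log (dirichletConst α) -
    Real.log (beta (α 0) (α 1)) - Real.log (beta (α 2) (α 3)) -
    Real.log (beta (α 0) (α 2)) - Real.log (beta (α 1) (α 3)), fun N y => ?_⟩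
  have h0 := hα 0
  have h1 := hα 1
  have h2 := hα 2
  have h3 := hα 3
  have hD := dirichletConst_pos hα
  have E : bdeLikelihood α y Graph.edge = _ := marginalLikelihood_cellProb hα y
  have E0 : bdeLikelihood α y Graph.empty = _ := congrArg₂ (· * ·)
    (marginalLikelihood_cellMarginal₁ hα y) (marginalLikelihood_cellMarginal₂ hα y)
  have hN : (N : ℝ) = cellCount y 0 + cellCount y 1 + cellCount y 2 + cellCount y 3 := by
    exact_mod_cast (sum_cellCount y).symm
  have n0 : (0 : ℝ) ≤ cellCount y 0 := Nat.cast_nonneg _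
  have n1 : (0 : ℝ) ≤ cellCount y 1 := Nat.cast_nonneg _
  have n2 : (0 : ℝ) ≤ cellCount y 2 := Nat.cast_nonneg _
  have n3 : (0 : ℝ) ≤ cellCount y 3 := Nat.cast_nonneg _
  push_cast at E0 ⊢
  rw [add_zero, add_zero] at E
  -- The outer beta function of each of the three likelihoods has this same total: one `Γ(A)` in the
  -- joint denominator against two for the columns leaves one in the numerator of the ratio.
  set A : ℝ := α 0 + α 1 + α 2 + α 3 + N with hA
  have a1 : α 0 + cellCount y 0 + (α 1 + cellCount y 1) +
      (α 2 + cellCount y 2 + (α 3 + cellCount y 3)) = A := by rw [hA, hN]; ring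
  have a2 : α 0 + α 1 + (cellCount y 0 + cellCount y 1) +
      (α 2 + α 3 + (cellCount y 2 + cellCount y 3)) = A := by rw [hA, hN]; ring
  have a3 : α 0 + α 2 + (cellCount y 0 + cellCount y 2) +
      (α 1 + α 3 + (cellCount y 1 + cellCount y 3)) = A := by rw [hA, hN]; ring
  generalize (cellCount y 0 : ℝ) = m0 at *
  generalize (cellCount y 1 : ℝ) = m1 at *
  generalize (cellCount y 2 : ℝ) = m2 at *
  generalize (cellCount y 3 : ℝ) = m3 at *
  have p1 := beta_pos (α := α 0 + m0) (β := α 1 + m1) (by positivity) (by positivity)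
  have p2 := beta_pos (α := α 2 + m2) (β := α 3 + m3) (by positivity) (by positivity)
  have p3 := beta_pos (α := α 0 + m0 + (α 1 + m1)) (β := α 2 + m2 + (α 3 + m3))
    (by positivity) (by positivity)
  have p4 := beta_pos h0 h1
  have p5 := beta_pos h2 h3
  have p6 := beta_pos h0 h2
  have p7 := beta_pos h1 h3
  have p8 := beta_pos (α := α 0 + α 1 + (m0 + m1)) (β := α 2 + α 3 + (m2 + m3))
    (by positivity) (by positivity)
  have p9 := beta_pos (α := α 0 + α 2 + (m0 + m2)) (β := α 1 + α 3 + (m1 + m3))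
    (by positivity) (by positivity)
  have hE : 0 < bdeLikelihood α y Graph.edge := by rw [E]; positivity
  have hE0 : 0 < bdeLikelihood α y Graph.empty := by rw [E0]; positivity
  rw [logPosteriorRatio_eq hq (fun G => by cases G <;> assumption), E, E0,
    Real.log_mul (by positivity) (by positivity), Real.log_mul (by positivity) (by positivity),
    Real.log_mul (by positivity) (by positivity), Real.log_mul (by positivity) (by positivity),
    Real.log_mul (by positivity) (by positivity), Real.log_mul (by positivity) (by positivity),
    Real.log_mul (by positivity) (by positivity), Real.log_mul (by positivity) (by positivity),
    Real.log_mul (by positivity) (by positivity), Real.log_mul (by positivity) (by positivity),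
    log_beta (a := α 0 + m0) (b := α 1 + m1) (by positivity) (by positivity),
    log_beta (a := α 2 + m2) (b := α 3 + m3) (by positivity) (by positivity),
    log_beta (a := α 0 + m0 + (α 1 + m1)) (b := α 2 + m2 + (α 3 + m3))
      (by positivity) (by positivity),
    log_beta (a := α 0 + α 1 + (m0 + m1)) (b := α 2 + α 3 + (m2 + m3))
      (by positivity) (by positivity),
    log_beta (a := α 0 + α 2 + (m0 + m2)) (b := α 1 + α 3 + (m1 + m3))
      (by positivity) (by positivity), a1, a2, a3]
  ring

/-! ### Stirling bounds and the empirical mutual information. -/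

/-- A crude form of Stirling's formula, uniform in the integer part of the argument. -/
lemma exists_abs_log_Gamma_add_sub_le {a : ℝ} (ha : 0 < a) :
    ∃ C : ℝ, 0 ≤ C ∧ ∀ n : ℕ, |Real.log (Real.Gamma (a + n)) - (n * Real.log n - n)| ≤
      C * (1 + Real.log n) := by
  set ψ : ℕ → ℝ := fun n => Real.log (Real.Gamma (a + n)) - (n * Real.log n - n) with hψ
  -- The increment of `ψ` is `log (1 + a / n) - ((n + 1) log (1 + 1 / n) - 1)`, both parts of size
  -- at most a constant times `1 / n`. Since `1 / n ≤ 2 (log (n + 1) - log n)`, the bounds telescope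
  -- to a multiple of `log n`.
  have step : ∀ n : ℕ, 1 ≤ n →
      |ψ (n + 1)| ≤ |ψ n| + 2 * (a + 1) * (Real.log (n + 1 : ℕ) - Real.log n) := by
    intro n hn
    have hn' : (1 : ℝ) ≤ n := by exact_mod_cast hn
    have hn0 : (0 : ℝ) < n := by linarith
    have hG : 0 < Real.Gamma (a + n) := Real.Gamma_pos_of_pos (by linarith)
    have e1 : Real.log (Real.Gamma (a + (n + 1 : ℕ))) =
        Real.log (a + n) + Real.log (Real.Gamma (a + n)) := by
      push_cast
      rw [← add_assoc, Real.Gamma_add_one (by linarith), Real.log_mul (by linarith) hG.ne']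
    set δ := Real.log (n + 1 : ℕ) - Real.log n with hδ
    have hδ' : δ = Real.log (1 + (n : ℝ)⁻¹) := by
      rw [hδ, ← Real.log_div (by positivity) hn0.ne']; congr 1; push_cast; field_simp
    have d1 : δ ≤ (n : ℝ)⁻¹ := by
      rw [hδ']; have := Real.log_le_sub_one_of_pos (x := 1 + (n : ℝ)⁻¹) (by positivity); linarith
    have d2 : ((n : ℝ) + 1)⁻¹ ≤ δ := by
      rw [hδ']
      have := Real.one_sub_inv_le_log_of_pos (x := 1 + (n : ℝ)⁻¹) (by positivity)
      have e : 1 - (1 + (n : ℝ)⁻¹)⁻¹ = ((n : ℝ) + 1)⁻¹ := by field_simp; ring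
      linarith
    have g1 : 0 ≤ Real.log (a + n) - Real.log n :=
      sub_nonneg.2 (Real.log_le_log hn0 (by linarith))
    have g2 : Real.log (a + n) - Real.log n ≤ a * (n : ℝ)⁻¹ := by
      rw [← Real.log_div (by positivity) hn0.ne']
      have := Real.log_le_sub_one_of_pos (x := (a + n) / n) (by positivity)
      have e : (a + n) / n - 1 = a * (n : ℝ)⁻¹ := by field_simp; ring
      linarith
    have hstep : ψ (n + 1) - ψ n = (Real.log (a + n) - Real.log n) - ((n + 1) * δ - 1) := by
      simp only [hψ, e1, hδ]; push_cast; ring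
    have q1 : 0 ≤ (n + 1) * δ - 1 := by
      have := mul_le_mul_of_nonneg_left d2 (by positivity : (0 : ℝ) ≤ n + 1)
      rw [mul_inv_cancel₀ (by positivity)] at this
      linarith
    have q2 : (n + 1) * δ - 1 ≤ (n : ℝ)⁻¹ := by
      have := mul_le_mul_of_nonneg_left d1 (by positivity : (0 : ℝ) ≤ n + 1)
      have e : ((n : ℝ) + 1) * (n : ℝ)⁻¹ = 1 + (n : ℝ)⁻¹ := by field_simp
      linarith
    have d3 : (n : ℝ)⁻¹ ≤ 2 * δ := by
      have : (n : ℝ)⁻¹ ≤ 2 * ((n : ℝ) + 1)⁻¹ := by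
        rw [inv_eq_one_div, ← div_eq_mul_inv, div_le_div_iff₀ hn0 (by positivity)]; linarith
      linarith
    have hd : |ψ (n + 1) - ψ n| ≤ 2 * (a + 1) * δ := by
      have hinv : 0 ≤ (n : ℝ)⁻¹ := by positivity
      have hb : a * (n : ℝ)⁻¹ ≤ a * (2 * δ) := mul_le_mul_of_nonneg_left d3 ha.le
      have hc : 0 ≤ a * (n : ℝ)⁻¹ := by positivity
      rw [hstep, abs_le]
      constructor <;> linarith
    have := abs_add_le (ψ n) (ψ (n + 1) - ψ n)
    rw [add_sub_cancel] at this
    linarith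
  have bound : ∀ n : ℕ, 1 ≤ n → |ψ n| ≤ |ψ 1| + 2 * (a + 1) * Real.log n := by
    intro n hn
    induction n, hn using Nat.le_induction with
    | base => simp
    | succ n hn ih =>
      have := step n hn
      linarith
  -- The term `|ψ 0|` serves `n = 0`, an empty cell, where `log 0 = 0` by convention.
  refine ⟨|ψ 0| + |ψ 1| + 2 * (a + 1), by positivity, fun n => ?_⟩
  change |ψ n| ≤ _
  have p0 := abs_nonneg (ψ 0)
  have p1 := abs_nonneg (ψ 1)
  rcases Nat.eq_zero_or_pos n with rfl | hn
  · simp; linarith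
  · have hl : 0 ≤ Real.log n := Real.log_natCast_nonneg n
    have := bound n hn
    have h1 : 0 ≤ (|ψ 0| + |ψ 1|) * Real.log n := by positivity
    rw [mul_one_add, add_mul]
    linarith

/-- The mutual information of a pair of binary variables as a function of the cell
probabilities. -/
noncomputable def mutualInfo (v : Fin 4 → ℝ) : ℝ :=
  Real.negMulLog (v 0 + v 1) + Real.negMulLog (v 2 + v 3) +
    Real.negMulLog (v 0 + v 2) + Real.negMulLog (v 1 + v 3) -
    (Real.negMulLog (v 0) + Real.negMulLog (v 1) + Real.negMulLog (v 2) + Real.negMulLog (v 3))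

lemma continuous_mutualInfo : Continuous mutualInfo := by
  unfold mutualInfo
  have h := Real.continuous_negMulLog
  have c : ∀ i : Fin 4, Continuous fun v : Fin 4 → ℝ => v i := fun i => continuous_apply i
  exact ((((h.comp ((c 0).add (c 1))).add (h.comp ((c 2).add (c 3)))).add
    (h.comp ((c 0).add (c 2)))).add (h.comp ((c 1).add (c 3)))).sub
    ((((h.comp (c 0)).add (h.comp (c 1))).add (h.comp (c 2))).add (h.comp (c 3)))

lemma negMulLog_le_one {x : ℝ} (hx : 0 ≤ x) : Real.negMulLog x ≤ 1 := by
  rcases hx.eq_or_lt with rfl | hx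
  · simp
  · have h := Real.one_sub_inv_le_log_of_pos hx
    have := mul_le_mul_of_nonneg_left h hx.le
    rw [mul_sub, mul_inv_cancel₀ hx.ne'] at this
    rw [Real.negMulLog]
    linarith

lemma abs_mutualInfo_le {v : Fin 4 → ℝ} (hv : ∀ i, 0 ≤ v i) (hs : v 0 + v 1 + v 2 + v 3 ≤ 1) :
    |mutualInfo v| ≤ 4 := by
  have h0 := hv 0
  have h1 := hv 1
  have h2 := hv 2
  have h3 := hv 3
  have b : ∀ x : ℝ, 0 ≤ x → x ≤ 1 → 0 ≤ Real.negMulLog x ∧ Real.negMulLog x ≤ 1 :=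
    fun x h h' => ⟨Real.negMulLog_nonneg h h', negMulLog_le_one h⟩
  obtain ⟨_, _⟩ := b (v 0) h0 (by linarith)
  obtain ⟨_, _⟩ := b (v 1) h1 (by linarith)
  obtain ⟨_, _⟩ := b (v 2) h2 (by linarith)
  obtain ⟨_, _⟩ := b (v 3) h3 (by linarith)
  obtain ⟨_, _⟩ := b (v 0 + v 1) (by linarith) (by linarith)
  obtain ⟨_, _⟩ := b (v 2 + v 3) (by linarith) (by linarith)
  obtain ⟨_, _⟩ := b (v 0 + v 2) (by linarith) (by linarith)
  obtain ⟨_, _⟩ := b (v 1 + v 3) (by linarith) (by linarith)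
  rw [abs_le, mutualInfo]
  constructor <;> linarith

/-- Turns counts into frequencies, with empty cells included; the multiples of `log N` cancel
because the counts sum to `N`. -/
lemma mul_log_eq {N : ℕ} (hN : N ≠ 0) (r : ℝ) :
    r * Real.log r = r * Real.log N - N * Real.negMulLog (r / N) := by
  have hN' : (N : ℝ) ≠ 0 := by exact_mod_cast hN
  rcases eq_or_ne r 0 with rfl | hr
  · simp
  · rw [Real.negMulLog, Real.log_div hr hN']; field_simp; ring

/-- The log posterior ratio under the BDe score is `N` times the mutual information of the empirical
distribution, up to a logarithmic error. -/
lemma exists_abs_logPosteriorRatio_bde_sub_le {q : Graph → ℝ} (hq : ∀ G, 0 < q G)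
    {α : Fin 4 → ℝ} (hα : ∀ i, 0 < α i) :
    ∃ C : ℝ, ∀ (N : ℕ), N ≠ 0 → ∀ y : Fin N → Bool × Bool,
      |1 / (N : ℝ) * logPosteriorRatio q (bdeLikelihood α y) -
        mutualInfo (fun i => cellCount y i / N)| ≤ C * ((1 + Real.log N) / N) := by
  obtain ⟨K, hK⟩ := exists_logPosteriorRatio_bdeLikelihood_eq hq hα
  have h0 := hα 0
  have h1 := hα 1
  have h2 := hα 2
  have h3 := hα 3
  obtain ⟨C0, p0, s0⟩ := exists_abs_log_Gamma_add_sub_le h0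
  obtain ⟨C1, p1, s1⟩ := exists_abs_log_Gamma_add_sub_le h1
  obtain ⟨C2, p2, s2⟩ := exists_abs_log_Gamma_add_sub_le h2
  obtain ⟨C3, p3, s3⟩ := exists_abs_log_Gamma_add_sub_le h3
  obtain ⟨C4, p4, s4⟩ := exists_abs_log_Gamma_add_sub_le
    (by positivity : 0 < α 0 + α 1 + α 2 + α 3)
  obtain ⟨C5, p5, s5⟩ := exists_abs_log_Gamma_add_sub_le (by positivity : 0 < α 0 + α 1)
  obtain ⟨C6, p6, s6⟩ := exists_abs_log_Gamma_add_sub_le (by positivity : 0 < α 2 + α 3)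
  obtain ⟨C7, p7, s7⟩ := exists_abs_log_Gamma_add_sub_le (by positivity : 0 < α 0 + α 2)
  obtain ⟨C8, p8, s8⟩ := exists_abs_log_Gamma_add_sub_le (by positivity : 0 < α 1 + α 3)
  refine ⟨|K| + (C0 + C1 + C2 + C3 + C4 + C5 + C6 + C7 + C8), fun N hN y => ?_⟩
  have hNpos : (0 : ℝ) < N := by positivity
  have hsum := sum_cellCount y
  have hL : 0 ≤ Real.log N := Real.log_natCast_nonneg N
  have mono : ∀ {C : ℝ} {n : ℕ}, 0 ≤ C → n ≤ N →
      C * (1 + Real.log n) ≤ C * (1 + Real.log N) := by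
    intro C n hC hn
    refine mul_le_mul_of_nonneg_left (add_le_add_right ?_ _) hC
    rcases Nat.eq_zero_or_pos n with rfl | hn0
    · simpa using hL
    · exact Real.log_le_log (by positivity) (by exact_mod_cast hn)
  have t0 := (s0 (cellCount y 0)).trans (mono p0 (by omega))
  have t1 := (s1 (cellCount y 1)).trans (mono p1 (by omega))
  have t2 := (s2 (cellCount y 2)).trans (mono p2 (by omega))
  have t3 := (s3 (cellCount y 3)).trans (mono p3 (by omega))
  have t4 := (s4 N).trans (mono p4 le_rfl)
  have t5 := (s5 (cellCount y 0 + cellCount y 1)).trans (mono p5 (by omega))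
  have t6 := (s6 (cellCount y 2 + cellCount y 3)).trans (mono p6 (by omega))
  have t7 := (s7 (cellCount y 0 + cellCount y 2)).trans (mono p7 (by omega))
  have t8 := (s8 (cellCount y 1 + cellCount y 3)).trans (mono p8 (by omega))
  have key : N * (1 / (N : ℝ) * logPosteriorRatio q (bdeLikelihood α y) -
        mutualInfo (fun i => cellCount y i / N)) =
      logPosteriorRatio q (bdeLikelihood α y) -
        N * mutualInfo (fun i => cellCount y i / N) := by field_simp
  have hs : (cellCount y 0 + cellCount y 1 + cellCount y 2 + cellCount y 3 : ℝ) = N := by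
    exact_mod_cast hsum
  have hmi : (N : ℝ) * mutualInfo (fun i => cellCount y i / N) =
      ((cellCount y 0 : ℕ) * Real.log (cellCount y 0 : ℕ) +
        (cellCount y 1 : ℕ) * Real.log (cellCount y 1 : ℕ) +
        (cellCount y 2 : ℕ) * Real.log (cellCount y 2 : ℕ) +
        (cellCount y 3 : ℕ) * Real.log (cellCount y 3 : ℕ) + N * Real.log N) -
      ((cellCount y 0 + cellCount y 1 : ℕ) * Real.log (cellCount y 0 + cellCount y 1 : ℕ) +
        (cellCount y 2 + cellCount y 3 : ℕ) * Real.log (cellCount y 2 + cellCount y 3 : ℕ) +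
        (cellCount y 0 + cellCount y 2 : ℕ) * Real.log (cellCount y 0 + cellCount y 2 : ℕ) +
        (cellCount y 1 + cellCount y 3 : ℕ) * Real.log (cellCount y 1 + cellCount y 3 : ℕ)) := by
    rw [mul_log_eq hN (cellCount y 0 : ℕ), mul_log_eq hN (cellCount y 1 : ℕ),
      mul_log_eq hN (cellCount y 2 : ℕ), mul_log_eq hN (cellCount y 3 : ℕ),
      mul_log_eq hN (cellCount y 0 + cellCount y 1 : ℕ),
      mul_log_eq hN (cellCount y 2 + cellCount y 3 : ℕ),
      mul_log_eq hN (cellCount y 0 + cellCount y 2 : ℕ),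
      mul_log_eq hN (cellCount y 1 + cellCount y 3 : ℕ), mutualInfo]
    push_cast
    rw [add_div, add_div, add_div, add_div]
    linear_combination Real.log N * hs
  have habs : |logPosteriorRatio q (bdeLikelihood α y) -
        N * mutualInfo (fun i => cellCount y i / N)| ≤
      (|K| + (C0 + C1 + C2 + C3 + C4 + C5 + C6 + C7 + C8)) * (1 + Real.log N) := by
    rw [hK N y, hmi]
    have k1 := le_abs_self K
    have k2 := neg_abs_le K
    have k3 : 0 ≤ |K| * Real.log N := by positivity
    have hcast1 : ((cellCount y 0 + cellCount y 1 : ℕ) : ℝ) = cellCount y 0 + cellCount y 1 := by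
      push_cast; ring
    have hcast2 : ((cellCount y 2 + cellCount y 3 : ℕ) : ℝ) = cellCount y 2 + cellCount y 3 := by
      push_cast; ring
    have hcast3 : ((cellCount y 0 + cellCount y 2 : ℕ) : ℝ) = cellCount y 0 + cellCount y 2 := by
      push_cast; ring
    have hcast4 : ((cellCount y 1 + cellCount y 3 : ℕ) : ℝ) = cellCount y 1 + cellCount y 3 := by
      push_cast; ring
    have expand : (|K| + (C0 + C1 + C2 + C3 + C4 + C5 + C6 + C7 + C8)) * (1 + Real.log N) =
        |K| + |K| * Real.log N + (C0 * (1 + Real.log N) + C1 * (1 + Real.log N) +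
        C2 * (1 + Real.log N) + C3 * (1 + Real.log N) + C4 * (1 + Real.log N) +
        C5 * (1 + Real.log N) + C6 * (1 + Real.log N) + C7 * (1 + Real.log N) +
        C8 * (1 + Real.log N)) := by ring
    rw [expand]
    rw [abs_le] at t0 t1 t2 t3 t4 t5 t6 t7 t8 ⊢
    obtain ⟨a0, b0⟩ := t0
    obtain ⟨a1, b1⟩ := t1
    obtain ⟨a2, b2⟩ := t2
    obtain ⟨a3, b3⟩ := t3
    obtain ⟨a4, b4⟩ := t4
    obtain ⟨a5, b5⟩ := t5
    obtain ⟨a6, b6⟩ := t6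
    obtain ⟨a7, b7⟩ := t7
    obtain ⟨a8, b8⟩ := t8
    -- The linear terms of Stirling's formula cancel: the cell counts and `N` contribute `-2 N`, the
    -- two pairs of marginal counts `+2 N`.
    constructor <;> linarith
  rw [← key, abs_mul, abs_of_pos hNpos] at habs
  rw [← mul_div_assoc, le_div_iff₀ hNpos, mul_comm]
  exact habs

/-! ### The BDe limit and its value. -/

lemma sampleMean_cellIndicator (m : ℝ) {N : ℕ} (x : Fin N → ℝ × ℝ) (i : Fin 4) :
    sampleMean (cellIndicator m i) x = cellCount (fun k => discretize m (x k)) i / N := by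
  simp only [sampleMean, cellIndicator, cellCount, Fintype.card_subtype]
  rw [Finset.sum_boole]

/-- The sum over tables is an integral for the pushforward of the sample law; as an integral over
samples it falls under `tendsto_integral_of_sampleMean`. -/
lemma discRatio_eq_integral (q : Graph → ℝ) (α : Fin 4 → ℝ) (m : ℝ) (P : Measure (ℝ × ℝ))
    [IsProbabilityMeasure P] (N : ℕ) :
    discRatio q α m P N = ∫ x : Fin N → ℝ × ℝ, 1 / (N : ℝ) *
      logPosteriorRatio q (bdeLikelihood α fun k => discretize m (x k)) ∂(sampleLaw P N) := by
  have hd : Measurable fun (x : Fin N → ℝ × ℝ) k => discretize m (x k) :=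
    measurable_pi_lambda _ fun k => (measurable_discretize m).comp (measurable_pi_apply k)
  have hprob : IsProbabilityMeasure
      ((sampleLaw P N).map fun (x : Fin N → ℝ × ℝ) k => discretize m (x k)) :=
    Measure.isProbabilityMeasure_map hd.aemeasurable
  rw [integral_const_mul, discRatio,
    ← integral_map (f := fun y => logPosteriorRatio q (bdeLikelihood α y)) hd.aemeasurable
      (Measurable.of_discrete).aestronglyMeasurable, integral_fintype Integrable.of_finite]
  congr 1
  refine Finset.sum_congr rfl fun y _ => ?_
  rw [map_measureReal_apply hd (measurableSet_singleton y), smul_eq_mul, mul_comm]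
  congr 2
  ext x
  simp [funext_iff]

/-- Limit of the normalized expected log posterior ratio under the BDe score. -/
theorem tendsto_discRatio {q : Graph → ℝ} (hq : ∀ G, 0 < q G) {α : Fin 4 → ℝ}
    (hα : ∀ i, 0 < α i) (m : ℝ) (P : Measure (ℝ × ℝ)) [IsProbabilityMeasure P] :
    Tendsto (fun N : ℕ => discRatio q α m P N) atTop
      (𝓝 (mutualInfo fun i => ∫ s, cellIndicator m i s ∂P)) := by
  obtain ⟨C, hC⟩ := exists_abs_logPosteriorRatio_bde_sub_le hq hα
  have hc : Tendsto (fun N : ℕ => C * ((1 + Real.log N) / N)) atTop (𝓝 0) := by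
    simpa using tendsto_one_add_log_div_atTop.const_mul C
  have hd : ∀ N, Measurable fun (x : Fin N → ℝ × ℝ) k => discretize m (x k) := fun N =>
    measurable_pi_lambda _ fun k => (measurable_discretize m).comp (measurable_pi_apply k)
  have main := tendsto_integral_of_sampleMean (P := P) (φ := cellIndicator m)
    (fun i => memLp_cellIndicator m i P)
    (F := fun N x => 1 / (N : ℝ) *
      logPosteriorRatio q (bdeLikelihood α fun k => discretize m (x k)))
    (fun N => (((Measurable.of_discrete (f := fun y : Fin N → Bool × Bool =>
      logPosteriorRatio q (bdeLikelihood α y))).comp (hd N)).const_mul _).aestronglyMeasurable)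
    (H := fun w => mutualInfo w.2) (continuous_mutualInfo.comp continuous_snd).continuousAt hc
    (fun N hN x => by
      simp only [sampleMean_cellIndicator]
      exact hC N hN _)
    (C := 4)
    (fun N hN x => by
      have hNpos : (0 : ℝ) < N := by positivity
      have hs : (cellCount (fun k => discretize m (x k)) 0 +
          cellCount (fun k => discretize m (x k)) 1 + cellCount (fun k => discretize m (x k)) 2 +
          cellCount (fun k => discretize m (x k)) 3 : ℝ) = N := by
        exact_mod_cast sum_cellCount (fun k => discretize m (x k))
      have hlog : 0 ≤ Real.log N := Real.log_natCast_nonneg N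
      have h1 : |mutualInfo fun i => sampleMean (cellIndicator m i) x| ≤ 4 := by
        simp only [sampleMean_cellIndicator]
        refine abs_mutualInfo_le (fun i => by positivity) ?_
        rw [← add_div, ← add_div, ← add_div, hs, div_self hNpos.ne']
      have h2 : 0 ≤ ∑ i, |sampleMean (cellIndicator m i) x| :=
        Finset.sum_nonneg fun i _ => abs_nonneg _
      refine h1.trans ?_
      calc (4 : ℝ) = 4 * 1 * 1 := by norm_num
        _ ≤ 4 * (1 + Real.log N) * (1 + ∑ i, |sampleMean (cellIndicator m i) x|) := by
          gcongr <;> linarith)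
  refine main.2.congr fun N => (discRatio_eq_integral q α m P N).symm

lemma mutualInfo_symmetric {p : ℝ} :
    mutualInfo ![p, 1 / 2 - p, 1 / 2 - p, p] =
      Real.log 4 + 2 * p * Real.log p + (1 - 2 * p) * Real.log (1 / 2 - p) := by
  have h4 : Real.log 4 = 2 * Real.log 2 := by
    rw [show (4 : ℝ) = 2 ^ 2 by norm_num, Real.log_pow]; norm_num
  have h2 : Real.log (1 / 2) = -Real.log 2 := by rw [one_div, Real.log_inv]
  simp only [mutualInfo, Matrix.cons_val]
  -- All four marginal probabilities equal `1 / 2`, so the marginal entropies add up to `log 4`.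
  rw [add_sub_cancel, sub_add_cancel, h4]
  simp only [Real.negMulLog, h2]
  ring

end HybridBN

theorem theorem3
    (p : unitInterval) (hp : (p : ℝ) = 1 / 2) (μ₂ β σ₂ : ℝ) (hσ : 0 < σ₂)
    (q : Graph → ℝ) (hq : ∀ G, 0 < q G)
    (αμ αw t : ℝ) (hαμ : 0 < αμ) (hαw : 3 < αw) (ht : 0 < t)
    (α : Fin 4 → ℝ) (hα : ∀ i, 0 < α i)
    (m : ℝ) (hm : IsMedian (sdcLaw p μ₂ β σ₂).snd m)
    (p₁₁ : ℝ)
    (hp₁₁ : p₁₁ = 1 / 2 * ∫ x in Set.Ioi (-(β / (2 * σ₂))),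
      1 / √(2 * Real.pi) * Real.exp (-(x ^ 2 / 2))) :
    (∀ N : ℕ, Integrable
        (fun x : Fin N → ℝ × ℝ => logPosteriorRatio q (bgeLikelihood αμ αw t x))
        (sampleLaw (sdcLaw p μ₂ β σ₂) N)) ∧
      Tendsto (fun N : ℕ => ragRatio q αμ αw t (sdcLaw p μ₂ β σ₂) N) atTop
        (𝓝 (1 / 2 * Real.log (1 + β ^ 2 / (4 * σ₂ ^ 2)))) ∧
      Tendsto (fun N : ℕ => discRatio q α m (sdcLaw p μ₂ β σ₂) N) atTop
        (𝓝 (Real.log 4 + 2 * p₁₁ * Real.log p₁₁ +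
          (1 - 2 * p₁₁) * Real.log (1 / 2 - p₁₁))) := by
  obtain ⟨hint, hrag⟩ := ragRatio_sdcLaw hp μ₂ β hσ hq hαμ hαw ht
  refine ⟨hint, hrag, ?_⟩
  -- The BDe limit holds for any cutting point; the median is needed only to make the table
  -- symmetric.
  obtain rfl := eq_of_isMedian μ₂ β hp hσ hm
  have hcells : (fun i => ∫ s, cellIndicator (μ₂ + β / 2) i s ∂(sdcLaw p μ₂ β σ₂)) =
      ![p₁₁, 1 / 2 - p₁₁, 1 / 2 - p₁₁, p₁₁] := by
    rw [hp₁₁, ← normalTail_eq_integral]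
    exact funext fun i => integral_cellIndicator μ₂ β hp hσ i
  have h := tendsto_discRatio hq hα (μ₂ + β / 2) (sdcLaw p μ₂ β σ₂)
  rwa [hcells, mutualInfo_symmetric] at h
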